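/- Let $\Lambda$ be an associative ring with unit, $I$ a two-sided ideal of $\Lambda$ and $n\ge 2$. Let $\Gamma$ be the ring of $n\times n$ matrices with entries in $\Lambda$ on and below the diagonal and entries in $I$ above the diagonal, let $f\in\Gamma$ be the diagonal idempotent with entry $1$ in position $(n,n)$, and let $\Sigma$ be the ring of lower triangular $(n-1)\times(n-1)$ matrices over $\Lambda/I$. Then $\Sigma\cong\Gamma/\Gamma f\Gamma$ (delete the last row and column and reduce modulo $I$) and $\Lambda\cong f\Gamma f$. Let $\mathsf i\colon \mathrm{Mod}\,\Sigma\to\mathrm{Mod}\,\Gamma$ be restriction along $\Gamma\to\Sigma$ and $\mathsf e=f(-)\colon \mathrm{Mod}\,\Gamma\to\mathrm{Mod}\,\Lambda$ (left modules). These functors are part of a recollement $(\mathrm{Mod}\,\Sigma,\mathrm{Mod}\,\Gamma,\mathrm{Mod}\,\Lambda)$, that is, there are adjoint triples $(\mathsf q,\mathsf i,\mathsf p)$ and $(\mathsf l,\mathsf e,\mathsf r)$ with $\mathsf i,\mathsf l,\mathsf r$ fully faithful and $\operatorname{Im}\mathsf i=\operatorname{Ker}\mathsf e$. Its $l$-height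 is at least $k$ if there are functors $\mathsf l^{k-1},\dots,\mathsf l^1,\mathsf l^0=\mathsf l$ with $\mathsf l^{j+1}$ left adjoint to $\mathsf l^j$; its $r$-height is at least $k$ if there are functors $\mathsf r^0=\mathsf r,\mathsf r^1,\dots,\mathsf r^{k-1}$ with $\mathsf r^{j+1}$ right adjoint to $\mathsf r^j$. (i) The recollement is homological, i.e. $\mathsf i$ induces isomorphisms $\mathrm{Ext}^k_\Sigma(X,Y)\to\mathrm{Ext}^k_\Gamma(\mathsf iX,\mathsf iY)$ for all $X,Y$ and all $k\ge 0$; it has $l$-height at least one and $r$-height at least three. (ii) If $I$ is projective neither as a left nor as a right $\Lambda$-module, then the $l$-height is exactly one and the $r$-height is exactly three. (iii) If ${}_\Lambda I$ is finitely generated and projective, then the $l$-height is at least one and the $r$-height is at least four. (iv) If $I_\Lambda$ is finitely generated and projective, then the $l$-height is at least two and the $r$-height is at least three. (v) The exact functors $\mathsf i$ and $\mathsf e$ induce a recollement $(\mathsf D(\mathrm{Mod}\,\Sigma),\mathsf D(\mathrm{Mod}\,\Gamma),\mathsf D(\mathrm{Mod}\,\Lambda))$ of unbounded derived categories. Consider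 ladders going downwards from it: diagrams of $h+2$ consecutive rows of triangle functors, starting with the three rows of the given recollement, in which any three consecutive rows form a recollement; such a ladder has height $h$. If there is such a ladder of height at least four, then ${}_\Lambda I$ has finite projective dimension. Conversely, if ${}_\Lambda I$ has finite projective dimension and has a resolution by finitely generated projective left $\Lambda$-modules (as it always does when $\Lambda$ is left noetherian), then there is such a ladder of height at least four. -/

import Mathlib

open CategoryTheory CategoryTheory.Limits

universe u v w

noncomputable section

/-! ### Recollements and ladders -/

/-- The recollement `(A, B, C)` with given middle functors `i : A ⥤ B` and `e : B ⥤ C`: adjoint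
triples `(q, i, p)` and `(l, e, r)` with `i`, `l`, `r` fully faithful and `Im i = Ker e`, where
`Im i` is the essential image.
(The six functors are automatically additive if `i` and `e` are.) -/
structure Recollement {A B C : Type u} [Category.{v} A] [Category.{v} B] [Category.{v} C]
    (i : A ⥤ B) (e : B ⥤ C) where
  q : B ⥤ A
  p : B ⥤ A
  l : C ⥤ B
  r : C ⥤ B
  adj_q_i : q ⊣ i
  adj_i_p : i ⊣ p
  adj_l_e : l ⊣ e
  adj_e_r : e ⊣ r
  full_i : i.Full
  faithful_i : i.Faithful
  full_l : l.Full
  faithful_l : l.Faithful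
  full_r : r.Full
  faithful_r : r.Faithful
  image_eq_kernel : ∀ X : B, i.essImage X ↔ IsZero (e.obj X)

/-- `F` has `n` consecutive left adjoints `Fₙ ⊣ ⋯ ⊣ F₁ ⊣ F₀ = F`. -/
def HasLeftAdjoints : (n : ℕ) → {C D : Type u} → [Category.{v} C] → [Category.{v} D] →
    (C ⥤ D) → Prop
  | 0, _, _, _, _, _ => True
  | n + 1, C, D, _, _, F => ∃ G : D ⥤ C, Nonempty (G ⊣ F) ∧ HasLeftAdjoints n G

/-- `F` has `n` consecutive right adjoints `F = F₀ ⊣ F₁ ⊣ ⋯ ⊣ Fₙ`. -/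
def HasRightAdjoints : (n : ℕ) → {C D : Type u} → [Category.{v} C] → [Category.{v} D] →
    (C ⥤ D) → Prop
  | 0, _, _, _, _, _ => True
  | n + 1, C, D, _, _, F => ∃ G : D ⥤ C, Nonempty (F ⊣ G) ∧ HasRightAdjoints n G

namespace Recollement

variable {A B C : Type u} [Category.{v} A] [Category.{v} B] [Category.{v} C]
  {i : A ⥤ B} {e : B ⥤ C}

/-- The recollement has a ladder of `l`-height at least `n` (for `n ≥ 1`): there is a tuple
`(lⁿ⁻¹, …, l¹, l⁰)` of consecutive left adjoints with `l⁰ = l`. -/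
def LHeightAtLeast (R : Recollement i e) (n : ℕ) : Prop := HasLeftAdjoints (n - 1) R.l

/-- The recollement has a ladder of `r`-height at least `n` (for `n ≥ 1`): there is a tuple
`(r⁰, r¹, …, rⁿ⁻¹)` of consecutive right adjoints with `r⁰ = r`. -/
def RHeightAtLeast (R : Recollement i e) (n : ℕ) : Prop := HasRightAdjoints (n - 1) R.r

/-- The `l`-height is exactly `n`. -/
def LHeightExactly (R : Recollement i e) (n : ℕ) : Prop :=
  R.LHeightAtLeast n ∧ ¬ R.LHeightAtLeast (n + 1)

/-- The `r`-height is exactly `n`. -/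
def RHeightExactly (R : Recollement i e) (n : ℕ) : Prop :=
  R.RHeightAtLeast n ∧ ¬ R.RHeightAtLeast (n + 1)

end Recollement

/-- An exact functor is a homological embedding if it induces isomorphisms on all `Ext`-groups. -/
def IsHomologicalEmbedding {A B : Type u} [Category.{v} A] [Category.{v} B] [Abelian A] [Abelian B]
    [HasExt.{w} A] [HasExt.{w} B] (F : A ⥤ B) [F.Additive] [PreservesFiniteLimits F]
    [PreservesFiniteColimits F] : Prop :=
  ∀ (X Y : A) (n : ℕ), Function.Bijective (F.mapExtAddHom X Y n : Abelian.Ext.{w} X Y n →+ _)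

/-- `F` is a triangle functor: it commutes with the shifts and preserves distinguished triangles. -/
def IsTriangleFunctor {A B : Type u} [Category.{v} A] [Category.{v} B] [HasZeroObject A]
    [HasZeroObject B] [Preadditive A] [Preadditive B] [HasShift A ℤ] [HasShift B ℤ]
    [∀ n : ℤ, (shiftFunctor A n).Additive] [∀ n : ℤ, (shiftFunctor B n).Additive]
    [Pretriangulated A] [Pretriangulated B] (F : A ⥤ B) : Prop :=
  ∃ _ : F.CommShift ℤ, F.IsTriangulated

/-- A recollement of triangulated categories: a recollement all of whose functors are triangle
functors. -/
structure TriangulatedRecollement {A B C : Type u} [Category.{v} A] [Category.{v} B]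
    [Category.{v} C] [HasZeroObject A] [HasZeroObject B] [HasZeroObject C]
    [Preadditive A] [Preadditive B] [Preadditive C] [HasShift A ℤ] [HasShift B ℤ] [HasShift C ℤ]
    [∀ n : ℤ, (shiftFunctor A n).Additive] [∀ n : ℤ, (shiftFunctor B n).Additive]
    [∀ n : ℤ, (shiftFunctor C n).Additive]
    [Pretriangulated A] [Pretriangulated B] [Pretriangulated C]
    (i : A ⥤ B) (e : B ⥤ C) extends Recollement i e where
  triangle_i : IsTriangleFunctor i
  triangle_e : IsTriangleFunctor e
  triangle_q : IsTriangleFunctor q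
  triangle_p : IsTriangleFunctor p
  triangle_l : IsTriangleFunctor l
  triangle_r : IsTriangleFunctor r

/-- The triangulated categories and functors `A ⥤ B ⥤ C` form the middle row of a recollement
which is the first one of a ladder going downwards of height at least `h`. Such a ladder is a
diagram of `h + 2` consecutive rows of triangle functors between `A`, `B`, `C`, any three
consecutive rows of which form a recollement, so that it contains `h` recollements. The first one
has the rows `(l, q)`, `(e, i)`, `(r, p)`, the second one the rows `(e, i)`, `(r, p)`, `(r¹, p¹)`,
with middle row `C ⥤ B ⥤ A` given by `r` and `p`, and so on. (The upper row of each recollement is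
determined by its middle row up to unique isomorphism, hence agrees with the middle row of the
preceding one.) -/
def HasDownwardLadder : (h : ℕ) → {A B C : Type u} → [Category.{v} A] → [Category.{v} B] →
    [Category.{v} C] → [HasZeroObject A] → [HasZeroObject B] → [HasZeroObject C] →
    [Preadditive A] → [Preadditive B] → [Preadditive C] →
    [HasShift A ℤ] → [HasShift B ℤ] → [HasShift C ℤ] →
    [∀ n : ℤ, (shiftFunctor A n).Additive] → [∀ n : ℤ, (shiftFunctor B n).Additive] →
    [∀ n : ℤ, (shiftFunctor C n).Additive] →
    [Pretriangulated A] → [Pretriangulated B] → [Pretriangulated C] →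
    (A ⥤ B) → (B ⥤ C) → Prop
  | 0, _, _, _, _, _, _, _, _, _, _, _, _, _, _, _, _, _, _, _, _, _, _, _ => True
  | h + 1, _, _, _, _, _, _, _, _, _, _, _, _, _, _, _, _, _, _, _, _, _, i, e =>
      ∃ R : TriangulatedRecollement i e, HasDownwardLadder h R.r R.p

/-! ### The matrix rings -/

section Rings

variable {Λ : Type u} [Ring Λ]

/-- The ring `Γ` of `n × n` matrices with entries in `Λ` on and below the diagonal and entries in
the two-sided ideal `I` above the diagonal. -/
def gammaRing (I : TwoSidedIdeal Λ) (n : ℕ) : Subring (Matrix (Fin n) (Fin n) Λ) where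
  carrier := {M | ∀ a b, a < b → M a b ∈ I}
  zero_mem' := fun _ _ _ => I.zero_mem
  one_mem' := fun a b h => by
    rw [Matrix.one_apply_ne h.ne]
    exact I.zero_mem
  add_mem' := fun hM hN a b h => I.add_mem (hM a b h) (hN a b h)
  neg_mem' := fun hM a b h => I.neg_mem (hM a b h)
  mul_mem' := fun {M N} hM hN a b h => by
    rw [Matrix.mul_apply]
    refine sum_mem fun c _ => ?_
    rcases lt_or_ge a c with hc | hc
    · exact I.mul_mem_right _ _ (hM a c hc)
    · exact I.mul_mem_left _ _ (hN c b (hc.trans_lt h))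

/-- The ring of lower triangular `n × n` matrices with entries in `R`. -/
def lowerTriangularRing (R : Type u) [Ring R] (n : ℕ) : Subring (Matrix (Fin n) (Fin n) R) where
  carrier := {M | ∀ a b, a < b → M a b = 0}
  zero_mem' := fun _ _ _ => rfl
  one_mem' := fun _ _ h => Matrix.one_apply_ne h.ne
  add_mem' := fun {M N} hM hN a b h => by
    rw [Matrix.add_apply, hM a b h, hN a b h, add_zero]
  neg_mem' := fun {M} hM a b h => by
    rw [Matrix.neg_apply, hM a b h, neg_zero]
  mul_mem' := fun {M N} hM hN a b h => by
    rw [Matrix.mul_apply]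
    refine Finset.sum_eq_zero fun c _ => ?_
    rcases lt_or_ge a c with hc | hc
    · rw [hM a c hc, zero_mul]
    · rw [hN c b (hc.trans_lt h), mul_zero]

/-- The ring `Σ` of lower triangular `m × m` matrices with entries in `Λ / I`. -/
abbrev sigmaRing (I : TwoSidedIdeal Λ) (m : ℕ) :
    Subring (Matrix (Fin m) (Fin m) I.ringCon.Quotient) :=
  lowerTriangularRing I.ringCon.Quotient m

lemma ringCon_mk'_eq_zero (I : TwoSidedIdeal Λ) {x : Λ} (hx : x ∈ I) : I.ringCon.mk' x = 0 := by
  have h : I.ringCon x 0 := (TwoSidedIdeal.mem_iff I x).1 hx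
  exact ((RingCon.eq I.ringCon).2 h).trans (map_zero I.ringCon.mk')

/-- The canonical surjection `Γ → Γ / ΓfΓ = Σ` for matrices of size `n = m + 1`: delete the last
row and the last column and reduce the entries modulo `I`. -/
def gammaToSigma (I : TwoSidedIdeal Λ) (m : ℕ) : gammaRing I (m + 1) →+* sigmaRing I m where
  toFun M := ⟨Matrix.of fun a b => I.ringCon.mk' (M.1 a.castSucc b.castSucc), fun a b h =>
    ringCon_mk'_eq_zero I (M.2 _ _ (Fin.castSucc_lt_castSucc_iff.2 h))⟩
  map_zero' := by
    ext a b
    exact map_zero I.ringCon.mk'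
  map_one' := by
    ext a b
    by_cases h : a = b
    · subst h
      simp
    · have h' : a.castSucc ≠ b.castSucc := fun h' => h (Fin.castSucc_injective _ h')
      simp [Matrix.one_apply_ne h, Matrix.one_apply_ne h']
  map_add' M N := by
    ext a b
    exact map_add I.ringCon.mk' _ _
  map_mul' M N := by
    ext a b
    change I.ringCon.mk' ((M.1 * N.1) a.castSucc b.castSucc) = _
    rw [Matrix.mul_apply, Fin.sum_univ_castSucc, map_add, map_sum,
      ringCon_mk'_eq_zero I (x := M.1 a.castSucc (Fin.last m) * N.1 (Fin.last m) b.castSucc)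
        (I.mul_mem_right _ _ (M.2 _ _ (Fin.castSucc_lt_last a))), add_zero]
    simp [Matrix.mul_apply]

/-- The embedding of `Λ` into `Γ` as the `k`-th diagonal entry. It does not preserve `1`: the
image of `1` is the diagonal idempotent at `k`. -/
def diagonalHom (I : TwoSidedIdeal Λ) {n : ℕ} (k : Fin n) : Λ →ₙ+* gammaRing I n where
  toFun x := ⟨Matrix.single k k x, fun a b h => by
    rw [Matrix.single_apply_of_ne]
    · exact I.zero_mem
    · rintro ⟨rfl, rfl⟩
      exact h.false⟩
  map_zero' := Subtype.ext (Matrix.single_zero _ _)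
  map_add' x y := Subtype.ext (Matrix.single_add _ _ _ _)
  map_mul' x y := Subtype.ext (Matrix.single_mul_single_same _ _ _ _ _).symm

end Rings

/-! ### The functors -/

section Corner

variable {Λ Γ : Type u} [Ring Λ] [Ring Γ] (φ : Λ →ₙ+* Γ)

/-- For a multiplicative additive map `φ : Λ → Γ` and the idempotent `f = φ 1`, the subgroup
`f M = {x | f x = x}` of a `Γ`-module `M`. -/
def cornerSubgroup (M : Type u) [AddCommGroup M] [Module Γ M] : AddSubgroup M where
  carrier := {x | φ 1 • x = x}
  zero_mem' := smul_zero _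
  add_mem' := fun {x y} (hx : φ 1 • x = x) (hy : φ 1 • y = y) => by
    change φ 1 • (x + y) = x + y
    rw [smul_add, hx, hy]
  neg_mem' := fun {x} (hx : φ 1 • x = x) => by
    change φ 1 • (-x) = -x
    rw [smul_neg, hx]

lemma smul_mem_cornerSubgroup {M : Type u} [AddCommGroup M] [Module Γ M] (a : Λ) (x : M) :
    φ a • x ∈ cornerSubgroup φ M := by
  change φ 1 • φ a • x = φ a • x
  rw [smul_smul, ← map_mul, one_mul]

/-- `Λ` acts on `f M` through `φ`. -/
instance cornerModule (M : Type u) [AddCommGroup M] [Module Γ M] :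
    Module Λ (cornerSubgroup φ M) where
  smul a x := ⟨φ a • x.1, smul_mem_cornerSubgroup φ a x.1⟩
  one_smul x := Subtype.ext x.2
  mul_smul a b x := Subtype.ext <| by
    change φ (a * b) • x.1 = φ a • φ b • x.1
    rw [map_mul, mul_smul]
  smul_zero a := Subtype.ext (smul_zero (φ a))
  smul_add a x y := Subtype.ext (smul_add (φ a) x.1 y.1)
  add_smul a b x := Subtype.ext <| by
    change φ (a + b) • x.1 = φ a • x.1 + φ b • x.1
    rw [map_add, add_smul]
  zero_smul x := Subtype.ext <| by
    change φ 0 • x.1 = 0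
    rw [map_zero, zero_smul]

/-- The functor `M ↦ f M` from `Γ`-modules to `Λ`-modules. -/
def cornerFunctor : ModuleCat.{u} Γ ⥤ ModuleCat.{u} Λ where
  obj M := ModuleCat.of Λ (cornerSubgroup φ M)
  map {M N} g := ModuleCat.ofHom
    { toFun := fun x => ⟨g.hom x.1, by
        change φ 1 • g.hom x.1 = g.hom x.1
        rw [← map_smul]
        exact congrArg _ x.2⟩
      map_add' := fun x y => Subtype.ext (map_add g.hom x.1 y.1)
      map_smul' := fun a x => Subtype.ext (map_smul g.hom (φ a) x.1) }

instance cornerFunctor_additive : (cornerFunctor φ).Additive where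

lemma cornerFunctor_exact (S : ShortComplex (ModuleCat.{u} Γ)) (hS : S.Exact) :
    (S.map (cornerFunctor φ)).Exact := by
  rw [ShortComplex.moduleCat_exact_iff] at hS ⊢
  intro x hx
  obtain ⟨y, hy⟩ := hS x.1 (congrArg Subtype.val hx)
  refine ⟨⟨φ 1 • y, smul_mem_cornerSubgroup φ 1 y⟩, Subtype.ext ?_⟩
  change S.f.hom (φ 1 • y) = x.1
  rw [map_smul]
  exact (congrArg (φ 1 • ·) hy).trans x.2

lemma cornerFunctor_preservesFinite :
    PreservesFiniteLimits (cornerFunctor φ) ∧ PreservesFiniteColimits (cornerFunctor φ) :=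
  (((cornerFunctor φ).exact_tfae.out 1 3) : _ ↔ _).1 (cornerFunctor_exact φ)

instance cornerFunctor_preservesFiniteLimits : PreservesFiniteLimits (cornerFunctor φ) :=
  (cornerFunctor_preservesFinite φ).1

instance cornerFunctor_preservesFiniteColimits : PreservesFiniteColimits (cornerFunctor φ) :=
  (cornerFunctor_preservesFinite φ).2

end Corner

section Functors

variable {Λ : Type u} [Ring Λ] (I : TwoSidedIdeal Λ) (m : ℕ)

/-- The functor `i : Mod Σ ⥤ Mod Γ`, restriction along `Γ → Γ / ΓfΓ = Σ`. -/
abbrev functorI : ModuleCat.{u} (sigmaRing I m) ⥤ ModuleCat.{u} (gammaRing I (m + 1)) :=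
  ModuleCat.restrictScalars (gammaToSigma I m)

/-- The functor `e = f(-) : Mod Γ ⥤ Mod Λ`, where `f` is the last diagonal idempotent and
`fΓf = Λ`. -/
abbrev functorE : ModuleCat.{u} (gammaRing I (m + 1)) ⥤ ModuleCat.{u} Λ :=
  cornerFunctor (diagonalHom I (Fin.last m))

lemma functorI_preservesFinite :
    PreservesFiniteLimits (functorI I m) ∧ PreservesFiniteColimits (functorI I m) :=
  (((functorI I m).exact_tfae.out 1 3) : _ ↔ _).1 fun S hS => by
    rw [ShortComplex.moduleCat_exact_iff] at hS ⊢
    exact hS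

instance functorI_preservesFiniteLimits : PreservesFiniteLimits (functorI I m) :=
  (functorI_preservesFinite I m).1

instance functorI_preservesFiniteColimits : PreservesFiniteColimits (functorI I m) :=
  (functorI_preservesFinite I m).2

end Functors

/-! ### Finiteness -/

/-- The module `M` has finite projective dimension. -/
def HasFiniteProjectiveDimension {Λ : Type u} [Ring Λ] (M : ModuleCat.{u} Λ) : Prop :=
  ∃ d : ℕ, HasProjectiveDimensionLE M d

/-- The module `M` has a (possibly infinite) resolution by finitely generated projective
modules. -/
def HasFGProjectiveResolution {Λ : Type u} [Ring Λ] (M : ModuleCat.{u} Λ) : Prop :=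
  ∃ P : ProjectiveResolution M, ∀ k : ℕ, Module.Finite Λ (P.complex.X k)

end

/-!
The corner functor `e = f(-)` is left adjoint to the column functor `r(X) = Xⁿ`, and `r` is in turn
left adjoint to the corner functor `f₀(-)` of the first diagonal idempotent. All three functors are
exact, so the adjunctions `e ⊣ r ⊣ f₀(-)` pass to the derived categories without resolutions
(`mapDerivedCategoryAdjunction`). The remaining information consists of three facts on modules.

* The kernel `ΓfΓ` of `Γ → Σ` is isomorphic, as a left module, to a sum of `n` copies of the
  projective module `Γf` (`sum_sigmaKernelColumn_comp`).
* The value `f₀Γ` of `f₀(-)` at the regular module is the first row `Λ ⊕ Iⁿ⁻¹` of `Γ`.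
* The right `Λ`-module `Γf` is the last column `Iⁿ⁻¹ ⊕ Λ` of `Γ`.

**Recollements.** A functor has a left adjoint as soon as it has a universal arrow from a generator:
every module has a free presentation, and in a compactly generated triangulated category the domain
of the partial left adjoint is localizing (`isRightAdjoint_of_isUniversalArrow_ring`,
`isRightAdjoint_of_isUniversalArrow`). Right adjoints come from the preservation of coproducts,
by Brown representability in the triangulated case (`isLeftAdjoint_of_preservesCoproducts`). The
projection `Γ → Σ` and the idempotent `f` in `Γf` are universal arrows for `i` and `e`, between
projective modules, and remain universal in the derived categories
(`isUniversalArrow_mapDerivedCategory`). Since `Γf` corepresents `e`, the first fact shows that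
`ΓfΓ` has no morphisms to objects of the kernel of `D(e)`. With the triangle `ΓfΓ → Γ → Σ` this
makes `D(i)` fully faithful, with the kernel of `D(e)` as essential image
(`IsCompactGenerator.nonempty_triangulatedRecollement`); in particular `i` is a homological
embedding.

**Heights of the recollement of module categories.** A right adjoint is itself a left adjoint if its
left adjoint maps the regular module to a finitely generated projective module
(`isLeftAdjoint_of_finite_of_projective`). So `f₀(-)` has a right adjoint `r₂`, because the value of
`r` at `Λ` is `Γf₀`, and `r₂` has a right adjoint if `f₀Γ` is finitely generated and projective,
that is, if `I` is. Conversely, if `r₂` has a right adjoint, it is exact, so that `f₀(-)` preserves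
projective modules and `I` is projective as a summand of `f₀Γ`. To the left, `l = Γf ⊗ -` has a left
adjoint if and only if the right module `Γf` has a finite dual basis. The two directions are
`HasDualBasis.isRightAdjoint`, where `l` is identified with `Hom (Hom (Γf, Λ), -)`, and
`hasDualBasis_of_isRightAdjoint`, where a dual basis is read off from a universal element.

**Ladders of derived categories.** A recollement can be continued by one row downwards exactly when
its lowest functors have right adjoints (`TriangulatedRecollement.exists_next`,
`TriangulatedRecollement.isLeftAdjoint_r`). A ladder of height four therefore amounts to a chain
`r ⊣ D(f₀(-)) ⊣ r₂ ⊣ r₃`. Here `r₂` always exists since `r(Λ) = Γf₀` is compact, and by Brown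
representability `r₃` exists if and only if `D(f₀(-))` maps `Γ` to a compact object, that is, if and
only if `I` is compact in `D(Mod Λ)` (`hasDownwardLadder_iff`). A compact module has finite
projective dimension, since otherwise nonzero classes in infinitely many degrees of `Ext` assemble
to a morphism to a coproduct that does not factor through a finite subcoproduct
(`IsCompactModule.hasFiniteProjectiveDimension`). A module of finite projective dimension with a
resolution by finitely generated projective modules is compact, by induction on the dimension
(`HasFGProjectiveResolution.isCompactModule`).
-/

noncomputable section

set_option linter.unusedSectionVars false

/-! ### Coproducts in preadditive categories and compact objects -/

section Cofan

variable {T : Type*} [Category* T] [Preadditive T]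

/-- The projection of a coproduct in a preadditive category onto one of its summands. -/
def cofanProj {J : Type u} {X : J → T} {c : Cofan X} (hc : IsColimit c) (j : J) : c.pt ⟶ X j :=
  open Classical in
  Cofan.IsColimit.desc hc fun i => if h : i = j then eqToHom (congrArg X h) else 0

@[simp]
lemma inj_cofanProj_self {J : Type u} {X : J → T} {c : Cofan X} (hc : IsColimit c) (j : J) :
    c.inj j ≫ cofanProj hc j = 𝟙 _ := by
  simp [cofanProj]

lemma inj_cofanProj_of_ne {J : Type u} {X : J → T} {c : Cofan X} (hc : IsColimit c) {i j : J}
    (h : i ≠ j) : c.inj i ≫ cofanProj hc j = 0 := by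
  simp [cofanProj, h]

/-- The idempotent endomorphism of a coproduct that projects onto finitely many summands. -/
def cofanPart {J : Type u} {X : J → T} {c : Cofan X} (hc : IsColimit c) (S : Finset J) :
    c.pt ⟶ c.pt :=
  ∑ j ∈ S, cofanProj hc j ≫ c.inj j

lemma inj_cofanPart_of_mem {J : Type u} {X : J → T} {c : Cofan X} (hc : IsColimit c)
    {S : Finset J} {j : J} (h : j ∈ S) : c.inj j ≫ cofanPart hc S = c.inj j := by
  rw [cofanPart, Preadditive.comp_sum, Finset.sum_eq_single_of_mem j h]
  · rw [reassoc_of% inj_cofanProj_self hc]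
  · intro i _ hi
    rw [reassoc_of% inj_cofanProj_of_ne hc hi.symm, zero_comp]

lemma cofanPart_comp_cofanPart {J : Type u} {X : J → T} {c : Cofan X} (hc : IsColimit c)
    {S S' : Finset J} (h : S ⊆ S') : cofanPart hc S ≫ cofanPart hc S' = cofanPart hc S := by
  conv_lhs => rw [cofanPart, Preadditive.sum_comp]
  exact Finset.sum_congr rfl fun j hj => by
    rw [Category.assoc, inj_cofanPart_of_mem hc (h hj)]

lemma comp_cofanPart_mono {J : Type u} {X : J → T} {c : Cofan X} (hc : IsColimit c)
    {S S' : Finset J} (h : S ⊆ S') {G : T} {f : G ⟶ c.pt} (hf : f ≫ cofanPart hc S = f) :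
    f ≫ cofanPart hc S' = f := by
  rw [← hf, Category.assoc, cofanPart_comp_cofanPart hc h]

/-- An object `G` is compact if every morphism from `G` to a coproduct, indexed by a type in the
universe `u`, factors through finitely many summands. -/
def IsCompactObj (G : T) : Prop :=
  ∀ ⦃J : Type u⦄ ⦃X : J → T⦄ ⦃c : Cofan X⦄ (hc : IsColimit c) (f : G ⟶ c.pt),
    ∃ S : Finset J, f ≫ cofanPart hc S = f

/-- A morphism from a compact object to a coproduct vanishes if its components do. -/
lemma IsCompactObj.eq_zero {G : T} (hG : IsCompactObj.{u} G) {J : Type u} {X : J → T} {c : Cofan X}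
    (hc : IsColimit c) (f : G ⟶ c.pt) (hf : ∀ j, f ≫ cofanProj hc j = 0) : f = 0 := by
  obtain ⟨S, hS⟩ := hG hc f
  rw [← hS, cofanPart, Preadditive.comp_sum]
  exact Finset.sum_eq_zero fun j _ => by rw [reassoc_of% (hf j), zero_comp]

/-- If the identity of `G` is a finite sum of endomorphisms factoring through compact objects, then
`G` is compact. This covers retracts and finite direct sums. -/
lemma IsCompactObj.of_sum {G : T} {B : Type*} [Fintype B] (H : B → T)
    (hH : ∀ b, IsCompactObj.{u} (H b)) (p : ∀ b, G ⟶ H b) (i : ∀ b, H b ⟶ G)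
    (h : ∑ b, p b ≫ i b = 𝟙 G) : IsCompactObj.{u} G := by
  classical
  intro J X c hc f
  choose S hS using fun b => hH b hc (i b ≫ f)
  refine ⟨Finset.univ.biUnion S, ?_⟩
  have hf : f = ∑ b, p b ≫ i b ≫ f := by
    simpa [Preadditive.sum_comp] using congrArg (· ≫ f) h.symm
  rw [hf, Preadditive.sum_comp]
  refine Finset.sum_congr rfl fun b _ => ?_
  rw [Category.assoc,
    comp_cofanPart_mono hc (Finset.subset_biUnion_of_mem S (Finset.mem_univ b)) (hS b)]

lemma IsCompactObj.of_retract {G H : T} (hH : IsCompactObj.{u} H) (p : G ⟶ H) (i : H ⟶ G)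
    (h : p ≫ i = 𝟙 G) : IsCompactObj.{u} G :=
  IsCompactObj.of_sum (B := Unit) (fun _ => H) (fun _ => hH) (fun _ => p) (fun _ => i) (by simpa)

/-- `F` preserves coproducts indexed by types in the universe `u`. -/
def PreservesCoproducts {T S : Type*} [Category* T] [Category* S] (F : T ⥤ S) : Prop :=
  ∀ ⦃J : Type u⦄ ⦃X : J → T⦄ ⦃c : Cofan X⦄ (_ : IsColimit c),
    Nonempty (IsColimit (Cofan.mk (F.obj c.pt) fun j => F.map (c.inj j)))

lemma preservesCoproducts_of_isLeftAdjoint {T S : Type*} [Category* T] [Category* S] (F : T ⥤ S)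
    [F.IsLeftAdjoint] : PreservesCoproducts.{u} F := fun _ _ c hc => by
  have : PreservesColimitsOfSize.{u, u} F :=
    (Adjunction.ofIsLeftAdjoint F).leftAdjoint_preservesColimits
  exact ⟨Cofan.isColimitMapCoconeEquiv F _ c (isColimitOfPreserves F hc)⟩

lemma map_cofanProj {S : Type*} [Category* S] [Preadditive S] (F : T ⥤ S) [F.Additive]
    {J : Type u} {X : J → T} {c : Cofan X} (hc : IsColimit c)
    (hFc : IsColimit (Cofan.mk (F.obj c.pt) fun j => F.map (c.inj j))) (j : J) :
    F.map (cofanProj hc j) = cofanProj hFc j := by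
  refine Cofan.IsColimit.hom_ext hFc _ _ fun i => ?_
  by_cases h : i = j
  · subst h
    rw [inj_cofanProj_self]
    simp [← F.map_comp]
  · rw [inj_cofanProj_of_ne hFc h]
    simp [← F.map_comp, inj_cofanProj_of_ne hc h]

lemma map_cofanPart {S : Type*} [Category* S] [Preadditive S] (F : T ⥤ S) [F.Additive]
    {J : Type u} {X : J → T} {c : Cofan X} (hc : IsColimit c)
    (hFc : IsColimit (Cofan.mk (F.obj c.pt) fun j => F.map (c.inj j))) (A : Finset J) :
    F.map (cofanPart hc A) = cofanPart hFc A := by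
  simp only [cofanPart, F.map_sum, F.map_comp, map_cofanProj F hc hFc]
  rfl

/-- A left adjoint whose right adjoint preserves coproducts preserves compact objects. -/
lemma IsCompactObj.leftAdjoint_obj {S : Type*} [Category* S] [Preadditive S] {L : T ⥤ S}
    {F : S ⥤ T} [F.Additive] (adj : L ⊣ F) (hF : PreservesCoproducts.{u} F) {G : T}
    (hG : IsCompactObj.{u} G) : IsCompactObj.{u} (L.obj G) := by
  intro J X c hc f
  obtain ⟨hFc⟩ := hF hc
  obtain ⟨A, hA⟩ := hG hFc (adj.homEquiv _ _ f)
  refine ⟨A, (adj.homEquiv _ _).injective ?_⟩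
  rw [adj.homEquiv_naturality_right, map_cofanPart F hc hFc]
  exact hA

lemma IsCompactObj.obj_of_equivalence {S : Type*} [Category* S] [Preadditive S] (e : T ≌ S)
    [e.inverse.Additive] {G : T} (hG : IsCompactObj.{u} G) : IsCompactObj.{u} (e.functor.obj G) :=
  hG.leftAdjoint_obj e.toAdjunction (preservesCoproducts_of_isLeftAdjoint _)

end Cofan

/-! ### Localizing subcategories and Brown representability -/

section Triangulated

open Pretriangulated

variable {T : Type*} [Category* T] [HasZeroObject T] [HasShift T ℤ] [Preadditive T]
  [∀ n : ℤ, (shiftFunctor T n).Additive] [Pretriangulated T]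

lemma IsCompactObj.shift {G : T} (hG : IsCompactObj.{u} G) (n : ℤ) :
    IsCompactObj.{u} (G⟦n⟧) := by
  have : (shiftEquiv T n).inverse.Additive :=
    inferInstanceAs (shiftFunctor T (-n)).Additive
  exact hG.obj_of_equivalence (shiftEquiv T n)

section Exactness

variable {X Y Z : T} {f : X ⟶ Y} {g : Y ⟶ Z} {h : Z ⟶ X⟦(1 : ℤ)⟧}

lemma distTriang_comp₁₂ (hT : Triangle.mk f g h ∈ distTriang T) : f ≫ g = 0 :=
  comp_distTriang_mor_zero₁₂ _ hT

lemma distTriang_comp₃₁ (hT : Triangle.mk f g h ∈ distTriang T) : h ≫ f⟦(1 : ℤ)⟧' = 0 :=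
  comp_distTriang_mor_zero₃₁ _ hT

lemma exists_desc₂ (hT : Triangle.mk f g h ∈ distTriang T) {W : T}
    (k : Y ⟶ W) (hk : f ≫ k = 0) : ∃ l : Z ⟶ W, g ≫ l = k :=
  (Triangle.yoneda_exact₂ _ hT k hk).imp fun _ => Eq.symm

lemma exists_desc₃ (hT : Triangle.mk f g h ∈ distTriang T) {W : T}
    (k : Z ⟶ W) (hk : g ≫ k = 0) : ∃ l : X⟦(1 : ℤ)⟧ ⟶ W, h ≫ l = k :=
  (Triangle.yoneda_exact₃ _ hT k hk).imp fun _ => Eq.symm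

lemma exists_lift₂ (hT : Triangle.mk f g h ∈ distTriang T) {W : T}
    (k : W ⟶ Y) (hk : k ≫ g = 0) : ∃ l : W ⟶ X, l ≫ f = k :=
  (Triangle.coyoneda_exact₂ _ hT k hk).imp fun _ => Eq.symm

lemma exists_lift₃ (hT : Triangle.mk f g h ∈ distTriang T) {W : T}
    (k : W ⟶ Z) (hk : k ≫ h = 0) : ∃ l : W ⟶ Y, l ≫ g = k :=
  (Triangle.coyoneda_exact₃ _ hT k hk).imp fun _ => Eq.symm

lemma exists_desc₁ (hT : Triangle.mk f g h ∈ distTriang T) {W : T}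
    (k : X⟦(1 : ℤ)⟧ ⟶ W) (hk : h ≫ k = 0) : ∃ l : Y⟦(1 : ℤ)⟧ ⟶ W, f⟦(1 : ℤ)⟧' ≫ l = k := by
  obtain ⟨l : Y⟦(1 : ℤ)⟧ ⟶ W, hl : k = (-f⟦(1 : ℤ)⟧') ≫ l⟩ :=
    Triangle.yoneda_exact₃ _ (rot_of_distTriang _ hT) k hk
  exact ⟨-l, by rw [hl, Preadditive.comp_neg, Preadditive.neg_comp]⟩

lemma exists_shift_distTriang (hT : Triangle.mk f g h ∈ distTriang T) (n : ℤ) :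
    ∃ (f' : X⟦n⟧ ⟶ Y⟦n⟧) (g' : Y⟦n⟧ ⟶ Z⟦n⟧) (h' : Z⟦n⟧ ⟶ (X⟦n⟧)⟦(1 : ℤ)⟧),
      Triangle.mk f' g' h' ∈ distTriang T :=
  ⟨_, _, _, Triangle.shift_distinguished _ hT n⟩

variable {S : Type*} [Category* S] [HasZeroObject S] [HasShift S ℤ] [Preadditive S]
  [∀ n : ℤ, (shiftFunctor S n).Additive] [Pretriangulated S]

lemma map_distTriang (hT : Triangle.mk f g h ∈ distTriang T) (F : T ⥤ S) [F.CommShift ℤ]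
    [F.IsTriangulated] :
    Triangle.mk (F.map f) (F.map g) (F.map h ≫ (F.commShiftIso (1 : ℤ)).hom.app X) ∈
      distTriang S :=
  F.map_distinguished _ hT

end Exactness

/-- The cone of a morphism between compact objects is compact. -/
lemma IsCompactObj.cone {X Y Z : T} {a : X ⟶ Y} {b : Y ⟶ Z} {d : Z ⟶ X⟦(1 : ℤ)⟧}
    (hT : Triangle.mk a b d ∈ distTriang T) (hX : IsCompactObj.{u} X)
    (hY : IsCompactObj.{u} Y) : IsCompactObj.{u} Z := by
  classical
  intro J W c hc f
  obtain ⟨S, hS⟩ := hY hc (b ≫ f)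
  obtain ⟨g, hg⟩ := exists_desc₃ hT (f - f ≫ cofanPart hc S) (by
    rw [Preadditive.comp_sub, ← Category.assoc, hS, sub_self])
  obtain ⟨S', hS'⟩ := hX.shift 1 hc g
  refine ⟨S ∪ S', ?_⟩
  have h : (d ≫ g) ≫ cofanPart hc (S ∪ S') = (f - f ≫ cofanPart hc S) ≫ cofanPart hc (S ∪ S') :=
    by rw [hg]
  rw [Category.assoc, comp_cofanPart_mono hc Finset.subset_union_right hS', hg,
    Preadditive.sub_comp, Category.assoc,
    cofanPart_comp_cofanPart hc Finset.subset_union_left] at h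
  simpa using h.symm

/-- A localizing property of objects of a triangulated category: closed under shifts, cones and
coproducts indexed by types in the universe `u`. -/
structure IsLocalizing (P : ObjectProperty T) : Prop where
  shift : ∀ (X : T) (n : ℤ), P X → P (X⟦n⟧)
  cone : ∀ ⦃X Y Z : T⦄ ⦃f : X ⟶ Y⦄ ⦃g : Y ⟶ Z⦄ ⦃h : Z ⟶ X⟦(1 : ℤ)⟧⦄,
    Triangle.mk f g h ∈ distTriang T → P X → P Y → P Z
  coproduct : ∀ ⦃J : Type u⦄ ⦃X : J → T⦄ ⦃c : Cofan X⦄ (_ : IsColimit c), (∀ j, P (X j)) → P c.pt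

lemma IsLocalizing.of_iso {P : ObjectProperty T} (hP : IsLocalizing.{u} P) {X Y : T} (e : X ≅ Y)
    (hX : P X) : P Y :=
  hP.coproduct (J := PUnit) (X := fun _ => X) (c := Cofan.mk Y fun _ => e.hom)
    (Cofan.IsColimit.mk _ (fun s => e.inv ≫ s.inj ⟨⟩) (by simp) (by
      intro s m hm
      simp [← hm ⟨⟩])) fun _ => hX

variable {S : Type*} [Category* S] [HasZeroObject S] [HasShift S ℤ] [Preadditive S]
  [∀ n : ℤ, (shiftFunctor S n).Additive] [Pretriangulated S]

/-- The homotopy colimit of a sequence: the cone `L` of the difference of the identity and the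
transition morphisms on the coproduct of the terms. Morphisms from compact objects to `L` factor
through a term of the sequence, and compatible families of morphisms extend to `L`, though not
uniquely. -/
lemma exists_hocolim [∀ J : Type u, HasCoproductsOfShape J T] (X : ℕ → T)
    (φ : ∀ n, X n ⟶ X (n + 1)) :
    ∃ (L : T) (a : ∀ n, X n ⟶ L), (∀ n, φ n ≫ a (n + 1) = a n) ∧
      (∀ G : T, IsCompactObj.{u} G → ∀ f : G ⟶ L, ∃ n, ∃ g : G ⟶ X n, f = g ≫ a n) ∧
      (∀ (F : T ⥤ S) [F.CommShift ℤ] [F.IsTriangulated], PreservesCoproducts.{u} F →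
        ∀ (Y : S) (u : ∀ n, F.obj (X n) ⟶ Y), (∀ n, F.map (φ n) ≫ u (n + 1) = u n) →
        ∃ v : F.obj L ⟶ Y, ∀ n, F.map (a n) ≫ v = u n) ∧
      (∀ P : ObjectProperty T, IsLocalizing.{u} P → (∀ n, P (X n)) → P L) := by
  let X' : ULift.{u} ℕ → T := fun n => X n.down
  let c : Cofan X' := Cofan.mk _ (Sigma.ι X')
  have hc : IsColimit c := coproductIsCoproduct X'
  -- `d` is the difference of the identity and the transition morphisms
  let d : c.pt ⟶ c.pt :=
    Cofan.IsColimit.desc hc fun n => c.inj n - φ n.down ≫ c.inj ⟨n.down + 1⟩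
  have hd (n : ℕ) : c.inj ⟨n⟩ ≫ d = c.inj ⟨n⟩ - φ n ≫ c.inj ⟨n + 1⟩ := by
    simp [d]
  obtain ⟨L, q, b, hT⟩ := Pretriangulated.distinguished_cocone_triangle d
  have hdq : d ≫ q = 0 := distTriang_comp₁₂ hT
  have hcomp (n : ℕ) : φ n ≫ c.inj ⟨n + 1⟩ ≫ q = c.inj ⟨n⟩ ≫ q := by
    have := congrArg (c.inj ⟨n⟩ ≫ ·) hdq
    simp only [reassoc_of% hd, Preadditive.sub_comp, comp_zero, sub_eq_zero, Category.assoc] at this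
    exact this.symm
  have hcomp' (n k : ℕ) : ∃ ψ : X n ⟶ X (n + k), c.inj ⟨n⟩ ≫ q = ψ ≫ c.inj ⟨n + k⟩ ≫ q := by
    induction k with
    | zero => exact ⟨𝟙 _, by simp⟩
    | succ k ih =>
      obtain ⟨ψ, hψ⟩ := ih
      exact ⟨ψ ≫ φ _, by rw [hψ, ← hcomp, Category.assoc]; rfl⟩
  have hdp0 : d ≫ cofanProj hc ⟨0⟩ = cofanProj hc ⟨0⟩ := by
    refine Cofan.IsColimit.hom_ext hc _ _ fun ⟨n⟩ => ?_
    rw [reassoc_of% hd, Preadditive.sub_comp, Category.assoc,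
      inj_cofanProj_of_ne hc (i := ⟨n + 1⟩) (by simp), comp_zero, sub_zero]
  have hdp (m : ℕ) : d ≫ cofanProj hc ⟨m + 1⟩ =
      cofanProj hc ⟨m + 1⟩ - cofanProj hc ⟨m⟩ ≫ φ m := by
    refine Cofan.IsColimit.hom_ext hc _ _ fun ⟨n⟩ => ?_
    rw [reassoc_of% hd, Preadditive.sub_comp, Preadditive.comp_sub, Category.assoc]
    congr 1
    by_cases h : n = m
    · subst h
      rw [inj_cofanProj_self, reassoc_of% inj_cofanProj_self hc, Category.comp_id]
    · rw [inj_cofanProj_of_ne hc (by simpa using h), comp_zero,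
        reassoc_of% inj_cofanProj_of_ne hc (by simpa using h), zero_comp]
  refine ⟨L, fun n => c.inj ⟨n⟩ ≫ q, hcomp, ?_, ?_, ?_⟩
  · intro G hG f
    -- the components of `f ≫ b` vanish one after the other, by the formulas for `d ≫ cofanProj`
    have hfb : f ≫ b = 0 := by
      obtain ⟨hc1⟩ := preservesCoproducts_of_isLeftAdjoint.{u} (shiftFunctor T (1 : ℤ)) hc
      have hbd : (f ≫ b) ≫ d⟦(1 : ℤ)⟧' = 0 := by
        rw [Category.assoc, distTriang_comp₃₁ hT, comp_zero]
      refine hG.eq_zero hc1 _ fun ⟨n⟩ => ?_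
      rw [← map_cofanProj]
      induction n with
      | zero => rw [← hdp0, Functor.map_comp, ← Category.assoc, hbd, zero_comp]
      | succ n ih =>
        have h : (f ≫ b) ≫ (d ≫ cofanProj hc ⟨n + 1⟩)⟦(1 : ℤ)⟧' = _ :=
          congrArg (fun g => (f ≫ b) ≫ g⟦(1 : ℤ)⟧') (hdp n)
        rw [Functor.map_comp, ← Category.assoc, hbd, zero_comp, Functor.map_sub,
          Preadditive.comp_sub, Functor.map_comp, ← Category.assoc, ih, zero_comp, sub_zero] at h
        exact h.symm
    obtain ⟨f', hf'⟩ := exists_lift₃ hT f hfb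
    obtain ⟨A, hA⟩ := hG hc f'
    let N := A.sup fun n => n.down
    have key : ∀ n ∈ A, ∃ ψ : X n.down ⟶ X N, c.inj n ≫ q = ψ ≫ c.inj ⟨N⟩ ≫ q := by
      intro n hn
      obtain ⟨k, hk⟩ := Nat.exists_eq_add_of_le
        (Finset.le_sup (f := fun n : ULift.{u} ℕ => n.down) hn)
      change N = _ at hk
      rw [hk]
      exact hcomp' n.down k
    choose! ψ hψ using key
    refine ⟨N, ∑ n ∈ A, f' ≫ cofanProj hc n ≫ ψ n, ?_⟩
    have hq : f = f' ≫ cofanPart hc A ≫ q := by rw [← Category.assoc, hA, hf']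
    rw [hq, cofanPart, Preadditive.sum_comp, Preadditive.comp_sum, Preadditive.sum_comp]
    refine Finset.sum_congr rfl fun n hn => ?_
    simp only [Category.assoc, hψ n hn]
  · intro F _ _ hF Y u hu
    obtain ⟨hFc⟩ := hF hc
    let u' : F.obj c.pt ⟶ Y := Cofan.IsColimit.desc hFc fun n => u n.down
    have hu' (n : ℕ) : F.map (c.inj ⟨n⟩) ≫ u' = u n :=
      Cofan.IsColimit.fac hFc (fun n => u n.down) ⟨n⟩
    obtain ⟨v, hv⟩ := exists_desc₂ (map_distTriang hT F) u' (by
      refine Cofan.IsColimit.hom_ext hFc _ _ fun ⟨n⟩ => ?_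
      change F.map (c.inj ⟨n⟩) ≫ F.map d ≫ u' = F.map (c.inj ⟨n⟩) ≫ 0
      rw [← F.map_comp_assoc, hd, F.map_sub, Preadditive.sub_comp, F.map_comp, Category.assoc,
        hu', hu', hu, sub_self, comp_zero])
    refine ⟨v, fun n => ?_⟩
    rw [F.map_comp, Category.assoc, hv, hu']
  · intro P hP hX
    have := hP.coproduct hc fun n => hX n.down
    exact hP.cone hT this this

/-- Half of Brown representability: a contravariant functor `Hom (F -, Y)` is represented, as far as
morphisms from the compact objects `G k` are concerned, by an object built from the `G k`. It is the
homotopy colimit of a sequence that starts with a coproduct of objects `G k`, large enough to hit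
all elements, and whose later terms successively kill the elements that have to vanish. -/
lemma exists_brown [∀ J : Type u, HasCoproductsOfShape J T] {ι : Type*} [Small.{u} ι] (G : ι → T)
    (hG : ∀ k, IsCompactObj.{u} (G k)) (F : T ⥤ S) [F.CommShift ℤ] [F.IsTriangulated]
    (hF : PreservesCoproducts.{u} F) (Y : S) [∀ k, Small.{u} (F.obj (G k) ⟶ Y)]
    [∀ k (X : T), Small.{u} (G k ⟶ X)] (P : ObjectProperty T) (hP : IsLocalizing.{u} P)
    (hPG : ∀ k, P (G k)) :
    ∃ (X : T) (v : F.obj X ⟶ Y), P X ∧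
      ∀ k, Function.Bijective fun g : G k ⟶ X => F.map g ≫ v := by
  -- the inductive step: kill all `g : G k ⟶ X` that vanish after composition with `x`
  have next (s : Σ X : T, (F.obj X ⟶ Y)) : ∃ (s' : Σ X : T, (F.obj X ⟶ Y)) (φ : s.1 ⟶ s'.1),
      (P s.1 → P s'.1) ∧ F.map φ ≫ s'.2 = s.2 ∧
        ∀ k (g : G k ⟶ s.1), F.map g ≫ s.2 = 0 → g ≫ φ = 0 := by
    obtain ⟨X, x⟩ := s
    let K := Shrink.{u} (Σ k, {g : G k ⟶ X // F.map g ≫ x = 0})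
    let e : K ≃ _ := (equivShrink _).symm
    let c : Cofan fun j : K => G (e j).1 := Cofan.mk _ (Sigma.ι _)
    have hc : IsColimit c := coproductIsCoproduct _
    let t : c.pt ⟶ X := Cofan.IsColimit.desc hc fun j => (e j).2.1
    have ht (j : K) : c.inj j ≫ t = (e j).2.1 := Cofan.IsColimit.fac hc _ j
    obtain ⟨X', φ, b, hT⟩ := Pretriangulated.distinguished_cocone_triangle t
    obtain ⟨hFc⟩ := hF hc
    obtain ⟨x', hx'⟩ := exists_desc₂ (map_distTriang hT F) x (by
      refine Cofan.IsColimit.hom_ext hFc _ _ fun j => ?_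
      change F.map (c.inj j) ≫ F.map t ≫ x = F.map (c.inj j) ≫ 0
      rw [← F.map_comp_assoc, ht, (e j).2.2, comp_zero])
    refine ⟨⟨X', x'⟩, φ, fun hX => hP.cone hT (hP.coproduct hc fun j => hPG _) hX, hx',
      fun k g hg => ?_⟩
    have key (a : Σ k, {g : G k ⟶ X // F.map g ≫ x = 0}) : a.2.1 ≫ φ = 0 := by
      obtain ⟨j, rfl⟩ := e.surjective a
      rw [← ht, Category.assoc, distTriang_comp₁₂ hT, comp_zero]
    exact key ⟨k, g, hg⟩
  -- the start of the sequence
  have start : ∃ s : Σ X : T, (F.obj X ⟶ Y), P s.1 ∧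
      ∀ k (f : F.obj (G k) ⟶ Y), ∃ g : G k ⟶ s.1, F.map g ≫ s.2 = f := by
    let K := Shrink.{u} (Σ k, (F.obj (G k) ⟶ Y))
    let e : K ≃ _ := (equivShrink _).symm
    let c : Cofan fun j : K => G (e j).1 := Cofan.mk _ (Sigma.ι _)
    have hc : IsColimit c := coproductIsCoproduct _
    obtain ⟨hFc⟩ := hF hc
    refine ⟨⟨c.pt, Cofan.IsColimit.desc hFc fun j => (e j).2⟩, hP.coproduct hc fun j => hPG _, ?_⟩
    have key (a : Σ k, (F.obj (G k) ⟶ Y)) : ∃ g : G a.1 ⟶ c.pt,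
        F.map g ≫ Cofan.IsColimit.desc hFc (fun j => (e j).2) = a.2 := by
      obtain ⟨j, rfl⟩ := e.surjective a
      exact ⟨c.inj j, Cofan.IsColimit.fac hFc _ j⟩
    exact fun k f => key ⟨k, f⟩
  choose nxt φ hnxtP hφ hkill using next
  obtain ⟨s₀, hs₀P, hs₀⟩ := start
  let s : ℕ → Σ X : T, (F.obj X ⟶ Y) := fun n => nxt^[n] s₀
  have hs (n : ℕ) : s (n + 1) = nxt (s n) := Function.iterate_succ_apply' _ _ _
  have hsP (n : ℕ) : P (s n).1 := by
    induction n with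
    | zero => exact hs₀P
    | succ n ih =>
      rw [hs]
      exact hnxtP _ ih
  have hψ (n : ℕ) : ∃ ψ : (s n).1 ⟶ (s (n + 1)).1, F.map ψ ≫ (s (n + 1)).2 = (s n).2 ∧
      ∀ k (g : G k ⟶ (s n).1), F.map g ≫ (s n).2 = 0 → g ≫ ψ = 0 := by
    rw [hs]
    exact ⟨_, hφ _, hkill _⟩
  choose ψ hψ₁ hψ₂ using hψ
  obtain ⟨X, a, ha, hX, hXF, hXP⟩ := exists_hocolim.{u} (S := S) (fun n => (s n).1) ψ
  obtain ⟨v, hv⟩ := hXF F hF Y (fun n => (s n).2) hψ₁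
  refine ⟨X, v, hXP P hP hsP, fun k => ⟨fun f f' hff' => ?_, fun f => ?_⟩⟩
  · obtain ⟨n, g, hg⟩ := hX (G k) (hG k) (f - f')
    rw [← sub_eq_zero, hg, ← ha, ← Category.assoc, hψ₂ n k g, zero_comp]
    rw [← hv, ← F.map_comp_assoc, ← hg, F.map_sub, Preadditive.sub_comp, sub_eq_zero]
    exact hff'
  · obtain ⟨g : G k ⟶ (s 0).1, hg : F.map g ≫ (s 0).2 = f⟩ := hs₀ k f
    refine ⟨g ≫ a 0, ?_⟩
    change F.map (g ≫ a 0) ≫ v = f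
    rw [F.map_comp, Category.assoc, hv, hg]

/-- An object `G` whose shifts detect zero objects. -/
def IsWeakGenerator (G : T) : Prop :=
  ∀ X : T, (∀ (n : ℤ) (f : G⟦n⟧ ⟶ X), f = 0) → IsZero X

/-- A morphism inducing bijections on morphisms from all shifts of a weak generator is an
isomorphism. -/
lemma IsWeakGenerator.isIso {G : T} (hG : IsWeakGenerator G) {X Y : T} (f : X ⟶ Y)
    (hf : ∀ n : ℤ, Function.Bijective fun g : G⟦n⟧ ⟶ X => g ≫ f) : IsIso f := by
  obtain ⟨Z, g, h, hT⟩ := Pretriangulated.distinguished_cocone_triangle f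
  refine (Triangle.isZero₃_iff_isIso₁ _ hT).1 (hG Z fun n k => ?_)
  have hk : k ≫ h = 0 := by
    -- the morphisms to `X⟦1⟧` are controlled by those from `G⟦n - 1⟧` to `X`
    let e : (G⟦n + -1⟧)⟦(1 : ℤ)⟧ ≅ G⟦n⟧ := (shiftFunctorAdd' T (n + -1) 1 n (by omega)).symm.app G
    obtain ⟨l, hl⟩ := (shiftFunctor T (1 : ℤ)).map_surjective (e.hom ≫ k ≫ h)
    have hl' : l ≫ f = 0 := by
      apply (shiftFunctor T (1 : ℤ)).map_injective
      rw [Functor.map_comp, hl, Functor.map_zero, Category.assoc, Category.assoc,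
        distTriang_comp₃₁ hT, comp_zero, comp_zero]
    rw [show l = 0 from (hf _).1 (by simpa using hl'), Functor.map_zero] at hl
    rw [← cancel_epi e.hom, ← hl, comp_zero]
  obtain ⟨l, rfl⟩ := exists_lift₃ hT k hk
  obtain ⟨m, rfl⟩ := (hf n).2 l
  dsimp
  rw [Category.assoc, distTriang_comp₁₂ hT, comp_zero]

/-- A localizing property which holds for a compact weak generator holds for all objects. -/
lemma IsLocalizing.eq_top [∀ J : Type u, HasCoproductsOfShape J T] {P : ObjectProperty T}
    (hP : IsLocalizing.{u} P) {G : T} (hG : IsCompactObj.{u} G) (hG' : IsWeakGenerator G)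
    (hGs : ∀ (n : ℤ) (X : T), Small.{u} (G⟦n⟧ ⟶ X)) (hPG : P G) (X : T) : P X := by
  have (n : ℤ) : Small.{u} ((𝟭 T).obj (G⟦n⟧) ⟶ X) := hGs n X
  obtain ⟨X', v, hX', hv⟩ := exists_brown.{u} (fun n : ℤ => G⟦n⟧) (fun n => hG.shift n) (𝟭 T)
    (preservesCoproducts_of_isLeftAdjoint _) X P hP fun n => hP.shift _ n hPG
  have : IsIso v := hG'.isIso v hv
  exact hP.of_iso (asIso v) hX'

/-- Homs out of objects of a triangulated category with a weak generator `G` are `u`-small as soon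
as those out of the shifts of `G` are. -/
lemma small_hom_of_isWeakGenerator [∀ J : Type u, HasCoproductsOfShape J T] {G : T}
    (hG : IsCompactObj.{u} G) (hG' : IsWeakGenerator G)
    (hGs : ∀ (n : ℤ) (X : T), Small.{u} (G⟦n⟧ ⟶ X)) (X Y : T) : Small.{u} (X ⟶ Y) := by
  let P : ObjectProperty T := fun X => ∀ (n : ℤ) (Y : T), Small.{u} (X⟦n⟧ ⟶ Y)
  have small_of_iso {A B : T} (e : A ≅ B) (Y : T) (h : Small.{u} (A ⟶ Y)) : Small.{u} (B ⟶ Y) :=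
    small_of_injective (β := A ⟶ Y) (f := fun g => e.hom ≫ g) fun g g' h => by
      simpa using h
  have hP : IsLocalizing.{u} P := by
    refine ⟨fun X n hX m Y => small_of_iso ((shiftFunctorAdd T n m).app X) Y (hX _ Y),
      fun X Y Z f g h hT hX hY n W => ?_, fun J X c hc hX n Y => ?_⟩
    · obtain ⟨f', g', h', hT'⟩ := exists_shift_distTriang hT n
      have h₁ : Small.{u} ((X⟦n⟧)⟦(1 : ℤ)⟧ ⟶ W) :=
        small_of_iso ((shiftFunctorAdd T n 1).app X) W (hX _ W)
      have h₂ : Small.{u} (Y⟦n⟧ ⟶ W) := hY n W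
      -- a morphism out of the cone is determined by its restriction to `Y`, and by the difference
      -- with a chosen morphism with the same restriction
      let R : (Y⟦n⟧ ⟶ W) × ((X⟦n⟧)⟦(1 : ℤ)⟧ ⟶ W) → (Z⟦n⟧ ⟶ W) := fun a =>
        open Classical in
        (if h : ∃ k : Z⟦n⟧ ⟶ W, g' ≫ k = a.1 then h.choose else 0) + h' ≫ a.2
      refine small_of_surjective (f := R) fun k => ?_
      have hk : ∃ k' : Z⟦n⟧ ⟶ W, g' ≫ k' = g' ≫ k := ⟨k, rfl⟩
      obtain ⟨l, hl⟩ := exists_desc₃ hT' (k - hk.choose) (by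
        rw [Preadditive.comp_sub, hk.choose_spec, sub_self])
      refine ⟨(g' ≫ k, l), ?_⟩
      dsimp only [R]
      rw [dif_pos hk, hl, add_sub_cancel]
    · obtain ⟨hc'⟩ := preservesCoproducts_of_isLeftAdjoint.{u} (shiftFunctor T n) hc
      have := fun j => hX j n Y
      exact small_of_injective (β := ∀ j, ((X j)⟦n⟧ ⟶ Y))
        (f := fun g j => (c.inj j)⟦n⟧' ≫ g) fun g g' h =>
        Cofan.IsColimit.hom_ext hc' _ _ fun j => congrFun h j
  exact small_of_iso ((shiftFunctorZero T ℤ).app X) Y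
    (hP.eq_top hG hG' hGs (fun n X => hGs n X) X 0 Y)

section Representability

variable (F : T ⥤ S) [F.CommShift ℤ] [F.IsTriangulated] {X : T} {Y : S} (v : F.obj X ⟶ Y)

lemma bijective_map_comp_of_iso {A B : T} (e : A ≅ B)
    (h : Function.Bijective fun g : A ⟶ X => F.map g ≫ v) :
    Function.Bijective fun g : B ⟶ X => F.map g ≫ v := by
  refine ⟨fun g g' hg => ?_, fun k => ?_⟩
  · rw [← cancel_epi e.hom]
    apply h.1
    dsimp at hg ⊢
    rw [F.map_comp, F.map_comp, Category.assoc, Category.assoc, hg]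
  · obtain ⟨g, hg⟩ := h.2 (F.map e.hom ≫ k)
    refine ⟨e.inv ≫ g, ?_⟩
    dsimp at hg ⊢
    rw [F.map_comp, Category.assoc, hg, ← F.map_comp_assoc, e.inv_hom_id, F.map_id,
      Category.id_comp]

/-- The five lemma for the natural transformation `Hom (-, X) ⟶ Hom (F -, Y)`. -/
lemma bijective_map_comp_of_distTriang {A B C : T} {f : A ⟶ B} {g : B ⟶ C} {h : C ⟶ A⟦(1 : ℤ)⟧}
    (hT : Triangle.mk f g h ∈ distTriang T)
    (hA : Function.Bijective fun g : A ⟶ X => F.map g ≫ v)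
    (hB : Function.Bijective fun g : B ⟶ X => F.map g ≫ v)
    (hA' : Function.Bijective fun g : A⟦(1 : ℤ)⟧ ⟶ X => F.map g ≫ v)
    (hB' : Function.Bijective fun g : B⟦(1 : ℤ)⟧ ⟶ X => F.map g ≫ v) :
    Function.Bijective fun g : C ⟶ X => F.map g ≫ v := by
  have hFT := map_distTriang hT F
  have inj {W : T} (hW : Function.Bijective fun g : W ⟶ X => F.map g ≫ v) (g : W ⟶ X)
      (hg : F.map g ≫ v = 0) : g = 0 := hW.1 (by simpa using hg)
  refine ⟨fun k k' hk => ?_, fun k => ?_⟩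
  · rw [← sub_eq_zero]
    have hz : F.map (k - k') ≫ v = 0 := by
      rw [F.map_sub, Preadditive.sub_comp, sub_eq_zero]
      exact hk
    generalize k - k' = z at hz
    obtain ⟨x, rfl⟩ := exists_desc₃ hT z (inj hB _ (by
      rw [F.map_comp, Category.assoc, hz, comp_zero]))
    obtain ⟨t, ht⟩ := exists_desc₁ hFT ((F.commShiftIso (1 : ℤ)).inv.app A ≫ F.map x ≫ v) (by
      rw [Category.assoc, Iso.hom_inv_id_app_assoc, ← F.map_comp_assoc, hz])
    obtain ⟨s, hs⟩ := hB'.2 ((F.commShiftIso (1 : ℤ)).hom.app B ≫ t)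
    have : x = f⟦(1 : ℤ)⟧' ≫ s := by
      apply hA'.1
      dsimp at hs ⊢
      rw [F.map_comp, Category.assoc, hs, F.commShiftIso_hom_naturality_assoc, ht,
        Iso.hom_inv_id_app_assoc]
    rw [this, ← Category.assoc, distTriang_comp₃₁ hT, zero_comp]
  · obtain ⟨y, hy⟩ := hB.2 (F.map g ≫ k)
    dsimp at hy
    obtain ⟨z, hz⟩ := exists_desc₂ hT y (inj hA _ (by
      rw [F.map_comp, Category.assoc, hy, ← F.map_comp_assoc, distTriang_comp₁₂ hT, F.map_zero,
        zero_comp]))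
    obtain ⟨w, hw⟩ := exists_desc₃ hFT (k - F.map z ≫ v) (by
      rw [Preadditive.comp_sub, ← F.map_comp_assoc, hz, hy, sub_self])
    obtain ⟨x, hx⟩ := hA'.2 ((F.commShiftIso (1 : ℤ)).hom.app A ≫ w)
    refine ⟨z + h ≫ x, ?_⟩
    dsimp at hx ⊢
    rw [F.map_add, Preadditive.add_comp, F.map_comp h x, Category.assoc, hx, ← Category.assoc, hw,
      add_sub_cancel]

/-- Brown representability: a triangulated functor which preserves coproducts, from a triangulated
category with a compact weak generator, has a right adjoint. -/
lemma isLeftAdjoint_of_preservesCoproducts [∀ J : Type u, HasCoproductsOfShape J T] {G : T}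
    (hG : IsCompactObj.{u} G) (hG' : IsWeakGenerator G)
    (hGs : ∀ (n : ℤ) (X : T), Small.{u} (G⟦n⟧ ⟶ X)) (hS : ∀ X Y : S, Small.{u} (X ⟶ Y))
    (hF : PreservesCoproducts.{u} F) : F.IsLeftAdjoint := by
  refine Functor.isLeftAdjoint_of_rightAdjointObjIsDefined_eq_top ?_
  ext Y
  simp only [Pi.top_apply, Prop.top_eq_true, iff_true]
  obtain ⟨X, v, -, hv⟩ := exists_brown.{u} (fun n : ℤ => G⟦n⟧) (fun n => hG.shift n) F hF Y
    (fun _ => True) ⟨fun _ _ _ => trivial, fun _ _ _ _ _ _ _ _ _ => trivial,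
      fun _ _ _ _ _ => trivial⟩ fun _ => trivial
  let P : ObjectProperty T := fun Z => ∀ n : ℤ, Function.Bijective fun g : Z⟦n⟧ ⟶ X => F.map g ≫ v
  have hP : IsLocalizing.{u} P := by
    refine ⟨fun Z n hZ m => bijective_map_comp_of_iso F v ((shiftFunctorAdd T n m).app Z) (hZ _),
      fun A B C f g h hT hA hB n => ?_, fun J Z c hc hZ n => ?_⟩
    · have h (A : T) (hA : P A) := bijective_map_comp_of_iso F v ((shiftFunctorAdd T n 1).app A)
        (hA (n + 1))
      obtain ⟨f', g', h', hT'⟩ := exists_shift_distTriang hT n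
      exact bijective_map_comp_of_distTriang F v hT' (hA n) (hB n) (h A hA) (h B hB)
    · obtain ⟨hc'⟩ := preservesCoproducts_of_isLeftAdjoint.{u} (shiftFunctor T n) hc
      obtain ⟨hc''⟩ := hF hc'
      refine ⟨fun g g' hg => Cofan.IsColimit.hom_ext hc' _ _ fun j => (hZ j n).1 ?_, fun k => ?_⟩
      · have := congrArg (F.map ((c.inj j)⟦n⟧') ≫ ·) hg
        dsimp at this
        simp only [← F.map_comp_assoc] at this
        exact this
      · choose g hg using fun j => (hZ j n).2 (F.map ((c.inj j)⟦n⟧') ≫ k)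
        refine ⟨Cofan.IsColimit.desc hc' g, Cofan.IsColimit.hom_ext hc'' _ _ fun j => ?_⟩
        have h := Cofan.IsColimit.fac hc' g j
        refine Eq.trans ?_ (hg j)
        change F.map ((c.inj j)⟦n⟧') ≫ F.map _ ≫ v = _
        rw [← F.map_comp_assoc]
        exact congrArg (fun a => F.map a ≫ v) h
  have hZ (Z : T) : Function.Bijective fun g : Z ⟶ X => F.map g ≫ v :=
    bijective_map_comp_of_iso F v ((shiftFunctorZero T ℤ).app Z) (hP.eq_top hG hG' hGs hv Z 0)
  exact Functor.RepresentableBy.isRepresentable (Y := X)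
    { homEquiv := fun {Z} => Equiv.ofBijective _ (hZ Z)
      homEquiv_comp := fun f g => by simp }

end Representability

end Triangulated

/-! ### Partially defined left adjoints of triangulated functors -/

section UniversalArrow

/-- A morphism `η : X ⟶ F.obj L` is universal if every morphism `X ⟶ F.obj Y` factors uniquely
through it, that is, `L` is the value at `X` of the partially defined left adjoint of `F`. -/
def IsUniversalArrow {S T : Type*} [Category* S] [Category* T] (F : S ⥤ T) {X : T} {L : S}
    (η : X ⟶ F.obj L) : Prop :=
  ∀ Y : S, Function.Bijective fun g : L ⟶ Y => η ≫ F.map g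

variable {S T : Type*} [Category* S] [Category* T] {F : S ⥤ T}

lemma IsUniversalArrow.leftAdjointObjIsDefined {X : T} {L : S} {η : X ⟶ F.obj L}
    (h : IsUniversalArrow F η) : F.leftAdjointObjIsDefined X :=
  Functor.CorepresentableBy.isCorepresentable (X := L)
    { homEquiv := fun {Y} => Equiv.ofBijective _ (h Y)
      homEquiv_comp := fun f g => by simp }

lemma exists_isUniversalArrow {X : T} (h : F.leftAdjointObjIsDefined X) :
    ∃ (L : S) (η : X ⟶ F.obj L), IsUniversalArrow F η := by
  obtain ⟨L, ⟨e⟩⟩ := h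
  refine ⟨L, e.homEquiv (𝟙 L), fun Y => ?_⟩
  have : (fun g : L ⟶ Y => e.homEquiv (𝟙 L) ≫ F.map g) = e.homEquiv :=
    funext fun g => (e.homEquiv_eq g).symm
  rw [this]
  exact e.homEquiv.bijective

lemma isUniversalArrow_unit {G : T ⥤ S} (adj : G ⊣ F) (X : T) :
    IsUniversalArrow F (adj.unit.app X) := fun Y => by
  have : (fun g : G.obj X ⟶ Y => adj.unit.app X ≫ F.map g) = adj.homEquiv X Y :=
    funext fun g => (adj.homEquiv_unit X Y g).symm
  rw [this]
  exact (adj.homEquiv X Y).bijective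

/-- The value of a left adjoint is determined up to isomorphism by its universal property. -/
lemma IsUniversalArrow.nonempty_iso {X : T} {L L' : S} {η : X ⟶ F.obj L} {η' : X ⟶ F.obj L'}
    (h : IsUniversalArrow F η) (h' : IsUniversalArrow F η') :
    ∃ e : L ≅ L', η ≫ F.map e.hom = η' := by
  obtain ⟨a, ha⟩ := (h _).2 η'
  obtain ⟨b, hb⟩ := (h' _).2 η
  dsimp at ha hb
  refine ⟨⟨a, b, (h _).1 ?_, (h' _).1 ?_⟩, ha⟩
  · dsimp
    rw [F.map_comp, reassoc_of% ha, hb, F.map_id, Category.comp_id]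
  · dsimp
    rw [F.map_comp, reassoc_of% hb, ha, F.map_id, Category.comp_id]

end UniversalArrow

/-- A right adjoint preserves coproducts if its left adjoint maps the members of a family of compact
objects which detects isomorphisms to compact objects. -/
lemma preservesCoproducts_of_forall_isCompactObj {T S : Type*} [Category* T] [Category* S]
    [Preadditive T] [Preadditive S] [∀ J : Type u, HasCoproductsOfShape J T] {L : T ⥤ S}
    {F : S ⥤ T} [F.Additive] (adj : L ⊣ F) {ι : Type*} (G : ι → T)
    (hG : ∀ n, IsCompactObj.{u} (G n))
    (hG' : ∀ ⦃X Y : T⦄ (f : X ⟶ Y), (∀ n, Function.Bijective fun g : G n ⟶ X => g ≫ f) → IsIso f)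
    (hL : ∀ n, IsCompactObj.{u} (L.obj (G n))) : PreservesCoproducts.{u} F := by
  intro J X c hc
  let d : Cofan fun j => F.obj (X j) := Cofan.mk _ (Sigma.ι _)
  have hd : IsColimit d := coproductIsCoproduct _
  -- the comparison morphism is an isomorphism, as tested on the objects `G n`
  let κ : d.pt ⟶ F.obj c.pt := Cofan.IsColimit.desc hd fun j => F.map (c.inj j)
  have hκ (j : J) : d.inj j ≫ κ = F.map (c.inj j) := Cofan.IsColimit.fac hd _ j
  have hκ' (j : J) : κ ≫ F.map (cofanProj hc j) = cofanProj hd j := by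
    refine Cofan.IsColimit.hom_ext hd _ _ fun i => ?_
    rw [← Category.assoc, hκ, ← F.map_comp]
    by_cases hij : i = j
    · subst hij
      rw [inj_cofanProj_self, inj_cofanProj_self, F.map_id]
    · rw [inj_cofanProj_of_ne hc hij, inj_cofanProj_of_ne hd hij, F.map_zero]
  have : IsIso κ := by
    refine hG' κ fun n => ⟨fun f f' hf => ?_, fun f => ?_⟩
    · rw [← sub_eq_zero]
      refine (hG n).eq_zero hd _ fun j => ?_
      rw [← hκ', ← Category.assoc, Preadditive.sub_comp, sub_eq_zero.2 hf, zero_comp]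
    · obtain ⟨A, hA⟩ : ∃ A : Finset J, f ≫ F.map (cofanPart hc A) = f := by
        obtain ⟨A, hA⟩ := hL n hc ((adj.homEquiv _ _).symm f)
        refine ⟨A, (adj.homEquiv _ _).symm.injective ?_⟩
        rw [adj.homEquiv_naturality_right_symm, hA]
      refine ⟨∑ j ∈ A, (f ≫ F.map (cofanProj hc j)) ≫ d.inj j, ?_⟩
      dsimp only
      rw [Preadditive.sum_comp]
      simp only [Category.assoc, hκ]
      conv_rhs => rw [← hA, cofanPart, F.map_sum, Preadditive.comp_sum]
      exact Finset.sum_congr rfl fun j _ => by rw [F.map_comp]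
  exact ⟨hd.ofIsoColimit (Cofan.ext (asIso κ) hκ)⟩

section Triangulated

open Pretriangulated

variable {T : Type*} [Category* T] [HasZeroObject T] [HasShift T ℤ] [Preadditive T]
  [∀ n : ℤ, (shiftFunctor T n).Additive] [Pretriangulated T]
  {S : Type*} [Category* S] [HasZeroObject S] [HasShift S ℤ] [Preadditive S]
  [∀ n : ℤ, (shiftFunctor S n).Additive] [Pretriangulated S]

/-- The shift of a universal arrow is universal. -/
lemma IsUniversalArrow.shift {F : S ⥤ T} [F.CommShift ℤ] {X : T} {L : S} {η : X ⟶ F.obj L}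
    (h : IsUniversalArrow F η) (n : ℤ) :
    IsUniversalArrow F (η⟦n⟧' ≫ (F.commShiftIso n).inv.app L) := by
  intro Y
  let e : (Y⟦-n⟧)⟦n⟧ ≅ Y := (shiftEquiv S n).counitIso.app Y
  have hc (g : L ⟶ Y⟦-n⟧) : (η⟦n⟧' ≫ (F.commShiftIso n).inv.app L) ≫ F.map (g⟦n⟧') =
      (η ≫ F.map g)⟦n⟧' ≫ (F.commShiftIso n).inv.app _ := by
    rw [Functor.map_comp, Category.assoc, Category.assoc]
    congr 1
    exact ((F.commShiftIso n).inv.naturality g).symm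
  have key (g : L⟦n⟧ ⟶ Y) : ∃ g' : L ⟶ Y⟦-n⟧, g = g'⟦n⟧' ≫ e.hom := by
    obtain ⟨g', hg'⟩ := (shiftFunctor S n).map_surjective (g ≫ e.inv)
    exact ⟨g', by rw [hg', Category.assoc, e.inv_hom_id, Category.comp_id]⟩
  refine ⟨fun g g' hg => ?_, fun k => ?_⟩
  · obtain ⟨g, rfl⟩ := key g
    obtain ⟨g', rfl⟩ := key g'
    dsimp only at hg
    rw [F.map_comp, F.map_comp, ← Category.assoc, ← Category.assoc, cancel_mono, hc, hc,
      cancel_mono] at hg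
    rw [(h _).1 ((shiftFunctor T n).map_injective hg)]
  · obtain ⟨k', hk'⟩ := (shiftFunctor T n).map_surjective
      (k ≫ F.map e.inv ≫ (F.commShiftIso n).hom.app _)
    obtain ⟨g, hg⟩ := (h _).2 k'
    refine ⟨g⟦n⟧' ≫ e.hom, ?_⟩
    dsimp only at hg ⊢
    rw [F.map_comp, ← Category.assoc, hc, hg, hk']
    simp [← F.map_comp]

/-- The cone of objects with universal arrows has a universal arrow to the cone of their values, by
the five lemma. -/
lemma isUniversalArrow_of_distTriang {F : S ⥤ T} [F.CommShift ℤ] [F.IsTriangulated] {A B C : T}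
    {a : A ⟶ B} {b : B ⟶ C} {d : C ⟶ A⟦(1 : ℤ)⟧} (hT : Triangle.mk a b d ∈ distTriang T)
    {LA LB : S} {ηA : A ⟶ F.obj LA} {ηB : B ⟶ F.obj LB} (hA : IsUniversalArrow F ηA)
    (hB : IsUniversalArrow F ηB) :
    ∃ (LC : S) (ηC : C ⟶ F.obj LC), IsUniversalArrow F ηC := by
  obtain ⟨l, hl⟩ := (hA _).2 (a ≫ ηB)
  dsimp only at hl
  obtain ⟨LC, m, k, hT'⟩ := Pretriangulated.distinguished_cocone_triangle l
  have hFT := map_distTriang hT' F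
  obtain ⟨ηC, hC₁, hC₂⟩ : ∃ ηC : C ⟶ F.obj LC, b ≫ ηC = ηB ≫ F.map m ∧
      d ≫ ηA⟦(1 : ℤ)⟧' = ηC ≫ F.map k ≫ (F.commShiftIso (1 : ℤ)).hom.app LA :=
    complete_distinguished_triangle_morphism _ _ hT hFT ηA ηB hl.symm
  have hA₁ := hA.shift 1
  have hB₁ := hB.shift 1
  have hkd : d ≫ (ηA⟦(1 : ℤ)⟧' ≫ (F.commShiftIso (1 : ℤ)).inv.app LA) = ηC ≫ F.map k := by
    rw [reassoc_of% hC₂]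
    simp
  have hl₁ : (ηA⟦(1 : ℤ)⟧' ≫ (F.commShiftIso (1 : ℤ)).inv.app LA) ≫ F.map (l⟦(1 : ℤ)⟧') =
      a⟦(1 : ℤ)⟧' ≫ (ηB⟦(1 : ℤ)⟧' ≫ (F.commShiftIso (1 : ℤ)).inv.app LB) := by
    have h1 : (ηA ≫ F.map l)⟦(1 : ℤ)⟧' ≫ (F.commShiftIso (1 : ℤ)).inv.app LB =
        (a ≫ ηB)⟦(1 : ℤ)⟧' ≫ (F.commShiftIso (1 : ℤ)).inv.app LB := by rw [hl]
    rw [Functor.map_comp, Functor.map_comp, Category.assoc, Category.assoc] at h1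
    rw [Category.assoc, ← h1]
    congr 1
    exact ((F.commShiftIso (1 : ℤ)).inv.naturality l).symm
  have inj {W : T} {L Y : S} {η : W ⟶ F.obj L} (hη : IsUniversalArrow F η) (g : L ⟶ Y)
      (hg : η ≫ F.map g = 0) : g = 0 := (hη Y).1 (by simpa using hg)
  refine ⟨LC, ηC, fun Y => ⟨fun z z' hz => ?_, fun v => ?_⟩⟩
  · rw [← sub_eq_zero]
    have h0 : ηC ≫ F.map (z - z') = 0 := by
      rw [F.map_sub, Preadditive.comp_sub, sub_eq_zero]
      exact hz
    generalize z - z' = z at h0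
    obtain ⟨x, rfl⟩ := exists_desc₃ hT' z (inj hB _ (by
      rw [F.map_comp, ← Category.assoc, ← hC₁, Category.assoc, h0, comp_zero]))
    obtain ⟨t, ht⟩ := exists_desc₁ hT
      ((ηA⟦(1 : ℤ)⟧' ≫ (F.commShiftIso (1 : ℤ)).inv.app LA) ≫ F.map x) (by
        rw [← Category.assoc, hkd, Category.assoc, ← F.map_comp, h0])
    obtain ⟨s, hs⟩ := (hB₁ _).2 t
    dsimp only at hs
    have : x = l⟦(1 : ℤ)⟧' ≫ s := by
      apply (hA₁ _).1
      dsimp only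
      rw [← ht, ← hs, F.map_comp, ← Category.assoc (ηA⟦(1 : ℤ)⟧' ≫ _), hl₁,
        Category.assoc (a⟦(1 : ℤ)⟧')]
    rw [this, ← Category.assoc, distTriang_comp₃₁ hT', zero_comp]
  · obtain ⟨y, hy⟩ := (hB _).2 (b ≫ v)
    dsimp only at hy
    obtain ⟨z, hz⟩ := exists_desc₂ hT' y (inj hA _ (by
      rw [F.map_comp, ← Category.assoc, hl, Category.assoc, hy, ← Category.assoc,
        distTriang_comp₁₂ hT, zero_comp]))
    obtain ⟨w, hw⟩ := exists_desc₃ hT (v - ηC ≫ F.map z) (by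
      rw [Preadditive.comp_sub, ← Category.assoc, hC₁, Category.assoc, ← F.map_comp, hz, hy,
        sub_self])
    obtain ⟨x, hx⟩ := (hA₁ _).2 w
    refine ⟨z + k ≫ x, ?_⟩
    dsimp only at hx ⊢
    rw [F.map_add, Preadditive.comp_add, F.map_comp k x, ← Category.assoc ηC, ← hkd,
      Category.assoc, hx, hw, add_sub_cancel]

/-- The partially defined left adjoint of a triangulated functor is defined on a localizing
subcategory. -/
lemma isLocalizing_leftAdjointObjIsDefined [∀ J : Type u, HasCoproductsOfShape J S] (F : S ⥤ T)
    [F.CommShift ℤ] [F.IsTriangulated] : IsLocalizing.{u} F.leftAdjointObjIsDefined := by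
  refine ⟨fun X n hX => ?_, fun A B C a b d hT hA hB => ?_, fun J X c hc hX =>
    Functor.leftAdjointObjIsDefined_of_isColimit hc fun j => hX _⟩
  · obtain ⟨L, η, h⟩ := exists_isUniversalArrow hX
    exact (h.shift n).leftAdjointObjIsDefined
  · obtain ⟨LA, ηA, hA⟩ := exists_isUniversalArrow hA
    obtain ⟨LB, ηB, hB⟩ := exists_isUniversalArrow hB
    obtain ⟨LC, ηC, hC⟩ := isUniversalArrow_of_distTriang hT hA hB
    exact hC.leftAdjointObjIsDefined

/-- A triangulated functor has a left adjoint as soon as the left adjoint is defined at a compact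
weak generator. -/
lemma isRightAdjoint_of_isUniversalArrow [∀ J : Type u, HasCoproductsOfShape J S]
    [∀ J : Type u, HasCoproductsOfShape J T] (F : S ⥤ T) [F.CommShift ℤ] [F.IsTriangulated]
    {G : T} (hG : IsCompactObj.{u} G) (hG' : IsWeakGenerator G)
    (hGs : ∀ (n : ℤ) (X : T), Small.{u} (G⟦n⟧ ⟶ X)) {L : S} {η : G ⟶ F.obj L}
    (h : IsUniversalArrow F η) : F.IsRightAdjoint := by
  refine Functor.isRightAdjoint_of_leftAdjointObjIsDefined_eq_top ?_
  ext X
  simp only [Pi.top_apply, Prop.top_eq_true, iff_true]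
  exact (isLocalizing_leftAdjointObjIsDefined.{u} F).eq_top hG hG' hGs h.leftAdjointObjIsDefined X

/-- A functor preserves coproducts if its left adjoint maps the shifts of a compact weak generator
to compact objects. -/
lemma preservesCoproducts_of_isCompactObj [∀ J : Type u, HasCoproductsOfShape J T]
    {L : T ⥤ S} {F : S ⥤ T} [F.Additive] (adj : L ⊣ F) {G : T} (hG : IsCompactObj.{u} G)
    (hG' : IsWeakGenerator G) (hL : ∀ n : ℤ, IsCompactObj.{u} (L.obj (G⟦n⟧))) :
    PreservesCoproducts.{u} F :=
  preservesCoproducts_of_forall_isCompactObj adj (fun n : ℤ => G⟦n⟧) (fun n => hG.shift n)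
    (fun _ _ f hf => hG'.isIso f hf) hL

end Triangulated

/-! ### Constructing recollements downwards -/

section RecollementSteps

open Pretriangulated

variable {A B C : Type u} [Category.{v} A] [Category.{v} B] [Category.{v} C]
  [HasZeroObject A] [HasZeroObject B] [HasZeroObject C]
  [Preadditive A] [Preadditive B] [Preadditive C] [HasShift A ℤ] [HasShift B ℤ] [HasShift C ℤ]
  [∀ n : ℤ, (shiftFunctor A n).Additive] [∀ n : ℤ, (shiftFunctor B n).Additive]
  [∀ n : ℤ, (shiftFunctor C n).Additive]
  [Pretriangulated A] [Pretriangulated B] [Pretriangulated C]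

lemma IsTriangleFunctor.rightAdjoint {F : A ⥤ B} {G : B ⥤ A} (hF : IsTriangleFunctor F)
    (adj : F ⊣ G) : IsTriangleFunctor G := by
  obtain ⟨_, _⟩ := hF
  let := adj.rightAdjointCommShift ℤ
  have := adj.commShift_of_leftAdjoint ℤ
  exact ⟨inferInstance, adj.isTriangulated_rightAdjoint⟩

lemma IsTriangleFunctor.leftAdjoint {F : A ⥤ B} {G : B ⥤ A} (hG : IsTriangleFunctor G)
    (adj : F ⊣ G) : IsTriangleFunctor F := by
  obtain ⟨_, _⟩ := hG
  let := adj.leftAdjointCommShift ℤ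
  have := adj.commShift_of_rightAdjoint ℤ
  exact ⟨inferInstance, adj.isTriangulated_leftAdjoint⟩

lemma IsTriangleFunctor.additive {F : A ⥤ B} (hF : IsTriangleFunctor F) : F.Additive := by
  obtain ⟨_, _⟩ := hF
  infer_instance

lemma isIso_of_distTriang_isZero₃ {X Y Z : B} {f : X ⟶ Y} {g : Y ⟶ Z} {h : Z ⟶ X⟦(1 : ℤ)⟧}
    (hT : Triangle.mk f g h ∈ distTriang B) (hZ : IsZero Z) : IsIso f :=
  (Triangle.isZero₃_iff_isIso₁ _ hT).1 hZ

lemma isIso_of_distTriang_isZero₁ {X Y Z : B} {f : X ⟶ Y} {g : Y ⟶ Z} {h : Z ⟶ X⟦(1 : ℤ)⟧}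
    (hT : Triangle.mk f g h ∈ distTriang B) (hX : IsZero X) : IsIso g :=
  (Triangle.isZero₁_iff_isIso₂ _ hT).1 hX

lemma isZero_of_distTriang_isIso₁ {X Y Z : B} {f : X ⟶ Y} {g : Y ⟶ Z} {h : Z ⟶ X⟦(1 : ℤ)⟧}
    (hT : Triangle.mk f g h ∈ distTriang B) (hf : IsIso f) : IsZero Z :=
  (Triangle.isZero₃_iff_isIso₁ _ hT).2 hf

lemma isZero_of_distTriang_isIso₂ {X Y Z : B} {f : X ⟶ Y} {g : Y ⟶ Z} {h : Z ⟶ X⟦(1 : ℤ)⟧}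
    (hT : Triangle.mk f g h ∈ distTriang B) (hg : IsIso g) : IsZero X :=
  (Triangle.isZero₁_iff_isIso₂ _ hT).2 hg

lemma exists_distTriang {X Y : B} (f : X ⟶ Y) :
    ∃ (Z : B) (g : Y ⟶ Z) (h : Z ⟶ X⟦(1 : ℤ)⟧), Triangle.mk f g h ∈ distTriang B :=
  distinguished_cocone_triangle f

lemma exists_fiber {Y Z : B} (g : Y ⟶ Z) :
    ∃ (X : B) (f : X ⟶ Y) (h : Z ⟶ X⟦(1 : ℤ)⟧), Triangle.mk f g h ∈ distTriang B :=
  distinguished_cocone_triangle₁ g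

lemma isZero_iff_forall_eq_zero {X : B} : IsZero X ↔ ∀ f : X ⟶ X, f = 0 :=
  ⟨fun h _ => h.eq_of_src _ _, fun h => (IsZero.iff_id_eq_zero X).2 (h _)⟩

lemma exists_lift₁ {X Y Z W : B} {f : X ⟶ Y} {g : Y ⟶ Z} {h : Z ⟶ X⟦(1 : ℤ)⟧}
    (hT : Triangle.mk f g h ∈ distTriang B) (k : W ⟶ X⟦(1 : ℤ)⟧) (hk : k ≫ f⟦(1 : ℤ)⟧' = 0) :
    ∃ l : W ⟶ Z, l ≫ h = k :=
  (Triangle.coyoneda_exact₁ _ hT k hk).imp fun _ => Eq.symm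

lemma isIso_map_counit {F : A ⥤ B} {G : B ⥤ A} (adj : F ⊣ G) [IsIso adj.unit] (X : B) :
    IsIso (G.map (adj.counit.app X)) :=
  isIso_of_hom_comp_eq_id (adj.unit.app (G.obj X)) (adj.right_triangle_components X)

lemma isIso_map_unit {F : A ⥤ B} {G : B ⥤ A} (adj : F ⊣ G) [IsIso adj.counit] (X : A) :
    IsIso (F.map (adj.unit.app X)) :=
  isIso_of_comp_hom_eq_id (adj.counit.app (F.obj X)) (adj.left_triangle_components X)

/-- Morphisms from the first two terms of a triangle agree if there are no nonzero morphisms from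
the third term and its desuspension. -/
lemma bijective_precomp_of_distTriang {X Y Z W : B} {f : X ⟶ Y} {g : Y ⟶ Z}
    {h : Z ⟶ X⟦(1 : ℤ)⟧} (hT : Triangle.mk f g h ∈ distTriang B) (h₀ : ∀ k : Z ⟶ W, k = 0)
    (h₁ : ∀ k : Z⟦(-1 : ℤ)⟧ ⟶ W, k = 0) : Function.Bijective fun k : Y ⟶ W => f ≫ k := by
  refine ⟨fun k k' hk => ?_, fun k => ?_⟩
  · rw [← sub_eq_zero]
    obtain ⟨l, hl⟩ := exists_desc₂ hT (k - k') (by rw [Preadditive.comp_sub, sub_eq_zero.2 hk])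
    rw [← hl, h₀ l, comp_zero]
  · obtain ⟨l, hl⟩ := Triangle.yoneda_exact₂ _ (inv_rot_of_distTriang _ hT) k (h₁ _)
    exact ⟨l, hl.symm⟩

/-- If `R.r` has a right adjoint `s`, then the value of a right adjoint of `R.p` at `Z` is the
cone of the counit `r s i Z ⟶ i Z`. -/
lemma TriangulatedRecollement.isLeftAdjoint_p {i : A ⥤ B} {e : B ⥤ C}
    (R : TriangulatedRecollement i e) {s : B ⥤ C} (adj : R.r ⊣ s)
    (hr : ∀ X : B, IsZero (R.p.obj X) → R.r.essImage X)
    (hpr : ∀ Z : C, IsZero (R.p.obj (R.r.obj Z))) : R.p.IsLeftAdjoint := by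
  have := R.full_i
  have := R.faithful_i
  have := R.full_r
  have := R.faithful_r
  have hs := R.triangle_r.rightAdjoint adj
  obtain ⟨_, _⟩ := R.triangle_p
  obtain ⟨_, _⟩ := hs
  refine Functor.isLeftAdjoint_of_rightAdjointObjIsDefined_eq_top ?_
  ext Y
  simp only [Pi.top_apply, Prop.top_eq_true, iff_true]
  obtain ⟨Z, g, d, hT⟩ := exists_distTriang (adj.counit.app (i.obj Y))
  have hsZ : IsZero (s.obj Z) :=
    isZero_of_distTriang_isIso₁ (map_distTriang hT s) (isIso_map_counit adj _)
  -- `Z` is right orthogonal to the image of `R.r`, so that `R.p` is bijective on morphisms to `Z`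
  have hrZ (X : B) (hX : R.r.essImage X) (k : X ⟶ Z) : k = 0 := by
    obtain ⟨W, ⟨a⟩⟩ := hX
    rw [← cancel_epi a.hom, comp_zero]
    exact (adj.homEquiv _ _).injective (hsZ.eq_of_tgt _ _)
  have hg : IsIso (R.p.map g) := isIso_of_distTriang_isZero₁ (map_distTriang hT R.p) (hpr _)
  let v : R.p.obj Z ⟶ Y := inv (R.p.map g) ≫ inv (R.adj_i_p.unit.app Y)
  have hv (X : B) : Function.Bijective fun k : X ⟶ Z => R.p.map k ≫ v := by
    obtain ⟨W, b, c, hT'⟩ := exists_distTriang (R.adj_i_p.counit.app X)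
    have hpW : IsZero (R.p.obj W) :=
      isZero_of_distTriang_isIso₁ (map_distTriang hT' R.p) (isIso_map_counit R.adj_i_p X)
    have hpW' : IsZero (R.p.obj (W⟦(-1 : ℤ)⟧)) :=
      IsZero.of_iso ((shiftFunctor A (-1 : ℤ)).map_isZero hpW) ((R.p.commShiftIso (-1 : ℤ)).app W)
    have h₁ := bijective_precomp_of_distTriang hT' (hrZ _ (hr _ hpW)) (hrZ _ (hr _ hpW'))
    have h₂ : Function.Bijective fun k : X ⟶ Z => R.p.map k := by
      have h₃ : (fun k : X ⟶ Z => R.p.map k) = fun k =>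
          R.adj_i_p.homEquiv (R.p.obj X) Z (R.adj_i_p.counit.app X ≫ k) :=
        funext fun k => by simp [Adjunction.homEquiv_unit]
      rw [h₃]
      exact (R.adj_i_p.homEquiv (R.p.obj X) Z).bijective.comp h₁
    have h₄ : Function.Bijective fun k : R.p.obj X ⟶ R.p.obj Z => k ≫ v :=
      ⟨fun k k' hk => (cancel_mono v).1 hk, fun k => ⟨k ≫ inv v, by simp⟩⟩
    exact h₄.comp h₂
  exact Functor.RepresentableBy.isRepresentable (Y := Z)
    { homEquiv := fun {X} => Equiv.ofBijective _ (hv X)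
      homEquiv_comp := fun f g => by simp }

lemma TriangulatedRecollement.isZero_p_r {i : A ⥤ B} {e : B ⥤ C}
    (R : TriangulatedRecollement i e) (Z : C) : IsZero (R.p.obj (R.r.obj Z)) := by
  have hei : IsZero (e.obj (i.obj (R.p.obj (R.r.obj Z)))) :=
    (R.image_eq_kernel _).1 (i.obj_mem_essImage _)
  rw [isZero_iff_forall_eq_zero]
  intro f
  apply (R.adj_i_p.homEquiv _ _).symm.injective
  apply (R.adj_e_r.homEquiv _ _).symm.injective
  exact hei.eq_of_src _ _

/-- The essential image of `r` is the kernel of `p`: if `p X` vanishes, the fiber `F` of the unit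
`X ⟶ r e X` lies in the image of `i` and is killed by `p`, hence is zero. -/
lemma TriangulatedRecollement.essImage_r_iff {i : A ⥤ B} {e : B ⥤ C}
    (R : TriangulatedRecollement i e) (X : B) : R.r.essImage X ↔ IsZero (R.p.obj X) := by
  refine ⟨fun ⟨Z, ⟨a⟩⟩ => IsZero.of_iso (R.isZero_p_r Z) (R.p.mapIso a.symm), fun h => ?_⟩
  have := R.full_i
  have := R.faithful_i
  have := R.full_r
  have := R.faithful_r
  obtain ⟨_, _⟩ := R.triangle_e
  obtain ⟨_, _⟩ := R.triangle_p
  obtain ⟨F, f, d, hT⟩ := exists_fiber (R.adj_e_r.unit.app X)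
  have heF : IsZero (e.obj F) :=
    isZero_of_distTriang_isIso₂ (map_distTriang hT e) (isIso_map_unit R.adj_e_r X)
  have hpF : IsZero (R.p.obj F) := by
    refine isZero_of_distTriang_isIso₂ (map_distTriang hT R.p) ?_
    exact ⟨0, h.eq_of_src _ _, (R.isZero_p_r _).eq_of_src _ _⟩
  obtain ⟨Z, ⟨a⟩⟩ := (R.image_eq_kernel F).2 heF
  have hZ : IsZero Z :=
    IsZero.of_iso hpF (asIso (R.adj_i_p.unit.app Z) ≪≫ R.p.mapIso a)
  obtain ⟨_, _⟩ := R.triangle_i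
  have hF : IsZero F := IsZero.of_iso (i.map_isZero hZ) a.symm
  have := isIso_of_distTriang_isZero₁ hT hF
  exact ⟨_, ⟨(asIso (R.adj_e_r.unit.app X)).symm⟩⟩

/-- A recollement can be continued downwards as soon as its functor `r` has a right adjoint. -/
theorem TriangulatedRecollement.exists_next {i : A ⥤ B} {e : B ⥤ C}
    (R : TriangulatedRecollement i e) (h : R.r.IsLeftAdjoint) :
    Nonempty (TriangulatedRecollement R.r R.p) := by
  let adj := Adjunction.ofIsLeftAdjoint R.r
  have hp := R.isLeftAdjoint_p adj (fun X => (R.essImage_r_iff X).2) R.isZero_p_r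
  let adj' := Adjunction.ofIsLeftAdjoint R.p
  have := R.full_i
  have := R.faithful_i
  have hff := (Adjunction.Triple.mk R.adj_i_p adj').fullyFaithfulEquiv
    (Functor.FullyFaithful.ofFullyFaithful i)
  exact ⟨{
    q := e
    p := R.r.rightAdjoint
    l := i
    r := R.p.rightAdjoint
    adj_q_i := R.adj_e_r
    adj_i_p := adj
    adj_l_e := R.adj_i_p
    adj_e_r := adj'
    full_i := R.full_r
    faithful_i := R.faithful_r
    full_l := R.full_i
    faithful_l := R.faithful_i
    full_r := hff.full
    faithful_r := hff.faithful
    image_eq_kernel := R.essImage_r_iff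
    triangle_i := R.triangle_r
    triangle_e := R.triangle_p
    triangle_q := R.triangle_e
    triangle_p := R.triangle_r.rightAdjoint adj
    triangle_l := R.triangle_i
    triangle_r := R.triangle_p.rightAdjoint adj' }⟩

/-- If `R.p` has a right adjoint `t`, then the value of a right adjoint of `R.r` at `X` is the
preimage under `R.r` of the fiber of the unit `X ⟶ t p X`. -/
lemma TriangulatedRecollement.isLeftAdjoint_r {i : A ⥤ B} {e : B ⥤ C}
    (R : TriangulatedRecollement i e) (h : R.p.IsLeftAdjoint) : R.r.IsLeftAdjoint := by
  let adj := Adjunction.ofIsLeftAdjoint R.p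
  have := R.full_i
  have := R.faithful_i
  have := R.full_r
  have := R.faithful_r
  have hff := (Adjunction.Triple.mk R.adj_i_p adj).fullyFaithfulEquiv
    (Functor.FullyFaithful.ofFullyFaithful i)
  have := hff.full
  have := hff.faithful
  obtain ⟨_, _⟩ := R.triangle_p
  refine Functor.isLeftAdjoint_of_rightAdjointObjIsDefined_eq_top ?_
  ext X
  simp only [Pi.top_apply, Prop.top_eq_true, iff_true]
  obtain ⟨F, f, d, hT⟩ := exists_fiber (adj.unit.app X)
  have hpF : IsZero (R.p.obj F) :=
    isZero_of_distTriang_isIso₂ (map_distTriang hT R.p) (isIso_map_unit adj X)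
  obtain ⟨W, ⟨a⟩⟩ := (R.essImage_r_iff F).2 hpF
  -- There are no nonzero morphisms from the image of `R.r` to the image of `R.p.rightAdjoint`.
  have h₀ (V : B) (hV : IsZero (R.p.obj V)) (Y : A) (k : V ⟶ R.p.rightAdjoint.obj Y) : k = 0 :=
    (adj.homEquiv _ _).symm.injective (hV.eq_of_src _ _)
  have hv (V : C) : Function.Bijective fun k : V ⟶ W => R.r.map k ≫ a.hom ≫ f := by
    refine ⟨fun k k' hk => ?_, fun k => ?_⟩
    · apply R.r.map_injective
      rw [← cancel_mono a.hom, ← sub_eq_zero]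
      have hk' : (R.r.map k ≫ a.hom - R.r.map k' ≫ a.hom) ≫ f = 0 := by
        rw [Preadditive.sub_comp, Category.assoc, Category.assoc]
        exact sub_eq_zero.2 hk
      generalize R.r.map k ≫ a.hom - R.r.map k' ≫ a.hom = z at hk'
      apply (shiftFunctor B (1 : ℤ)).map_injective
      obtain ⟨y, hy⟩ := exists_lift₁ hT (z⟦(1 : ℤ)⟧') (by
        rw [← Functor.map_comp, hk', Functor.map_zero])
      have hy0 := h₀ ((R.r.obj V)⟦(1 : ℤ)⟧)
        (IsZero.of_iso ((shiftFunctor A (1 : ℤ)).map_isZero (R.isZero_p_r V))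
          ((R.p.commShiftIso (1 : ℤ)).app _)) _ y
      rw [← hy, hy0, zero_comp, Functor.map_zero]
    · obtain ⟨l, hl⟩ := exists_lift₂ hT k (h₀ _ (R.isZero_p_r V) _ _)
      obtain ⟨k', hk'⟩ := R.r.map_surjective (l ≫ a.inv)
      exact ⟨k', by simp [hk', hl]⟩
  exact Functor.RepresentableBy.isRepresentable (Y := W)
    { homEquiv := fun {V} => Equiv.ofBijective _ (hv V)
      homEquiv_comp := fun f g => by simp }

/-- A recollement starts a ladder of height four going downwards if its functor `r` is the first
of four functors `r ⊣ r₁ ⊣ r₂ ⊣ r₃`. -/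
theorem TriangulatedRecollement.hasDownwardLadder_four {i : A ⥤ B} {e : B ⥤ C}
    (R : TriangulatedRecollement i e) {r₁ r₃ : B ⥤ C} {r₂ : C ⥤ B} (adj₁ : R.r ⊣ r₁)
    (adj₂ : r₁ ⊣ r₂) (adj₃ : r₂ ⊣ r₃) : HasDownwardLadder 4 i e := by
  obtain ⟨R₂⟩ := R.exists_next ⟨_, ⟨adj₁⟩⟩
  have adj₂' : R₂.p ⊣ r₂ := adj₂.ofNatIsoLeft (adj₁.rightAdjointUniq R₂.adj_i_p)
  obtain ⟨R₃⟩ := R₂.exists_next (R₂.isLeftAdjoint_r ⟨_, ⟨adj₂'⟩⟩)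
  have adj₃' : R₃.r ⊣ r₃ := adj₃.ofNatIsoLeft (adj₂'.rightAdjointUniq R₃.adj_e_r)
  obtain ⟨R₄⟩ := R₃.exists_next ⟨_, ⟨adj₃'⟩⟩
  exact ⟨R, R₂, R₃, R₄, trivial⟩

/-- A ladder of height four going downwards provides functors `r ⊣ r₁ ⊣ r₂ ⊣ r₃`. -/
theorem HasDownwardLadder.exists_adjunctions {i : A ⥤ B} {e : B ⥤ C}
    (h : HasDownwardLadder 4 i e) : ∃ (r r₂ : C ⥤ B) (r₁ r₃ : B ⥤ C),
      Nonempty (e ⊣ r) ∧ Nonempty (r ⊣ r₁) ∧ Nonempty (r₁ ⊣ r₂) ∧ Nonempty (r₂ ⊣ r₃) := by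
  obtain ⟨R, R₂, R₃, R₄, -⟩ := h
  exact ⟨R.r, R₃.r, R₂.p, R₄.p, ⟨R.adj_e_r⟩, ⟨R₂.adj_i_p⟩, ⟨R₃.adj_e_r⟩, ⟨R₄.adj_i_p⟩⟩

end RecollementSteps

/-! ### Morphisms in the derived category from projective objects -/

section DerivedHom

open DerivedCategory CochainComplex HomologicalComplex

variable {C : Type u} [Category.{v} C] [Abelian C]

lemma isKProjective_single (k : ℤ) (P : C) [Projective P] :
    CochainComplex.IsKProjective ((single C (ComplexShape.up ℤ) k).obj P) := by
  have (n : ℤ) : Projective (((single C (ComplexShape.up ℤ) k).obj P).X n) := by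
    by_cases h : n = k
    · subst h
      exact Projective.of_iso (singleObjXSelf (ComplexShape.up ℤ) n P).symm inferInstance
    · have := isZero_single_obj_X (ComplexShape.up ℤ) k P n h
      exact Projective.of_iso this.isoZero.symm inferInstance
  have : CochainComplex.IsStrictlyLE ((single C (ComplexShape.up ℤ) k).obj P) k :=
    inferInstanceAs (CochainComplex.IsStrictlyLE ((CochainComplex.singleFunctor C k).obj P) k)
  exact CochainComplex.isKProjective_of_projective _ k

/-- The morphism from an object placed in degree `k` given by a cycle. -/
def fromSingle {Y : CochainComplex C ℤ} {P : C} (k : ℤ) (g : P ⟶ Y.X k)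
    (hg : g ≫ Y.d k (k + 1) = 0) : (single C (ComplexShape.up ℤ) k).obj P ⟶ Y :=
  mkHomFromSingle g (by
    rintro j rfl
    exact hg)

lemma fromSingle_surjective {Y : CochainComplex C ℤ} {P : C} {k : ℤ}
    (f : (single C (ComplexShape.up ℤ) k).obj P ⟶ Y) :
    ∃ (g : P ⟶ Y.X k) (hg : g ≫ Y.d k (k + 1) = 0), fromSingle k g hg = f := by
  refine ⟨(singleObjXSelf (ComplexShape.up ℤ) k P).inv ≫ f.f k, ?_, ?_⟩
  · rw [Category.assoc, f.comm, single_obj_d, zero_comp, comp_zero]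
  · apply from_single_hom_ext
    rw [fromSingle, mkHomFromSingle_f]
    simp

lemma fromSingle_comp {Y Z : CochainComplex C ℤ} {P : C} (k : ℤ) (g : P ⟶ Y.X k)
    (hg : g ≫ Y.d k (k + 1) = 0) (f : Y ⟶ Z) :
    fromSingle k g hg ≫ f = fromSingle k (g ≫ f.f k) (by
      rw [Category.assoc, f.comm, reassoc_of% hg, zero_comp]) := by
  apply from_single_hom_ext
  rw [comp_f, fromSingle, fromSingle, mkHomFromSingle_f, mkHomFromSingle_f, Category.assoc]

variable [HasDerivedCategory.{w} C]

lemma exists_Q_map_eq (K L : CochainComplex C ℤ) [K.IsKProjective] (f : Q.obj K ⟶ Q.obj L) :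
    ∃ g : K ⟶ L, Q.map g = f := by
  obtain ⟨g, hg⟩ := (CochainComplex.IsKProjective.Qh_map_bijective K _).2
    ((quotientCompQhIso C).hom.app K ≫ f ≫ (quotientCompQhIso C).inv.app L)
  obtain ⟨g, rfl⟩ := (HomotopyCategory.quotient _ _).map_surjective g
  refine ⟨g, ?_⟩
  rw [← cancel_epi ((quotientCompQhIso C).hom.app K), ← quotientCompQhIso_hom_naturality, hg]
  simp

lemma homotopy_of_Q_map_eq_zero {K L : CochainComplex C ℤ} [K.IsKProjective] {g : K ⟶ L}
    (h : Q.map g = 0) : Nonempty (Homotopy g 0) := by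
  refine ⟨HomotopyCategory.homotopyOfEq _ _
    ((CochainComplex.IsKProjective.Qh_map_bijective K _).1 ?_)⟩
  rw [← cancel_mono ((quotientCompQhIso C).hom.app L), quotientCompQhIso_hom_naturality,
    quotientCompQhIso_hom_naturality, h, Functor.map_zero]

lemma Q_map_eq_zero_of_homotopy {K L : CochainComplex C ℤ} {g : K ⟶ L} (h : Homotopy g 0) :
    Q.map g = 0 := by
  rw [Q_map_eq_of_homotopy C h, Functor.map_zero]

lemma exists_Q_map_fromSingle {Y : CochainComplex C ℤ} {P : C} [Projective P] {k : ℤ}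
    (f : Q.obj ((single C (ComplexShape.up ℤ) k).obj P) ⟶ Q.obj Y) :
    ∃ (g : P ⟶ Y.X k) (hg : g ≫ Y.d k (k + 1) = 0), Q.map (fromSingle k g hg) = f := by
  have := isKProjective_single k P
  obtain ⟨f, rfl⟩ := exists_Q_map_eq _ _ f
  obtain ⟨g, hg, rfl⟩ := fromSingle_surjective f
  exact ⟨g, hg, rfl⟩

/-- The morphism given by a cycle vanishes in the derived category if and only if the cycle is a
boundary. -/
lemma Q_map_fromSingle_eq_zero_iff {Y : CochainComplex C ℤ} {P : C} [Projective P] {k : ℤ}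
    (g : P ⟶ Y.X k) (hg : g ≫ Y.d k (k + 1) = 0) :
    Q.map (fromSingle k g hg) = 0 ↔ ∃ h : P ⟶ Y.X (k - 1), h ≫ Y.d (k - 1) k = g := by
  have hf : (singleObjXSelf (ComplexShape.up ℤ) k P).inv ≫ (fromSingle k g hg).f k = g := by
    rw [fromSingle, mkHomFromSingle_f]
    simp
  refine ⟨fun h => ?_, ?_⟩
  · have := isKProjective_single k P
    obtain ⟨h⟩ := homotopy_of_Q_map_eq_zero h
    refine ⟨(singleObjXSelf (ComplexShape.up ℤ) k P).inv ≫ h.hom k (k - 1), ?_⟩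
    conv_rhs => rw [← hf, h.comm k]
    rw [dNext_eq h.hom (show (ComplexShape.up ℤ).Rel k (k + 1) from rfl),
      prevD_eq h.hom (show (ComplexShape.up ℤ).Rel (k - 1) k by simp), single_obj_d]
    simp
  · rintro ⟨h, rfl⟩
    refine Q_map_eq_zero_of_homotopy ((CochainComplex.HomComplex.Cochain.equivHomotopy _ _).symm
      ⟨CochainComplex.HomComplex.Cochain.fromSingleMk h (by lia), ?_⟩)
    have hδ := CochainComplex.HomComplex.Cochain.δ_fromSingleMk (K := Y) h (n := -1)
      (show k + -1 = k - 1 by lia) 0 k (by lia)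
    rw [CochainComplex.HomComplex.Cochain.ofHom_zero, add_zero]
    refine Eq.trans ?_ hδ.symm
    ext p
    by_cases hp : p = k
    · subst hp
      refine Eq.trans ?_ (CochainComplex.HomComplex.Cochain.fromSingleMk_v _ _).symm
      rw [CochainComplex.HomComplex.Cochain.ofHom_v, fromSingle, mkHomFromSingle_f]
    · exact (isZero_single_obj_X _ _ _ _ hp).eq_of_src _ _

/-- The suspension of an object placed in degree zero. -/
def shiftSingleIso (P : C) (n : ℤ) :
    (Q.obj ((single C (ComplexShape.up ℤ) 0).obj P))⟦n⟧ ≅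
      Q.obj ((single C (ComplexShape.up ℤ) (-n)).obj P) :=
  ((DerivedCategory.singleFunctors C).shiftIso n (-n) 0 (by lia)).app P

lemma Q_obj_surjective (X : DerivedCategory C) :
    ∃ Y : CochainComplex C ℤ, Nonempty (Q.obj Y ≅ X) :=
  ⟨_, ⟨Q.objObjPreimageIso X⟩⟩

/-- The image under a derived exact functor of an object placed in degree zero. -/
def mapDerivedSingleIso {D : Type*} [Category* D] [Abelian D]
    [HasDerivedCategory.{w} D] (F : D ⥤ C) [F.Additive] [PreservesFiniteLimits F]
    [PreservesFiniteColimits F] (M : D) :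
    F.mapDerivedCategory.obj (Q.obj ((single D (ComplexShape.up ℤ) 0).obj M)) ≅
      Q.obj ((single C (ComplexShape.up ℤ) 0).obj (F.obj M)) :=
  F.mapDerivedCategoryFactors.app _ ≪≫
    Q.mapIso ((singleMapHomologicalComplex F (ComplexShape.up ℤ) 0).app M)

/-- A universal arrow between projective objects remains universal in the derived category. -/
lemma isUniversalArrow_mapDerivedCategory {D : Type*} [Category* D] [Abelian D]
    [HasDerivedCategory.{w} D] (F : D ⥤ C) [F.Additive] [PreservesFiniteLimits F]
    [PreservesFiniteColimits F] {P : C} {P' : D} [Projective P] [Projective P']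
    {η : P ⟶ F.obj P'} (h : IsUniversalArrow F η) :
    ∃ η' : Q.obj ((single C (ComplexShape.up ℤ) 0).obj P) ⟶
        F.mapDerivedCategory.obj (Q.obj ((single D (ComplexShape.up ℤ) 0).obj P')),
      η' ≫ (mapDerivedSingleIso F P').hom = Q.map ((single C (ComplexShape.up ℤ) 0).map η) ∧
        IsUniversalArrow F.mapDerivedCategory η' := by
  let K := (single D (ComplexShape.up ℤ) 0).obj P'
  let FK := (F.mapHomologicalComplex (ComplexShape.up ℤ)).obj K
  let ι : P' ⟶ K.X 0 := (singleObjXSelf (ComplexShape.up ℤ) 0 P').inv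
  let g₀ : P ⟶ FK.X 0 := η ≫ F.map ι
  have hg₀ : g₀ ≫ FK.d 0 (0 + 1) = 0 := by
    change (η ≫ F.map ι) ≫ F.map (K.d 0 (0 + 1)) = 0
    rw [Category.assoc, ← F.map_comp, single_obj_d, comp_zero, F.map_zero, comp_zero]
  refine ⟨Q.map (fromSingle 0 g₀ hg₀) ≫ F.mapDerivedCategoryFactors.inv.app K, ?_, fun X => ?_⟩
  · have h1 : F.mapDerivedCategoryFactors.inv.app K ≫ (mapDerivedSingleIso F P').hom =
        Q.map ((singleMapHomologicalComplex F (ComplexShape.up ℤ) 0).hom.app P') :=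
      F.mapDerivedCategoryFactors.inv_hom_id_app_assoc K _
    rw [Category.assoc, h1]
    refine (Q.map_comp _ _).symm.trans (congrArg Q.map ?_)
    apply from_single_hom_ext
    rw [comp_f, fromSingle, mkHomFromSingle_f]
    have h2 : F.map ι ≫ F.map (singleObjXSelf (ComplexShape.up ℤ) 0 P').hom = 𝟙 _ := by
      rw [← F.map_comp, Iso.inv_hom_id, CategoryTheory.Functor.map_id]
    rw [singleMapHomologicalComplex_hom_app_self, single_map_f_self]
    refine (Category.assoc _ _ _).trans ?_
    refine congrArg ((singleObjXSelf (ComplexShape.up ℤ) 0 P).hom ≫ ·) ?_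
    refine (Category.assoc _ _ _).trans (congrArg (η ≫ ·) ?_)
    refine (Category.assoc _ _ _).symm.trans ?_
    exact (congrArg (· ≫ _) h2).trans (Category.id_comp _)
  have key {Y : CochainComplex D ℤ} (g : P' ⟶ Y.X 0) (hg : g ≫ Y.d 0 (0 + 1) = 0) :
      ∃ hg' : (η ≫ F.map g) ≫ F.map (Y.d 0 (0 + 1)) = 0,
      (Q.map (fromSingle 0 g₀ hg₀) ≫ F.mapDerivedCategoryFactors.inv.app K) ≫
        F.mapDerivedCategory.map (Q.map (fromSingle 0 g hg)) =
      Q.map (fromSingle (Y := (F.mapHomologicalComplex (ComplexShape.up ℤ)).obj Y) 0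
        (η ≫ F.map g) hg') ≫ F.mapDerivedCategoryFactors.inv.app Y := by
    refine ⟨by rw [Category.assoc, ← F.map_comp, hg, F.map_zero, comp_zero], ?_⟩
    have hn := F.mapDerivedCategoryFactors.inv.naturality (fromSingle 0 g hg)
    dsimp only [Functor.comp_map] at hn
    rw [Category.assoc, ← hn, ← Category.assoc, ← Q.map_comp, fromSingle_comp]
    congr 3
    change (η ≫ F.map ι) ≫ F.map ((fromSingle 0 g hg).f 0) = η ≫ F.map g
    rw [Category.assoc, ← F.map_comp, fromSingle, mkHomFromSingle_f]
    simp [ι]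
  have inj {M : D} {g : P' ⟶ M} (hg : η ≫ F.map g = 0) : g = 0 :=
    (h M).1 (by simpa using hg)
  have main (Y : CochainComplex D ℤ) : Function.Bijective fun f : Q.obj K ⟶ Q.obj Y =>
      (Q.map (fromSingle 0 g₀ hg₀) ≫ F.mapDerivedCategoryFactors.inv.app K) ≫
        F.mapDerivedCategory.map f := by
    refine ⟨fun f f' hf => ?_, fun f => ?_⟩
    · rw [← sub_eq_zero]
      have hf' : (Q.map (fromSingle 0 g₀ hg₀) ≫ F.mapDerivedCategoryFactors.inv.app K) ≫
          F.mapDerivedCategory.map (f - f') = 0 := by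
        rw [Functor.map_sub, Preadditive.comp_sub]
        exact sub_eq_zero.2 hf
      generalize f - f' = f at hf'
      obtain ⟨g, hg, rfl⟩ := exists_Q_map_fromSingle f
      obtain ⟨hg', e⟩ := key g hg
      rw [e] at hf'
      replace hf' := (cancel_mono (F.mapDerivedCategoryFactors.inv.app Y)).1
        (hf'.trans zero_comp.symm)
      obtain ⟨b, hb⟩ := (Q_map_fromSingle_eq_zero_iff _ _).1 hf'
      obtain ⟨b', rfl⟩ := (h _).2 b
      refine (Q_map_fromSingle_eq_zero_iff _ _).2 ⟨b', ?_⟩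
      rw [← sub_eq_zero]
      apply inj
      rw [F.map_sub, F.map_comp, Preadditive.comp_sub, sub_eq_zero, ← Category.assoc]
      exact hb
    · obtain ⟨g, hg, hf⟩ := exists_Q_map_fromSingle (f ≫ F.mapDerivedCategoryFactors.hom.app Y)
      obtain ⟨g', rfl⟩ := (h _).2 g
      have hg' : g' ≫ Y.d 0 (0 + 1) = 0 := by
        apply inj
        rw [F.map_comp, ← Category.assoc]
        exact hg
      refine ⟨Q.map (fromSingle 0 g' hg'), ?_⟩
      obtain ⟨hg'', e⟩ := key g' hg'
      refine e.trans ?_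
      rw [← cancel_mono (F.mapDerivedCategoryFactors.hom.app Y), Category.assoc,
        Iso.inv_hom_id_app]
      exact (Category.comp_id _).trans hf
  obtain ⟨Y, ⟨e⟩⟩ := Q_obj_surjective X
  refine ⟨fun f f' hf => ?_, fun f => ?_⟩
  · rw [← cancel_mono e.inv]
    apply (main Y).1
    dsimp only at hf ⊢
    rw [Functor.map_comp, Functor.map_comp, ← Category.assoc, hf, Category.assoc]
  · obtain ⟨g, hg⟩ := (main Y).2 (f ≫ F.mapDerivedCategory.map e.inv)
    refine ⟨g ≫ e.hom, ?_⟩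
    dsimp only at hg ⊢
    rw [Functor.map_comp, ← Category.assoc, hg, Category.assoc, ← Functor.map_comp,
      e.inv_hom_id, CategoryTheory.Functor.map_id, Category.comp_id]

end DerivedHom

/-! ### The derived category of modules: coproducts and the compact generator -/

section Coproducts

lemma preservesCoproducts_of_preservesColimits {T S : Type*} [Category* T] [Category* S]
    (F : T ⥤ S) [∀ J : Type u, PreservesColimitsOfShape (Discrete J) F] :
    PreservesCoproducts.{u} F := fun _ _ c hc =>
  ⟨Cofan.isColimitMapCoconeEquiv F _ c (isColimitOfPreserves F hc)⟩

/-- Compactness has to be checked for one coproduct of each family only. -/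
lemma isCompactObj_of_exists {T : Type*} [Category* T] [Preadditive T] {G : T}
    (h : ∀ ⦃J : Type u⦄ (X : J → T), ∃ (c : Cofan X) (hc : IsColimit c), ∀ f : G ⟶ c.pt,
      ∃ S : Finset J, f ≫ cofanPart hc S = f) : IsCompactObj.{u} G := by
  intro J X c hc f
  obtain ⟨d, hd, H⟩ := h X
  let φ : d.pt ⟶ c.pt := Cofan.IsColimit.desc hd c.inj
  let ψ : c.pt ⟶ d.pt := Cofan.IsColimit.desc hc d.inj
  have hφ (j : J) : d.inj j ≫ φ = c.inj j := Cofan.IsColimit.fac hd _ j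
  have hψ (j : J) : c.inj j ≫ ψ = d.inj j := Cofan.IsColimit.fac hc _ j
  have hψφ : ψ ≫ φ = 𝟙 _ := Cofan.IsColimit.hom_ext hc _ _ fun j => by
    rw [reassoc_of% hψ j, hφ, Category.comp_id]
  have hπ (j : J) : ψ ≫ cofanProj hd j = cofanProj hc j :=
    Cofan.IsColimit.hom_ext hc _ _ fun i => by
      rw [reassoc_of% hψ i]
      by_cases hij : i = j
      · subst hij
        rw [inj_cofanProj_self, inj_cofanProj_self]
      · rw [inj_cofanProj_of_ne _ hij, inj_cofanProj_of_ne _ hij]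
  obtain ⟨S, hS⟩ := H (f ≫ ψ)
  refine ⟨S, ?_⟩
  have : ψ ≫ cofanPart hd S ≫ φ = cofanPart hc S := by
    simp only [cofanPart, Preadditive.sum_comp, Preadditive.comp_sum, Category.assoc, hφ]
    exact Finset.sum_congr rfl fun j _ => by rw [← Category.assoc, hπ]
  rw [← this, ← Category.assoc, ← Category.assoc, hS, Category.assoc, hψφ, Category.comp_id]

end Coproducts

section ModuleCat

open DerivedCategory HomologicalComplex

variable {R : Type u} [Ring R]

/-- An element of a coproduct of modules lies in a finite subcoproduct. -/
lemma exists_cofanPart_apply_eq {J : Type u} {X : J → ModuleCat.{u} R} {c : Cofan X}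
    (hc : IsColimit c) (x : c.pt) : ∃ S : Finset J, (cofanPart hc S).hom x = x := by
  classical
  have mono {S S' : Finset J} (h : S ⊆ S') {x : c.pt} (hx : (cofanPart hc S).hom x = x) :
      (cofanPart hc S').hom x = x := by
    have := congrArg (fun f => f.hom x) (cofanPart_comp_cofanPart hc h)
    simp only [ModuleCat.hom_comp, LinearMap.comp_apply, hx] at this
    exact this
  let N : Submodule R c.pt :=
    { carrier := {x | ∃ S : Finset J, (cofanPart hc S).hom x = x}
      zero_mem' := ⟨∅, map_zero _⟩
      add_mem' := by
        rintro x y ⟨S, hS⟩ ⟨S', hS'⟩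
        exact ⟨S ∪ S', by
          rw [map_add, mono Finset.subset_union_left hS, mono Finset.subset_union_right hS']⟩
      smul_mem' := by
        rintro a x ⟨S, hS⟩
        exact ⟨S, by rw [map_smul, hS]⟩ }
  have hN (j : J) (y : X j) : (c.inj j).hom y ∈ N :=
    ⟨{j}, congrArg (fun f => f.hom y) (inj_cofanPart_of_mem hc (Finset.mem_singleton_self j))⟩
  let d : c.pt ⟶ ModuleCat.of R N := Cofan.IsColimit.desc hc fun j =>
    ModuleCat.ofHom ((c.inj j).hom.codRestrict N (hN j))
  have hd : d ≫ ModuleCat.ofHom N.subtype = 𝟙 _ := by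
    refine Cofan.IsColimit.hom_ext hc _ _ fun j => ?_
    have hj : c.inj j ≫ d = ModuleCat.ofHom ((c.inj j).hom.codRestrict N (hN j)) :=
      Cofan.IsColimit.fac hc _ j
    rw [reassoc_of% hj]
    rfl
  have hx : (d.hom x : c.pt) = x := congrArg (fun f => f.hom x) hd
  exact hx ▸ (d.hom x).2

lemma preservesCoproducts_eval (k : ℤ) :
    PreservesCoproducts.{u} (eval (ModuleCat.{u} R) (ComplexShape.up ℤ) k) :=
  preservesCoproducts_of_preservesColimits _

lemma isCompactObj_single_ring (k : ℤ) : IsCompactObj.{u}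
    ((single (ModuleCat.{u} R) (ComplexShape.up ℤ) k).obj (ModuleCat.of R R)) := by
  intro J X c hc f
  obtain ⟨g, hg, rfl⟩ := fromSingle_surjective f
  obtain ⟨hc'⟩ := preservesCoproducts_eval k hc
  obtain ⟨S, hS⟩ := exists_cofanPart_apply_eq hc' (g.hom 1)
  refine ⟨S, ?_⟩
  rw [fromSingle_comp]
  congr 1
  have := map_cofanPart (eval (ModuleCat.{u} R) (ComplexShape.up ℤ) k) hc hc' S
  change (cofanPart hc S).f k = _ at this
  rw [this]
  apply ModuleCat.hom_ext
  apply LinearMap.ext_ring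
  exact hS

instance projective_of_self : Projective (ModuleCat.of R R) :=
  ((IsProjective.iff_projective (R := R) (ModuleCat.of R R))).1 inferInstance

variable [HasDerivedCategory.{w} (ModuleCat.{u} R)]

variable (R) in
/-- The ring, viewed as an object of the derived category of its modules. -/
abbrev ringObj : DerivedCategory (ModuleCat.{u} R) :=
  Q.obj ((single (ModuleCat.{u} R) (ComplexShape.up ℤ) 0).obj (ModuleCat.of R R))

/-- A complex without morphisms from the shifts of the ring is exact, since a cocycle in degree `k`
is a morphism from the ring placed in degree `k`, and is zero if and only if it is a coboundary. -/
lemma isZero_Q_of_forall {Y : CochainComplex (ModuleCat.{u} R) ℤ}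
    (h : ∀ (k : ℤ) (f : Q.obj ((single (ModuleCat.{u} R) (ComplexShape.up ℤ) k).obj
      (ModuleCat.of R R)) ⟶ Q.obj Y), f = 0) : IsZero (Q.obj Y) := by
  have hY (k : ℤ) : Y.ExactAt k := by
    rw [exactAt_iff' Y (k - 1) k (k + 1) (by simp) (by simp), ShortComplex.moduleCat_exact_iff]
    intro x hx
    let g : ModuleCat.of R R ⟶ Y.X k := ModuleCat.ofHom (LinearMap.toSpanSingleton R (Y.X k) x)
    have hg : g ≫ Y.d k (k + 1) = 0 := by
      apply ModuleCat.hom_ext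
      apply LinearMap.ext_ring
      change (Y.d k (k + 1)).hom ((1 : R) • x) = 0
      rw [one_smul]
      exact hx
    obtain ⟨y, hy⟩ := (Q_map_fromSingle_eq_zero_iff g hg).1 (h k _)
    refine ⟨y.hom 1, ?_⟩
    have := congrArg (fun f => f.hom 1) hy
    exact this.trans (one_smul R x)
  let Z : CochainComplex (ModuleCat.{u} R) ℤ := HomologicalComplex.zero
  have hZ : IsZero Z := HomologicalComplex.isZero_zero
  have : QuasiIso (0 : Y ⟶ Z) := ⟨fun k => by
    rw [quasiIsoAt_iff_exactAt _ _ (hY k)]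
    exact ExactAt.of_isZero ((eval (ModuleCat.{u} R) _ k).map_isZero hZ)⟩
  exact IsZero.of_iso (Q.map_isZero hZ) (asIso (Q.map (0 : Y ⟶ Z)))

variable (R) in
lemma isWeakGenerator_ringObj : IsWeakGenerator (ringObj R) := by
  intro X hX
  obtain ⟨Y, ⟨e⟩⟩ := Q_obj_surjective X
  refine IsZero.of_iso (isZero_Q_of_forall fun k f => ?_) e.symm
  let e' := shiftSingleIso (ModuleCat.of R R) (-k)
  rw [neg_neg] at e'
  rw [← cancel_epi e'.hom, ← cancel_mono e.hom, comp_zero, zero_comp]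
  exact hX _ _

/-- A morphism of the derived category is an isomorphism if it induces bijections on the morphisms
from the ring in all degrees. -/
lemma isIso_of_bijective_comp {X Y : DerivedCategory (ModuleCat.{u} R)} (f : X ⟶ Y)
    (h : ∀ k : ℤ, Function.Bijective fun g : Q.obj ((single (ModuleCat.{u} R) (ComplexShape.up ℤ)
      k).obj (ModuleCat.of R R)) ⟶ X => g ≫ f) : IsIso f := by
  refine (isWeakGenerator_ringObj R).isIso f fun n => ?_
  let e := shiftSingleIso (ModuleCat.of R R) n
  refine ⟨fun g g' hg => ?_, fun g => ?_⟩
  · rw [← cancel_epi e.inv]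
    apply (h (-n)).1
    dsimp only at hg ⊢
    rw [Category.assoc, hg, Category.assoc]
  · obtain ⟨g', hg'⟩ := (h (-n)).2 (e.inv ≫ g)
    refine ⟨e.hom ≫ g', ?_⟩
    dsimp only at hg' ⊢
    rw [Category.assoc, hg', e.hom_inv_id_assoc]

/-- A coproduct of quasi-isomorphisms is a quasi-isomorphism. -/
lemma isIso_Q_map_of_cofan {J : Type u} {X X' : J → CochainComplex (ModuleCat.{u} R) ℤ}
    {c : Cofan X} {c' : Cofan X'} (hc : IsColimit c) (hc' : IsColimit c') (s : ∀ j, X' j ⟶ X j)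
    (hs : ∀ j, IsIso (Q.map (s j))) (t : c'.pt ⟶ c.pt)
    (ht : ∀ j, c'.inj j ≫ t = s j ≫ c.inj j) : IsIso (Q.map t) := by
  have hπ (j : J) : t ≫ cofanProj hc j = cofanProj hc' j ≫ s j :=
    Cofan.IsColimit.hom_ext hc' _ _ fun i => by
      rw [reassoc_of% ht i]
      by_cases hij : i = j
      · subst hij
        rw [inj_cofanProj_self, reassoc_of% inj_cofanProj_self hc', Category.comp_id]
      · rw [inj_cofanProj_of_ne _ hij, reassoc_of% inj_cofanProj_of_ne hc' hij, comp_zero,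
          zero_comp]
  refine isIso_of_bijective_comp _ fun k => ⟨fun f f' hf => ?_, fun f => ?_⟩
  · rw [← sub_eq_zero]
    have hf' : (f - f') ≫ Q.map t = 0 := by
      rw [Preadditive.sub_comp]
      exact sub_eq_zero.2 hf
    generalize f - f' = f at hf'
    have := isKProjective_single k (ModuleCat.of R R)
    obtain ⟨φ, rfl⟩ := exists_Q_map_eq _ _ f
    obtain ⟨S, hS⟩ := isCompactObj_single_ring k hc' φ
    rw [← hS, cofanPart, Preadditive.comp_sum, Q.map_sum]
    refine Finset.sum_eq_zero fun j _ => ?_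
    have : Q.map (φ ≫ cofanProj hc' j) = 0 := by
      rw [← cancel_mono (Q.map (s j)), ← Q.map_comp, Category.assoc, ← hπ, ← Category.assoc,
        Q.map_comp, Q.map_comp, hf', zero_comp, zero_comp]
    rw [← Category.assoc, Q.map_comp, this, zero_comp]
  · have := isKProjective_single k (ModuleCat.of R R)
    obtain ⟨φ, rfl⟩ := exists_Q_map_eq _ _ f
    obtain ⟨S, hS⟩ := isCompactObj_single_ring k hc φ
    refine ⟨∑ j ∈ S, (Q.map (φ ≫ cofanProj hc j) ≫ inv (Q.map (s j))) ≫ Q.map (c'.inj j), ?_⟩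
    dsimp only
    conv_rhs => rw [← hS, cofanPart, Preadditive.comp_sum, Q.map_sum]
    rw [Preadditive.sum_comp]
    refine Finset.sum_congr rfl fun j _ => ?_
    rw [Category.assoc, ← Q.map_comp, ht, Q.map_comp (s j), Category.assoc,
      IsIso.inv_hom_id_assoc, ← Q.map_comp, Category.assoc]

/-- A morphism which is zero in the derived category is null-homotopic after composition with a
quasi-isomorphism. -/
lemma exists_quasiIso_homotopy {X Y : CochainComplex (ModuleCat.{u} R) ℤ} {a : X ⟶ Y}
    (ha : Q.map a = 0) : ∃ (X' : CochainComplex (ModuleCat.{u} R) ℤ) (t : X' ⟶ X),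
      IsIso (Q.map t) ∧ Nonempty (Homotopy (t ≫ a) 0) := by
  have h : Qh.map ((HomotopyCategory.quotient _ (ComplexShape.up ℤ)).map a) = Qh.map 0 := by
    rw [← cancel_mono ((quotientCompQhIso _).hom.app Y), quotientCompQhIso_hom_naturality, ha,
      Functor.map_zero, comp_zero, zero_comp]
  obtain ⟨X', t, ht, h⟩ := (MorphismProperty.map_eq_iff_precomp Qh
    (HomotopyCategory.quasiIso (ModuleCat.{u} R) (ComplexShape.up ℤ)) _ _).1 h
  obtain ⟨X', rfl⟩ := HomotopyCategory.quotient_obj_surjective X'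
  obtain ⟨t, rfl⟩ := (HomotopyCategory.quotient _ _).map_surjective t
  rw [← isIso_Qh_map_iff] at ht
  refine ⟨X', t, ht, ⟨HomotopyCategory.homotopyOfEq _ _ ?_⟩⟩
  rw [Functor.map_comp, h, comp_zero, Functor.map_zero]

lemma isZero_Q_mappingCone_id (X : CochainComplex (ModuleCat.{u} R) ℤ) :
    IsZero (Q.obj (CochainComplex.mappingCone (𝟙 X))) :=
  isZero_of_distTriang_isIso₁ (mappingCone_triangle_distinguished (𝟙 X))
    (inferInstanceAs (IsIso (Q.map (𝟙 X))))

/-- A null-homotopic morphism factors through a contractible complex. -/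
lemma exists_factor_of_homotopy {X Y : CochainComplex (ModuleCat.{u} R) ℤ} {a : X ⟶ Y}
    (h : Homotopy a 0) : ∃ b : CochainComplex.mappingCone (𝟙 X) ⟶ Y,
      CochainComplex.mappingCone.inr (𝟙 X) ≫ b = a :=
  ⟨CochainComplex.mappingCone.desc (𝟙 X) (CochainComplex.HomComplex.Cochain.ofHomotopy h) a
    (by simp), by simp⟩

lemma isZero_Q_cofan {J : Type u} {X : J → CochainComplex (ModuleCat.{u} R) ℤ}
    {c : Cofan X} (hc : IsColimit c) (h : ∀ j, IsZero (Q.obj (X j))) : IsZero (Q.obj c.pt) := by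
  have : IsIso (Q.map (0 : c.pt ⟶ c.pt)) := isIso_Q_map_of_cofan hc hc (fun j => 0)
    (fun j => ⟨0, (h j).eq_of_src _ _, (h j).eq_of_src _ _⟩) 0 (by simp)
  rw [IsZero.iff_id_eq_zero, ← cancel_epi (Q.map (0 : c.pt ⟶ c.pt)), Functor.map_zero,
    zero_comp, zero_comp]

variable (R) in
/-- The localization functor from complexes of modules to the derived category preserves
coproducts: morphisms are described by fractions, and coproducts of quasi-isomorphisms are
quasi-isomorphisms. -/
lemma preservesCoproducts_Q :
    PreservesCoproducts.{u} (Q : CochainComplex (ModuleCat.{u} R) ℤ ⥤ _) := by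
  intro J X c hc
  have fac (Y : CochainComplex (ModuleCat.{u} R) ℤ) (f : ∀ j, Q.obj (X j) ⟶ Q.obj Y) :
      ∃ g : Q.obj c.pt ⟶ Q.obj Y, ∀ j, Q.map (c.inj j) ≫ g = f j := by
    choose X' s hs g hg using fun j => right_fac (f j)
    let c' : Cofan X' := Cofan.mk _ (Sigma.ι _)
    have hc' : IsColimit c' := coproductIsCoproduct _
    let t : c'.pt ⟶ c.pt := Cofan.IsColimit.desc hc' fun j => s j ≫ c.inj j
    let g' : c'.pt ⟶ Y := Cofan.IsColimit.desc hc' g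
    have ht (j : J) : c'.inj j ≫ t = s j ≫ c.inj j := Cofan.IsColimit.fac hc' _ j
    have hg' (j : J) : c'.inj j ≫ g' = g j := Cofan.IsColimit.fac hc' _ j
    have := isIso_Q_map_of_cofan hc hc' s hs t ht
    refine ⟨inv (Q.map t) ≫ Q.map g', fun j => ?_⟩
    have := hs j
    rw [hg j, ← cancel_epi (Q.map (s j)), ← Q.map_comp_assoc, ← ht, Q.map_comp_assoc,
      IsIso.hom_inv_id_assoc, IsIso.hom_inv_id_assoc, ← Q.map_comp, hg']
  have inj (Y : DerivedCategory (ModuleCat.{u} R)) (f : Q.obj c.pt ⟶ Y)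
      (hf : ∀ j, Q.map (c.inj j) ≫ f = 0) : f = 0 := by
    obtain ⟨Y, ⟨e⟩⟩ := Q_obj_surjective Y
    obtain ⟨Y', g, s, hs, h⟩ := left_fac (f ≫ e.inv)
    have hg (j : J) : Q.map (c.inj j ≫ g) = 0 := by
      rw [← cancel_mono (inv (Q.map s)), Q.map_comp, Category.assoc, ← h, reassoc_of% hf j,
        zero_comp, zero_comp]
    -- the vanishing of each `Q.map (c.inj j ≫ g)` is witnessed by a factorization, after a
    -- quasi-isomorphism, through a contractible complex; these data are compatible with coproducts
    choose X' t ht H using fun j => exists_quasiIso_homotopy (hg j)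
    choose b hb using fun j => exists_factor_of_homotopy (H j).some
    let c' : Cofan X' := Cofan.mk _ (Sigma.ι _)
    have hc' : IsColimit c' := coproductIsCoproduct _
    let d : Cofan fun j => CochainComplex.mappingCone (𝟙 (X' j)) := Cofan.mk _ (Sigma.ι _)
    have hd : IsColimit d := coproductIsCoproduct _
    let T : c'.pt ⟶ c.pt := Cofan.IsColimit.desc hc' fun j => t j ≫ c.inj j
    have hT (j : J) : c'.inj j ≫ T = t j ≫ c.inj j := Cofan.IsColimit.fac hc' _ j
    let x : c'.pt ⟶ d.pt := Cofan.IsColimit.desc hc' fun j =>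
      CochainComplex.mappingCone.inr (𝟙 (X' j)) ≫ d.inj j
    have hx (j : J) : c'.inj j ≫ x = CochainComplex.mappingCone.inr (𝟙 (X' j)) ≫ d.inj j :=
      Cofan.IsColimit.fac hc' _ j
    let y : d.pt ⟶ Y' := Cofan.IsColimit.desc hd b
    have hy (j : J) : d.inj j ≫ y = b j := Cofan.IsColimit.fac hd _ j
    have hxy : T ≫ g = x ≫ y := Cofan.IsColimit.hom_ext hc' _ _ fun j => by
      rw [reassoc_of% hT j, reassoc_of% hx j, hy, hb]
    have := isIso_Q_map_of_cofan hc hc' t ht T hT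
    have hg0 : Q.map g = 0 := by
      rw [← cancel_epi (Q.map T), ← Q.map_comp, hxy, Q.map_comp, comp_zero,
        (isZero_Q_cofan hd fun j => isZero_Q_mappingCone_id _).eq_of_tgt (Q.map x) 0, zero_comp]
    rw [← cancel_mono e.inv, h, hg0, zero_comp, zero_comp]
  have fac' (Y : DerivedCategory (ModuleCat.{u} R)) (f : ∀ j, Q.obj (X j) ⟶ Y) :
      ∃ g : Q.obj c.pt ⟶ Y, ∀ j, Q.map (c.inj j) ≫ g = f j := by
    obtain ⟨Y, ⟨e⟩⟩ := Q_obj_surjective Y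
    obtain ⟨g, hg⟩ := fac Y fun j => f j ≫ e.inv
    exact ⟨g ≫ e.hom, fun j => by rw [reassoc_of% hg j, e.inv_hom_id, Category.comp_id]⟩
  choose g hg using fac'
  exact ⟨Cofan.IsColimit.mk _ (fun s => g s.pt s.inj) (fun s j => hg _ _ j) fun s m hm => by
    rw [← sub_eq_zero]
    refine inj _ _ fun j => ?_
    rw [Preadditive.comp_sub, hg, sub_eq_zero]
    exact hm j⟩

/-- Every family of objects of the derived category has a coproduct that is the image of a coproduct
of complexes. -/
lemma exists_cofan {J : Type u} (X : J → DerivedCategory (ModuleCat.{u} R)) :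
    ∃ (Y : J → CochainComplex (ModuleCat.{u} R) ℤ) (e : ∀ j, Q.obj (Y j) ≅ X j) (d : Cofan Y)
      (_ : IsColimit d),
      Nonempty (IsColimit (Cofan.mk (Q.obj d.pt) fun j => (e j).inv ≫ Q.map (d.inj j))) := by
  choose Y e using fun j => Q_obj_surjective (X j)
  let d : Cofan Y := Cofan.mk _ (Sigma.ι _)
  have hd : IsColimit d := coproductIsCoproduct _
  obtain ⟨h⟩ := preservesCoproducts_Q R hd
  refine ⟨Y, fun j => (e j).some, d, hd, ⟨Cofan.IsColimit.mk _
    (fun s => Cofan.IsColimit.desc h fun j => (e j).some.hom ≫ s.inj j) (fun s j => ?_)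
    fun s m hm => Cofan.IsColimit.hom_ext h _ _ fun j => ?_⟩⟩
  · have : Q.map (d.inj j) ≫ Cofan.IsColimit.desc h (fun j => (e j).some.hom ≫ s.inj j) =
      (e j).some.hom ≫ s.inj j := Cofan.IsColimit.fac h _ j
    change ((e j).some.inv ≫ Q.map (d.inj j)) ≫ _ = _
    rw [Category.assoc, this, Iso.inv_hom_id_assoc]
  · refine Eq.trans ?_ (Cofan.IsColimit.fac h _ j).symm
    have := hm j
    change ((e j).some.inv ≫ Q.map (d.inj j)) ≫ m = _ at this
    rw [← this, Category.assoc, Iso.hom_inv_id_assoc]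
    rfl

instance hasCoproducts_derivedCategory (J : Type u) :
    HasCoproductsOfShape J (DerivedCategory (ModuleCat.{u} R)) where
  has_colimit F := by
    obtain ⟨Y, e, d, hd, ⟨h⟩⟩ := exists_cofan fun j => F.obj ⟨j⟩
    have : HasColimit (Discrete.functor (F.obj ∘ Discrete.mk)) := ⟨⟨⟨_, h⟩⟩⟩
    exact hasColimit_of_iso Discrete.natIsoFunctor

variable (R) in
/-- The ring is compact in the derived category, since it is compact as a complex and all morphisms
from it are represented by morphisms of complexes. -/
lemma isCompactObj_ringObj : IsCompactObj.{u} (ringObj R) := by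
  refine isCompactObj_of_exists fun J X => ?_
  obtain ⟨Y, e, d, hd, ⟨h⟩⟩ := exists_cofan X
  refine ⟨_, h, fun f => ?_⟩
  have := isKProjective_single 0 (ModuleCat.of R R)
  obtain ⟨f, rfl⟩ := exists_Q_map_eq _ _ f
  obtain ⟨S, hS⟩ := isCompactObj_single_ring 0 hd f
  refine ⟨S, ?_⟩
  have hπ (j : J) : cofanProj h j = Q.map (cofanProj hd j) ≫ (e j).hom := by
    refine Cofan.IsColimit.hom_ext h _ _ fun i => ?_
    change _ = ((e i).inv ≫ Q.map (d.inj i)) ≫ _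
    rw [Category.assoc, ← Q.map_comp_assoc]
    by_cases hij : i = j
    · subst hij
      rw [inj_cofanProj_self, inj_cofanProj_self, CategoryTheory.Functor.map_id, Category.id_comp,
        Iso.inv_hom_id]
    · rw [inj_cofanProj_of_ne _ hij, inj_cofanProj_of_ne _ hij, Functor.map_zero, zero_comp,
        comp_zero]
  have : cofanPart h S = Q.map (cofanPart hd S) := by
    simp only [cofanPart, Q.map_sum, hπ]
    refine Finset.sum_congr rfl fun j _ => ?_
    change (Q.map (cofanProj hd j) ≫ (e j).hom) ≫ (e j).inv ≫ Q.map (d.inj j) = _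
    rw [Category.assoc, Iso.hom_inv_id_assoc, Q.map_comp]
  conv_rhs => rw [← hS, Q.map_comp]
  rw [this]

lemma small_hom_shift_ringObj (n : ℤ) (X : DerivedCategory (ModuleCat.{u} R)) :
    Small.{u} ((ringObj R)⟦n⟧ ⟶ X) := by
  obtain ⟨Y, ⟨e⟩⟩ := Q_obj_surjective X
  let e' := shiftSingleIso (ModuleCat.of R R) n
  let f (g : {g : ModuleCat.of R R ⟶ Y.X (-n) // g ≫ Y.d (-n) (-n + 1) = 0}) :
      (ringObj R)⟦n⟧ ⟶ X := e'.hom ≫ Q.map (fromSingle (-n) g.1 g.2) ≫ e.hom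
  refine small_of_surjective (f := f) fun k => ?_
  obtain ⟨g, hg, h⟩ := exists_Q_map_fromSingle (e'.inv ≫ k ≫ e.inv)
  refine ⟨⟨g, hg⟩, ?_⟩
  simp only [f, h, Category.assoc, Iso.hom_inv_id_assoc, Iso.inv_hom_id, Category.comp_id]

lemma small_hom_derivedCategory (X Y : DerivedCategory (ModuleCat.{u} R)) :
    Small.{u} (X ⟶ Y) :=
  small_hom_of_isWeakGenerator (isCompactObj_ringObj R) (isWeakGenerator_ringObj R)
    small_hom_shift_ringObj X Y

end ModuleCat

/-! ### Adjunctions between derived categories -/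

section DerivedAdjunction

open DerivedCategory HomologicalComplex

variable {C D : Type*} [Category* C] [Category* D] [Abelian C] [Abelian D] {F : C ⥤ D} {G : D ⥤ C}
  [F.Additive] [G.Additive]

/-- The adjunction between categories of complexes induced by an adjunction. -/
def mapComplexAdjunction (adj : F ⊣ G) :
    F.mapHomologicalComplex (ComplexShape.up ℤ) ⊣ G.mapHomologicalComplex (ComplexShape.up ℤ) :=
  Adjunction.mkOfUnitCounit
    { unit :=
        { app := fun K =>
            { f := fun i => adj.unit.app (K.X i)
              comm' := fun i j _ => (adj.unit.naturality (K.d i j)).symm }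
          naturality := fun K L f => by
            ext i
            exact adj.unit.naturality (f.f i) }
      counit :=
        { app := fun K =>
            { f := fun i => adj.counit.app (K.X i)
              comm' := fun i j _ => (adj.counit.naturality (K.d i j)).symm }
          naturality := fun K L f => by
            ext i
            exact adj.counit.naturality (f.f i) }
      left_triangle := by
        ext K i
        simp only [NatTrans.comp_app, comp_f]
        refine (congrArg (_ ≫ ·) (Category.id_comp _)).trans ?_
        exact adj.left_triangle_components (K.X i)
      right_triangle := by
        ext K i
        simp only [NatTrans.comp_app, comp_f]
        refine (congrArg (_ ≫ ·) (Category.id_comp _)).trans ?_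
        exact adj.right_triangle_components (K.X i) }

lemma mapComplexAdjunction_counit_app_f (adj : F ⊣ G) (K : CochainComplex D ℤ) (i : ℤ) :
    ((mapComplexAdjunction adj).counit.app K).f i = adj.counit.app (K.X i) := rfl

variable [HasDerivedCategory.{w} C] [HasDerivedCategory.{w} D]
  [PreservesFiniteLimits F] [PreservesFiniteColimits F]
  [PreservesFiniteLimits G] [PreservesFiniteColimits G]

/-- The adjunction between derived categories induced by an adjunction between exact functors. -/
def mapDerivedCategoryAdjunction (adj : F ⊣ G) : F.mapDerivedCategory ⊣ G.mapDerivedCategory :=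
  let : CatCommSq (F.mapHomologicalComplex (ComplexShape.up ℤ)) Q Q F.mapDerivedCategory :=
    ⟨F.mapDerivedCategoryFactors.symm⟩
  let : CatCommSq (G.mapHomologicalComplex (ComplexShape.up ℤ)) Q Q G.mapDerivedCategory :=
    ⟨G.mapDerivedCategoryFactors.symm⟩
  (mapComplexAdjunction adj).localization Q (quasiIso C (ComplexShape.up ℤ)) Q
    (quasiIso D (ComplexShape.up ℤ)) F.mapDerivedCategory G.mapDerivedCategory

/-- An exact fully faithful functor with an exact left adjoint is fully faithful on derived
categories: the counit is computed degreewise. -/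
lemma fullyFaithful_mapDerivedCategory (adj : F ⊣ G) [G.Full] [G.Faithful] :
    G.mapDerivedCategory.Full ∧ G.mapDerivedCategory.Faithful := by
  have : IsIso (mapDerivedCategoryAdjunction adj).counit := by
    rw [NatTrans.isIso_iff_isIso_app]
    intro X
    obtain ⟨Y, ⟨e⟩⟩ := Q_obj_surjective X
    rw [← NatTrans.isIso_app_iff_of_iso _ e]
    let : CatCommSq (F.mapHomologicalComplex (ComplexShape.up ℤ)) Q Q F.mapDerivedCategory :=
      ⟨F.mapDerivedCategoryFactors.symm⟩
    let : CatCommSq (G.mapHomologicalComplex (ComplexShape.up ℤ)) Q Q G.mapDerivedCategory :=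
      ⟨G.mapDerivedCategoryFactors.symm⟩
    have h := (mapComplexAdjunction adj).localization_counit_app Q
      (quasiIso C (ComplexShape.up ℤ)) Q (quasiIso D (ComplexShape.up ℤ)) F.mapDerivedCategory
      G.mapDerivedCategory Y
    have : IsIso ((mapComplexAdjunction adj).counit.app Y) := by
      have (i : ℤ) : IsIso (((mapComplexAdjunction adj).counit.app Y).f i) := by
        rw [mapComplexAdjunction_counit_app_f]
        exact inferInstanceAs (IsIso (adj.counit.app (Y.X i)))
      exact Hom.isIso_of_components _
    change IsIso (Adjunction.counit (Adjunction.localization _ _ _ _ _ _ _) |>.app (Q.obj Y))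
    rw [h]
    infer_instance
  have h := (mapDerivedCategoryAdjunction adj).fullyFaithfulROfIsIsoCounit
  exact ⟨h.full, h.faithful⟩

end DerivedAdjunction

/-! ### Compact modules and projective dimension -/

section CompactModule

open DerivedCategory HomologicalComplex

variable {R : Type u} [Ring R]

lemma exists_dual_basis (M : ModuleCat.{u} R) [Module.Finite R M] [Module.Projective R M] :
    ∃ (n : ℕ) (p : Fin n → (M ⟶ ModuleCat.of R R)) (i : Fin n → (ModuleCat.of R R ⟶ M)),
      ∑ b, p b ≫ i b = 𝟙 M := by
  obtain ⟨n, f, hf⟩ := Module.Finite.exists_fin' R M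
  obtain ⟨s, hs⟩ := Module.projective_lifting_property f LinearMap.id hf
  refine ⟨n, fun b => ModuleCat.ofHom (LinearMap.proj b ∘ₗ s),
    fun b => ModuleCat.ofHom (f ∘ₗ LinearMap.single R (fun _ => R) b), ?_⟩
  ext x
  rw [ModuleCat.hom_sum]
  simp only [LinearMap.sum_apply, ModuleCat.hom_comp, ModuleCat.hom_ofHom, LinearMap.comp_apply]
  rw [← map_sum]
  have h : f (s x) = x := LinearMap.congr_fun hs x
  refine Eq.trans (congrArg f ?_) h
  exact LinearMap.sum_single_apply _ _

/-- The beginning of a resolution by finitely generated projective modules: syzygies. -/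
lemma HasFGProjectiveResolution.exists_syzygies {M : ModuleCat.{u} R}
    (h : HasFGProjectiveResolution M) :
    ∃ S : ℕ → ShortComplex (ModuleCat.{u} R), (∀ n, (S n).ShortExact) ∧ (S 0).X₃ = M ∧
      (∀ n, (S (n + 1)).X₃ = (S n).X₁) ∧ (∀ n, Module.Finite R (S n).X₂) ∧
      ∀ n, Projective (S n).X₂ := by
  obtain ⟨P, hP⟩ := h
  let Z (n : ℕ) : ModuleCat.{u} R :=
    ModuleCat.of R (LinearMap.range (P.complex.d (n + 1) n).hom)
  have hd (n : ℕ) (x : P.complex.X (n + 2)) :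
      (P.complex.d (n + 1) n).hom ((P.complex.d (n + 2) (n + 1)).hom x) = 0 :=
    congrArg (fun f => f.hom x) (P.complex.d_comp_d (n + 2) (n + 1) n)
  have hπ : P.complex.d 1 0 ≫ P.π.f 0 = 0 := P.complex_d_comp_π_f_zero
  let S₀ : ShortComplex (ModuleCat.{u} R) :=
    { X₁ := Z 0
      X₂ := P.complex.X 0
      X₃ := M
      f := ModuleCat.ofHom (Submodule.subtype _)
      g := P.π.f 0
      zero := by
        ext ⟨_, x, rfl⟩
        exact congrArg (fun f => f.hom x) hπ }
  let S₁ (n : ℕ) : ShortComplex (ModuleCat.{u} R) :=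
    { X₁ := Z (n + 1)
      X₂ := P.complex.X (n + 1)
      X₃ := Z n
      f := ModuleCat.ofHom (Submodule.subtype _)
      g := ModuleCat.ofHom (LinearMap.rangeRestrict _)
      zero := by
        ext ⟨_, x, rfl⟩
        exact hd n x }
  refine ⟨fun n => Nat.casesOn n S₀ S₁, ?_, rfl, ?_, ?_, ?_⟩
  · rintro (_ | n)
    · have hm : Mono S₀.f := (ModuleCat.mono_iff_injective _).2 Subtype.val_injective
      have he : Epi S₀.g := inferInstanceAs (Epi (P.π.f 0))
      refine { exact := ?_ }
      have h0 : (ShortComplex.mk _ _ hπ).Exact :=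
        ShortComplex.exact_of_g_is_cokernel _ P.isColimitCokernelCofork
      rw [ShortComplex.moduleCat_exact_iff] at h0 ⊢
      intro x hx
      obtain ⟨y, hy⟩ := h0 x hx
      exact ⟨⟨x, y, hy⟩, rfl⟩
    · have hm : Mono (S₁ n).f := (ModuleCat.mono_iff_injective _).2 Subtype.val_injective
      have he : Epi (S₁ n).g :=
        (ModuleCat.epi_iff_surjective _).2 (LinearMap.surjective_rangeRestrict _)
      refine { exact := ?_ }
      have h0 := P.exact_succ n
      rw [ShortComplex.moduleCat_exact_iff] at h0 ⊢
      intro x hx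
      obtain ⟨y, hy⟩ := h0 x (congrArg Subtype.val hx)
      exact ⟨⟨x, y, hy⟩, rfl⟩
  · rintro (_ | n) <;> rfl
  · rintro (_ | n)
    · exact hP 0
    · exact hP (n + 1)
  · rintro (_ | n)
    · exact P.projective 0
    · exact P.projective (n + 1)

variable [HasDerivedCategory.{w} (ModuleCat.{u} R)]

/-- A module is called compact if it is a compact object of the derived category. -/
def IsCompactModule (M : ModuleCat.{u} R) : Prop :=
  IsCompactObj.{u} ((singleFunctor (ModuleCat.{u} R) 0).obj M)

variable (R) in
lemma isCompactModule_self : IsCompactModule (ModuleCat.of R R) :=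
  isCompactObj_ringObj R

lemma IsCompactModule.of_sum {M : ModuleCat.{u} R} {B : Type*} [Fintype B]
    (N : B → ModuleCat.{u} R) (hN : ∀ b, IsCompactModule (N b)) (p : ∀ b, M ⟶ N b)
    (i : ∀ b, N b ⟶ M) (h : ∑ b, p b ≫ i b = 𝟙 M) : IsCompactModule M := by
  refine IsCompactObj.of_sum (fun b => (singleFunctor (ModuleCat.{u} R) 0).obj (N b)) hN
    (fun b => (singleFunctor _ 0).map (p b)) (fun b => (singleFunctor _ 0).map (i b)) ?_
  simp only [← Functor.map_comp, ← Functor.map_sum, h, CategoryTheory.Functor.map_id]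

lemma isCompactModule_of_projective (M : ModuleCat.{u} R) [Module.Finite R M]
    [Module.Projective R M] : IsCompactModule M := by
  obtain ⟨n, p, i, h⟩ := exists_dual_basis M
  exact IsCompactModule.of_sum _ (fun _ => isCompactModule_self R) p i h

lemma IsCompactModule.of_shortExact {S : ShortComplex (ModuleCat.{u} R)} (hS : S.ShortExact)
    (h₁ : IsCompactModule S.X₁) (h₂ : IsCompactModule S.X₂) : IsCompactModule S.X₃ :=
  IsCompactObj.cone hS.singleTriangle_distinguished h₁ h₂

/-- A module of finite projective dimension with a resolution by finitely generated projective
modules is compact. -/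
lemma HasFGProjectiveResolution.isCompactModule {M : ModuleCat.{u} R}
    (h : HasFGProjectiveResolution M) (h' : HasFiniteProjectiveDimension M) :
    IsCompactModule M := by
  obtain ⟨S, hS, hM, hS₁, hS₂, hS₃⟩ := h.exists_syzygies
  obtain ⟨d, hd⟩ := h'
  have hc (n : ℕ) : IsCompactModule (S n).X₂ := by
    have := hS₂ n
    have : Module.Projective R (S n).X₂ := (IsProjective.iff_projective _).2 (hS₃ n)
    exact isCompactModule_of_projective _
  have key (d : ℕ) : ∀ n, HasProjectiveDimensionLE (S n).X₃ d → IsCompactModule (S n).X₃ := by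
    induction d with
    | zero =>
      intro n hn
      have hp : Projective (S n).X₃ := (projective_iff_hasProjectiveDimensionLE_zero _).2 hn
      have : Module.Projective R (S n).X₃ := (IsProjective.iff_projective _).2 hp
      have := hS₂ n
      have : Module.Finite R (S n).X₃ :=
        Module.Finite.of_surjective (S n).g.hom ((ModuleCat.epi_iff_surjective _).1 (hS n).epi_g)
      exact isCompactModule_of_projective _
    | succ d ih =>
      intro n hn
      refine .of_shortExact (hS n) ?_ (hc n)
      have := hS₃ n
      have h1 : HasProjectiveDimensionLE (S n).X₁ d :=
        ((hS n).hasProjectiveDimensionLT_X₃_iff d (hS₃ n)).1 hn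
      rw [← hS₁ n] at h1 ⊢
      exact ih _ h1
  rw [← hM] at hd ⊢
  exact key d 0 hd

/-- The coproduct of objects `Y i`, placed in degree `i`, is the complex with these terms and zero
differential. -/
lemma isColimit_cofan_single (Y : ℤ → ModuleCat.{u} R) (W : CochainComplex (ModuleCat.{u} R) ℤ)
    (e : ∀ i, Y i ≅ W.X i) (hW : ∀ i j, W.d i j = 0) :
    Nonempty (IsColimit (Cofan.mk W fun j : ULift.{u} ℤ =>
      fromSingle j.down (e j.down).hom (by rw [hW, comp_zero]))) := by
  refine ⟨Cofan.IsColimit.mk _ (fun s =>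
    { f := fun i => (e i).inv ≫ (singleObjXSelf (ComplexShape.up ℤ) i (Y i)).inv ≫
        (s.inj ⟨i⟩).f i
      comm' := fun i j _ => ?_ }) (fun s j => ?_) fun s m hm => ?_⟩
  · rw [Category.assoc, Category.assoc, (s.inj ⟨i⟩).comm, single_obj_d, zero_comp, comp_zero,
      comp_zero]
    exact ((congrArg (· ≫ _) (hW i j)).trans zero_comp).symm
  · apply from_single_hom_ext
    change (fromSingle j.down (e j.down).hom (by rw [hW, comp_zero])).f j.down ≫ _ = _
    rw [fromSingle, mkHomFromSingle_f]
    simp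
  · ext1 i
    change _ = (e i).inv ≫ (singleObjXSelf (ComplexShape.up ℤ) i (Y i)).inv ≫ (s.inj ⟨i⟩).f i
    rw [← hm ⟨i⟩]
    change _ = (e i).inv ≫ (singleObjXSelf (ComplexShape.up ℤ) i (Y i)).inv ≫
      (fromSingle i (e i).hom (by rw [hW, comp_zero])).f i ≫ m.f i
    rw [fromSingle, mkHomFromSingle_f]
    simp

/-- A compact module has finite projective dimension. Otherwise there are nonzero classes in
`Ext^n (M, Y n)` for infinitely many `n`. These are the components of a morphism from `M` to the
coproduct of the objects `Y n`, placed in degree `-n`, which does not factor through finitely many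
summands. -/
lemma IsCompactModule.hasFiniteProjectiveDimension {M : ModuleCat.{u} R} (h : IsCompactModule M) :
    HasFiniteProjectiveDimension M := by
  by_contra hd
  let P := projectiveResolution M
  let K := P.cochainComplex
  have exists_class (i : ℤ) : ∃ (Y : ModuleCat.{u} R) (f : K.X i ⟶ Y), K.d (i - 1) i ≫ f = 0 ∧
      (i < 0 → ∀ g : K.X (i + 1) ⟶ Y, K.d i (i + 1) ≫ g ≠ f) := by
    by_cases hi : i < 0
    · obtain ⟨n, rfl⟩ : ∃ n : ℕ, i = -((n + 1 : ℕ) : ℤ) := ⟨(-i - 1).toNat, by lia⟩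
      have hn : ¬ HasProjectiveDimensionLE M n := fun hn => hd ⟨n, hn⟩
      obtain ⟨Y, hY⟩ : ∃ Y, ¬ Subsingleton (Abelian.Ext.{u} M Y (n + 1)) := by
        by_contra! H
        exact hn (hasProjectiveDimensionLT_of_enoughInjectives M (n + 1) H)
      obtain ⟨α, hα⟩ : ∃ α : Abelian.Ext.{u} M Y (n + 1), α ≠ 0 := by
        by_contra! H
        exact hY ⟨fun a b => by rw [H a, H b]⟩
      obtain ⟨f, hf, rfl⟩ := P.extMk_surjective α (n + 2) rfl
      refine ⟨Y, (P.cochainComplexXIso _ (n + 1) rfl).hom ≫ f, ?_, fun _ g hg => hα ?_⟩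
      · rw [P.cochainComplex_d (-((n + 1 : ℕ) : ℤ) - 1) _ (n + 2) (n + 1) (by lia) rfl]
        simp [hf]
      · rw [P.extMk_eq_zero_iff f (n + 2) rfl hf n rfl]
        refine ⟨(P.cochainComplexXIso (-((n + 1 : ℕ) : ℤ) + 1) n (by lia)).inv ≫ g, ?_⟩
        rw [← cancel_epi (P.cochainComplexXIso (-((n + 1 : ℕ) : ℤ)) (n + 1) rfl).hom, ← hg,
          P.cochainComplex_d _ _ (n + 1) n rfl (by lia)]
        simp
    · exact ⟨ModuleCat.of R PUnit, 0, comp_zero, fun h => absurd h hi⟩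
  choose Y f hf hf' using exists_class
  let W : CochainComplex (ModuleCat.{u} R) ℤ := { X := Y, d := fun _ _ => 0 }
  let φ : K ⟶ W :=
    { f := f
      comm' := fun i j hij => by
        obtain rfl : i = j - 1 := by
          have : i + 1 = j := hij
          lia
        rw [hf]
        exact comp_zero }
  obtain ⟨hc⟩ := isColimit_cofan_single Y W (fun i => Iso.refl _) fun _ _ => rfl
  obtain ⟨hQ⟩ := preservesCoproducts_Q R hc
  have : IsIso (Q.map P.π') := (isIso_Q_map_iff_quasiIso _ P.π').2 inferInstance
  obtain ⟨a, ha⟩ : ∃ a, Q.map P.π' ≫ a = 𝟙 _ := ⟨inv (Q.map P.π'), IsIso.hom_inv_id _⟩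
  have hK : IsCompactObj.{u} (Q.obj K) := h.of_retract (Q.map P.π') a ha
  obtain ⟨S, hS⟩ := hK hQ (Q.map φ)
  obtain ⟨i, hi : i < 0, hiS⟩ :=
    (Set.Iio_infinite (0 : ℤ)).exists_notMem_finset (S.image ULift.down)
  replace hiS : (⟨i⟩ : ULift.{u} ℤ) ∉ S := fun h =>
    hiS (Finset.mem_image_of_mem ULift.down h)
  have h0 : Q.map (φ ≫ cofanProj hc ⟨i⟩) = 0 := by
    have h1 : Q.map (cofanProj hc ⟨i⟩) = cofanProj hQ ⟨i⟩ := map_cofanProj Q hc hQ ⟨i⟩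
    have h2 : cofanPart hQ S ≫ cofanProj hQ ⟨i⟩ = 0 := by
      rw [cofanPart, Preadditive.sum_comp]
      refine Finset.sum_eq_zero fun j hj => ?_
      have hji : j ≠ ⟨i⟩ := fun h => hiS (h ▸ hj)
      rw [Category.assoc, inj_cofanProj_of_ne hQ hji, comp_zero]
    rw [Q.map_comp, h1, ← hS, Category.assoc, h2, comp_zero]
  have : K.IsKProjective := CochainComplex.isKProjective_of_projective _ 0
  obtain ⟨H⟩ := homotopy_of_Q_map_eq_zero h0
  let x := singleObjXSelf (ComplexShape.up ℤ) i (Y i)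
  have hx : (cofanProj hc ⟨i⟩).f i = x.inv := by
    have h1 := congrArg (fun g => g.f i) (inj_cofanProj_self hc ⟨i⟩)
    have hg : 𝟙 (Y i) ≫ W.d i (i + 1) = 0 := comp_zero
    change (fromSingle (Y := W) i (𝟙 (Y i)) hg).f i ≫ (cofanProj hc ⟨i⟩).f i = 𝟙 _ at h1
    rw [fromSingle, mkHomFromSingle_f] at h1
    rw [← cancel_epi x.hom, x.hom_inv_id]
    exact (congrArg (· ≫ (cofanProj hc ⟨i⟩).f i) (Category.comp_id x.hom).symm).trans h1
  have h1 := H.comm i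
  rw [dNext_eq H.hom (show (ComplexShape.up ℤ).Rel i (i + 1) from rfl),
    prevD_eq H.hom (show (ComplexShape.up ℤ).Rel (i - 1) i by simp), single_obj_d, comp_zero,
    add_zero, zero_f, add_zero, comp_f, hx] at h1
  refine hf' i hi (H.hom (i + 1) i ≫ x.hom) ?_
  rw [← Category.assoc, ← h1]
  change (f i ≫ x.inv) ≫ x.hom = f i
  rw [Category.assoc, x.inv_hom_id, Category.comp_id]

end CompactModule

/-! ### Recollements of compactly generated triangulated categories -/

section CompactlyGenerated

open Pretriangulated

/-- `G` is a compact generator of a triangulated category with coproducts and small sets of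
morphisms. -/
structure IsCompactGenerator {T : Type*} [Category* T] [HasZeroObject T] [HasShift T ℤ]
    [Preadditive T] [∀ n : ℤ, (shiftFunctor T n).Additive] [Pretriangulated T] (G : T) : Prop where
  isCompactObj : IsCompactObj.{u} G
  isWeakGenerator : IsWeakGenerator G
  hasCoproducts (J : Type u) : HasCoproductsOfShape J T
  small (X Y : T) : Small.{u} (X ⟶ Y)

universe v₁ u₁

lemma eq_zero_of_shift {T : Type*} [Category* T] [HasZeroObject T] [HasShift T ℤ]
    [Preadditive T] [∀ n : ℤ, (shiftFunctor T n).Additive] [Pretriangulated T] {K Z : T}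
    (n : ℤ) (h : ∀ k : K ⟶ Z⟦-n⟧, k = 0) (k : K⟦n⟧ ⟶ Z) : k = 0 := by
  let e := ((shiftEquiv T n).toAdjunction.homEquiv K Z)
  have h1 : e k = e 0 := (h _).trans (h _).symm
  exact e.injective h1

section Ladders

variable {A B C : Type u₁} [Category.{v₁} A] [Category.{v₁} B] [Category.{v₁} C]
  [HasZeroObject A] [HasZeroObject B] [HasZeroObject C]
  [Preadditive A] [Preadditive B] [Preadditive C] [HasShift A ℤ] [HasShift B ℤ] [HasShift C ℤ]
  [∀ n : ℤ, (shiftFunctor A n).Additive] [∀ n : ℤ, (shiftFunctor B n).Additive]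
  [∀ n : ℤ, (shiftFunctor C n).Additive]
  [Pretriangulated A] [Pretriangulated B] [Pretriangulated C]
  {GA : A} {GB : B} {GC : C}

lemma IsCompactGenerator.isLeftAdjoint (hA : IsCompactGenerator.{u} GA)
    (hB : IsCompactGenerator.{u} GB) (F : A ⥤ B) [F.CommShift ℤ] [F.IsTriangulated]
    (hF : PreservesCoproducts.{u} F) : F.IsLeftAdjoint := by
  have := hA.hasCoproducts
  exact isLeftAdjoint_of_preservesCoproducts F hA.isCompactObj hA.isWeakGenerator
    (fun _ _ => hA.small _ _) hB.small hF

/-- A right adjoint preserves coproducts if its left adjoint maps a compact generator to a compact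
object. -/
lemma IsCompactGenerator.preservesCoproducts (hB : IsCompactGenerator.{u} GB) {L : B ⥤ A}
    [L.CommShift ℤ] {F : A ⥤ B} [F.Additive] (adj : L ⊣ F)
    (hL : IsCompactObj.{u} (L.obj GB)) : PreservesCoproducts.{u} F := by
  have := hB.hasCoproducts
  refine preservesCoproducts_of_isCompactObj adj hB.isCompactObj hB.isWeakGenerator fun n => ?_
  let e := (L.commShiftIso n).app GB
  exact (hL.shift n).of_retract e.hom e.inv e.hom_inv_id

/-- A functor `i` is fully faithful if it has a right adjoint and its values on a compact
generator are universal. -/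
lemma IsCompactGenerator.isIso_unit (hA : IsCompactGenerator.{u} GA) {i : A ⥤ B} {p : B ⥤ A}
    [i.CommShift ℤ] (adj : i ⊣ p) (h : IsUniversalArrow i (𝟙 (i.obj GA))) : IsIso adj.unit := by
  rw [NatTrans.isIso_iff_isIso_app]
  intro X
  refine hA.isWeakGenerator.isIso _ fun n => ?_
  have h1 : Function.Bijective fun g : GA⟦n⟧ ⟶ X => i.map g := by
    have h2 := h.shift n X
    have h3 : Function.Bijective fun k : i.obj (GA⟦n⟧) ⟶ i.obj X =>
        (i.commShiftIso n).inv.app GA ≫ k :=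
      ((i.commShiftIso n).app GA).symm.homFromEquiv.symm.bijective
    refine (h3.of_comp_iff' _).1 ?_
    refine (congrArg Function.Bijective (funext fun g => ?_)).mp h2
    simp
  have h2 : (fun g : GA⟦n⟧ ⟶ X => g ≫ adj.unit.app X) =
      adj.homEquiv _ _ ∘ fun g : GA⟦n⟧ ⟶ X => i.map g := by
    funext g
    simp [Adjunction.homEquiv_unit]
  exact (congrArg Function.Bijective h2).mpr ((adj.homEquiv _ _).bijective.comp h1)

variable {i : A ⥤ B} {e : B ⥤ C} {r : C ⥤ B} [i.CommShift ℤ] [i.IsTriangulated]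
  [e.CommShift ℤ] [e.IsTriangulated]

/-- Sufficient conditions for a recollement of compactly generated triangulated categories. The
universal arrow `η` makes `i` a right adjoint; its fiber `K` is left orthogonal to the kernel of
`e`. -/
theorem IsCompactGenerator.nonempty_triangulatedRecollement (hA : IsCompactGenerator.{u} GA)
    (hB : IsCompactGenerator.{u} GB) (hC : IsCompactGenerator.{u} GC)
    {η : GB ⟶ i.obj GA} (hη : IsUniversalArrow i η) {P : B} {θ : GC ⟶ e.obj P}
    (hθ : IsUniversalArrow e θ) {K : B} {a : K ⟶ GB} {d : i.obj GA ⟶ K⟦(1 : ℤ)⟧}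
    (hT : Triangle.mk a η d ∈ distTriang B)
    (hK : ∀ Z : B, IsZero (e.obj Z) → ∀ k : K ⟶ Z, k = 0)
    (hei : ∀ X : A, IsZero (e.obj (i.obj X))) (adj : e ⊣ r) [r.Full] [r.Faithful] :
    Nonempty (TriangulatedRecollement i e) := by
  have := hA.hasCoproducts
  have := hB.hasCoproducts
  have := hC.hasCoproducts
  have hi : IsTriangleFunctor i := ⟨inferInstance, inferInstance⟩
  have he : IsTriangleFunctor e := ⟨inferInstance, inferInstance⟩
  have : i.Additive := hi.additive
  have : i.IsRightAdjoint := isRightAdjoint_of_isUniversalArrow i hB.isCompactObj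
    hB.isWeakGenerator (fun _ _ => hB.small _ _) hη
  let adjq := Adjunction.ofIsRightAdjoint i
  have hq (n : ℤ) : IsCompactObj.{u} (i.leftAdjoint.obj (GB⟦n⟧)) := by
    obtain ⟨f, -⟩ := (isUniversalArrow_unit adjq (GB⟦n⟧)).nonempty_iso (hη.shift n)
    exact (hA.isCompactObj.shift n).of_retract f.hom f.inv f.hom_inv_id
  have : i.IsLeftAdjoint := hA.isLeftAdjoint hB i
    (preservesCoproducts_of_isCompactObj adjq hB.isCompactObj hB.isWeakGenerator hq)
  let adjp := Adjunction.ofIsLeftAdjoint i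
  have : e.IsRightAdjoint := isRightAdjoint_of_isUniversalArrow e hC.isCompactObj
    hC.isWeakGenerator (fun _ _ => hC.small _ _) hθ
  let adjl := Adjunction.ofIsRightAdjoint e
  have hKn (Z : B) (hZ : IsZero (e.obj Z)) (n : ℤ) (k : K⟦n⟧ ⟶ Z) : k = 0 := by
    refine eq_zero_of_shift n (hK _ ?_) k
    exact ((shiftFunctor C (-n)).map_isZero hZ).of_iso ((e.commShiftIso (-n)).app Z)
  have huniv : IsUniversalArrow i (𝟙 (i.obj GA)) := by
    intro Y
    have h1 := hη Y
    have h2 : Function.Bijective fun k : i.obj GA ⟶ i.obj Y => η ≫ k := by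
      refine bijective_precomp_of_distTriang (rot_of_distTriang _ hT) (hKn _ (hei Y) 1)
        fun k => ?_
      let φ : (K⟦(1 : ℤ)⟧)⟦(-1 : ℤ)⟧ ≅ K := (shiftEquiv B (1 : ℤ)).unitIso.symm.app K
      exact (cancel_epi φ.inv).1 ((hK _ (hei Y) _).trans (hK _ (hei Y) _).symm)
    refine (h2.of_comp_iff' _).1 ?_
    refine (congrArg Function.Bijective (funext fun g => ?_)).mp h1
    simp
  have : IsIso adjp.unit := hA.isIso_unit adjp huniv
  have ffi := adjp.fullyFaithfulLOfIsIsoUnit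
  have ffl : e.leftAdjoint.FullyFaithful :=
    (Adjunction.Triple.mk adjl adj).fullyFaithfulEquiv.symm (.ofFullyFaithful r)
  have key (Z : B) (hZe : IsZero (e.obj Z)) (hZp : IsZero (i.rightAdjoint.obj Z)) : IsZero Z := by
    refine hB.isWeakGenerator Z fun n g => ?_
    obtain ⟨a', η', d', hT'⟩ := exists_shift_distTriang hT n
    obtain ⟨g', rfl⟩ := exists_desc₂ hT' g (hKn Z hZe n _)
    let ψ : (i.obj GA)⟦n⟧ ≅ i.obj (GA⟦n⟧) := ((i.commShiftIso n).app GA).symm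
    have h0 : ψ.inv ≫ g' = 0 := (adjp.homEquiv _ _).injective (hZp.eq_of_tgt _ _)
    rw [(cancel_epi ψ.inv).1 (h0.trans comp_zero.symm), comp_zero]
  have htp := hi.rightAdjoint adjp
  have himage (X : B) : i.essImage X ↔ IsZero (e.obj X) := by
    refine ⟨fun ⟨Y, ⟨f⟩⟩ => (hei Y).of_iso (e.mapIso f.symm), fun hX => ?_⟩
    obtain ⟨Z, b, c, hT'⟩ := exists_distTriang (adjp.counit.app X)
    obtain ⟨_, _⟩ := htp
    have hZp := isZero_of_distTriang_isIso₁ (map_distTriang hT' i.rightAdjoint)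
      (isIso_map_counit adjp X)
    have hZe : IsZero (e.obj Z) := by
      have := isIso_of_distTriang_isZero₁ (map_distTriang hT' e) (hei _)
      exact hX.of_iso (asIso (e.map b)).symm
    have := isIso_of_distTriang_isZero₃ hT' (key Z hZe hZp)
    exact ⟨_, ⟨asIso (adjp.counit.app X)⟩⟩
  exact ⟨{
    q := i.leftAdjoint
    p := i.rightAdjoint
    l := e.leftAdjoint
    r := r
    adj_q_i := adjq
    adj_i_p := adjp
    adj_l_e := adjl
    adj_e_r := adj
    full_i := ffi.full
    faithful_i := ffi.faithful
    full_l := ffl.full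
    faithful_l := ffl.faithful
    full_r := inferInstance
    faithful_r := inferInstance
    image_eq_kernel := himage
    triangle_i := hi
    triangle_e := he
    triangle_q := hi.leftAdjoint adjq
    triangle_p := htp
    triangle_l := he.leftAdjoint adjl
    triangle_r := he.rightAdjoint adj }⟩

/-- Brown representability provides the adjoints for a ladder of height four. -/
theorem IsCompactGenerator.hasDownwardLadder (hB : IsCompactGenerator.{u} GB)
    (hC : IsCompactGenerator.{u} GC) (R : TriangulatedRecollement i e) (adj : e ⊣ r)
    {r₁ : B ⥤ C} (adj₁ : r ⊣ r₁) (hr : IsCompactObj.{u} (r.obj GC))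
    (hr₁ : IsCompactObj.{u} (r₁.obj GB)) : HasDownwardLadder 4 i e := by
  have htr := R.triangle_e.rightAdjoint adj
  have htr₁ := htr.rightAdjoint adj₁
  have := htr₁.additive
  have h₁ : PreservesCoproducts.{u} r₁ := by
    obtain ⟨_, _⟩ := htr
    exact hC.preservesCoproducts adj₁ hr
  have : r₁.IsLeftAdjoint := by
    obtain ⟨_, _⟩ := htr₁
    exact hB.isLeftAdjoint hC r₁ h₁
  let adj₂ := Adjunction.ofIsLeftAdjoint r₁
  have htr₂ := htr₁.rightAdjoint adj₂
  have := htr₂.additive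
  have h₂ : PreservesCoproducts.{u} r₁.rightAdjoint := by
    obtain ⟨_, _⟩ := htr₁
    exact hB.preservesCoproducts adj₂ hr₁
  have : r₁.rightAdjoint.IsLeftAdjoint := by
    obtain ⟨_, _⟩ := htr₂
    exact hC.isLeftAdjoint hB _ h₂
  refine R.hasDownwardLadder_four (adj₁.ofNatIsoLeft (adj.rightAdjointUniq R.adj_e_r)) adj₂
    (Adjunction.ofIsLeftAdjoint r₁.rightAdjoint)

/-- In a ladder of height four, the functor `r₁` has a right adjoint that preserves coproducts, so
it preserves compact objects. -/
lemma HasDownwardLadder.isCompactObj (h : HasDownwardLadder 4 i e) (adj : e ⊣ r)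
    {r₁ : B ⥤ C} (adj₁ : r ⊣ r₁) (hB : IsCompactObj.{u} GB) : IsCompactObj.{u} (r₁.obj GB) := by
  obtain ⟨r', r₂', r₁', r₃', ⟨a⟩, ⟨a₁⟩, ⟨a₂⟩, ⟨a₃⟩⟩ := h.exists_adjunctions
  have a₁' : r ⊣ r₁' := a₁.ofNatIsoLeft (a.rightAdjointUniq adj)
  have a₂' : r₁ ⊣ r₂' := a₂.ofNatIsoLeft (a₁'.rightAdjointUniq adj₁)
  have : e.Additive := (show IsTriangleFunctor e from ⟨inferInstance, inferInstance⟩).additive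
  have : r.Additive := adj.right_adjoint_additive
  have : r₁.Additive := adj₁.right_adjoint_additive
  have : r₂'.Additive := a₂'.right_adjoint_additive
  have : r₂'.IsLeftAdjoint := a₃.isLeftAdjoint
  exact hB.leftAdjoint_obj a₂' (preservesCoproducts_of_isLeftAdjoint _)

end Ladders

end CompactlyGenerated

/-! ### Recollements of derived categories of rings -/

section DerivedRecollement

open DerivedCategory HomologicalComplex Pretriangulated

/-- An exact functor which is fully faithful on derived categories is a homological embedding. -/
lemma isHomologicalEmbedding_of_fullyFaithful {A B : Type u} [Category.{v} A] [Category.{v} B]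
    [Abelian A] [Abelian B] [HasExt.{w} A] [HasExt.{w} B]
    [HasDerivedCategory A] [HasDerivedCategory B] (F : A ⥤ B)
    [F.Additive] [PreservesFiniteLimits F] [PreservesFiniteColimits F]
    [F.mapDerivedCategory.Full] [F.mapDerivedCategory.Faithful] : IsHomologicalEmbedding F := by
  intro X Y n
  rw [Functor.mapExtAddHom_coe]
  let a := (F.mapDerivedCategorySingleFunctor 0).app X
  let b := (shiftFunctor (DerivedCategory B) (n : ℤ)).mapIso
    ((F.mapDerivedCategorySingleFunctor 0).app Y)
  let c := (F.mapDerivedCategory.commShiftIso (n : ℤ)).app ((singleFunctor A 0).obj Y)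
  have h2 : Function.Bijective fun f : (singleFunctor A 0).obj X ⟶
      ((singleFunctor A 0).obj Y)⟦(n : ℤ)⟧ =>
      a.inv ≫ (F.mapDerivedCategory.map f ≫ c.hom) ≫ b.hom := by
    have h3 := (Functor.FullyFaithful.ofFullyFaithful F.mapDerivedCategory).homEquiv
      (X := (singleFunctor A 0).obj X) (Y := ((singleFunctor A 0).obj Y)⟦(n : ℤ)⟧) |>.bijective
    refine (congrArg Function.Bijective (funext fun f => ?_)).mp
      ((Iso.homCongr a (c ≪≫ b)).bijective.comp h3)
    exact congrArg (a.inv ≫ ·) (Category.assoc _ _ _).symm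
  refine (Function.Bijective.of_comp_iff' (Abelian.Ext.homEquiv (C := B)
    (X := F.obj X) (Y := F.obj Y) (n := n)).bijective _).1 ?_
  have h4 : Abelian.Ext.homEquiv (X := F.obj X) (Y := F.obj Y) (n := n) ∘
      Abelian.Ext.mapExactFunctor F = (fun f => a.inv ≫ (F.mapDerivedCategory.map f ≫ c.hom) ≫
        b.hom) ∘ Abelian.Ext.homEquiv (X := X) (Y := Y) (n := n) := by
    funext e
    exact Abelian.Ext.mapExactFunctor_hom F e
  rw [h4]
  exact h2.comp (Equiv.bijective _)

variable (R : Type u) [Ring R] [HasDerivedCategory.{w} (ModuleCat.{u} R)] in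
lemma isCompactGenerator_ringObj : IsCompactGenerator.{u} (ringObj R) where
  isCompactObj := isCompactObj_ringObj R
  isWeakGenerator := isWeakGenerator_ringObj R
  hasCoproducts := inferInstance
  small := small_hom_derivedCategory

variable {S Γ Λ : Type u} [Ring S] [Ring Γ] [Ring Λ]
  [HasDerivedCategory.{w} (ModuleCat.{u} S)] [HasDerivedCategory.{w} (ModuleCat.{u} Γ)]
  [HasDerivedCategory.{w} (ModuleCat.{u} Λ)]
  {i : ModuleCat.{u} S ⥤ ModuleCat.{u} Γ} {e : ModuleCat.{u} Γ ⥤ ModuleCat.{u} Λ}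
  {r : ModuleCat.{u} Λ ⥤ ModuleCat.{u} Γ} {r₁ : ModuleCat.{u} Γ ⥤ ModuleCat.{u} Λ}
  [i.Additive] [PreservesFiniteLimits i] [PreservesFiniteColimits i]
  [e.Additive] [PreservesFiniteLimits e] [PreservesFiniteColimits e]
  [r.Additive] [PreservesFiniteLimits r] [PreservesFiniteColimits r]
  [r₁.Additive] [PreservesFiniteLimits r₁] [PreservesFiniteColimits r₁]

/-- Exact functors `i` and `e` induce a recollement of derived categories if the kernel `K` of a
universal arrow from the regular module to a value of `i` is a summand of a sum of copies of a
projective module `P` which represents `e`. -/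
theorem nonempty_triangulatedRecollement_mapDerivedCategory
    {η : ModuleCat.of Γ Γ ⟶ i.obj (ModuleCat.of S S)} (hη : IsUniversalArrow i η)
    {P : ModuleCat.{u} Γ} [Projective P] {θ : ModuleCat.of Λ Λ ⟶ e.obj P}
    (hθ : IsUniversalArrow e θ) {K : ModuleCat.{u} Γ} {a : K ⟶ ModuleCat.of Γ Γ} {w : a ≫ η = 0}
    (hS : (ShortComplex.mk a η w).ShortExact) {B : Type*} [Fintype B] (p : B → (K ⟶ P))
    (j : B → (P ⟶ K)) (hpj : ∑ b, p b ≫ j b = 𝟙 K) (hei : ∀ X, IsZero (e.obj (i.obj X)))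
    (adj : e ⊣ r) [r.Full] [r.Faithful] :
    Nonempty (TriangulatedRecollement i.mapDerivedCategory e.mapDerivedCategory) := by
  obtain ⟨η', hη', hη'u⟩ := isUniversalArrow_mapDerivedCategory i hη
  obtain ⟨θ', -, hθ'⟩ := isUniversalArrow_mapDerivedCategory e hθ
  let φ := mapDerivedSingleIso i (ModuleCat.of S S)
  have hT : Triangle.mk ((singleFunctor _ 0).map a) η' (φ.hom ≫ hS.singleδ) ∈
      distTriang (DerivedCategory (ModuleCat.{u} Γ)) :=
    isomorphic_distinguished _ hS.singleTriangle_distinguished _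
      (Triangle.isoMk _ _ (Iso.refl _) (Iso.refl _) φ
        ((Category.comp_id _).trans (Category.id_comp _).symm)
        (hη'.trans (Category.id_comp _).symm)
        (by
          refine (congrArg (_ ≫ ·) ?_).trans (Category.comp_id _)
          exact (shiftFunctor _ (1 : ℤ)).map_id _))
  have hZ (Z : DerivedCategory (ModuleCat.{u} Γ)) (hZ : IsZero (e.mapDerivedCategory.obj Z))
      (f : (singleFunctor _ 0).obj P ⟶ Z) : f = 0 :=
    (hθ' Z).1 (hZ.eq_of_tgt _ _)
  obtain ⟨_, _⟩ := fullyFaithful_mapDerivedCategory adj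
  refine (isCompactGenerator_ringObj S).nonempty_triangulatedRecollement
    (isCompactGenerator_ringObj Γ) (isCompactGenerator_ringObj Λ) hη'u hθ' hT ?_ ?_
    (mapDerivedCategoryAdjunction adj)
  · intro Z hZ0 k
    have h1 : 𝟙 ((singleFunctor _ 0).obj K) = ∑ b, (singleFunctor _ 0).map (p b) ≫
        (singleFunctor _ 0).map (j b) := by
      simp only [← Functor.map_comp, ← Functor.map_sum, hpj, CategoryTheory.Functor.map_id]
    rw [← Category.id_comp k]
    refine (congrArg (· ≫ k) h1).trans ?_
    rw [Preadditive.sum_comp]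
    refine Finset.sum_eq_zero fun b _ => ?_
    rw [Category.assoc]
    exact (congrArg (_ ≫ ·) (hZ Z hZ0 _)).trans comp_zero
  · intro X
    obtain ⟨Y, ⟨f⟩⟩ := Q_obj_surjective X
    let W := (e.mapHomologicalComplex (ComplexShape.up ℤ)).obj
      ((i.mapHomologicalComplex (ComplexShape.up ℤ)).obj Y)
    have hW : IsZero W := by
      rw [IsZero.iff_id_eq_zero]
      ext1 k
      exact (hei (Y.X k)).eq_of_src _ _
    refine (Q.map_isZero hW).of_iso (Iso.symm ?_)
    exact e.mapDerivedCategoryFactors.symm.app _ ≪≫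
      e.mapDerivedCategory.mapIso (i.mapDerivedCategoryFactors.symm.app Y ≪≫
        i.mapDerivedCategory.mapIso f)

lemma isCompactObj_mapDerivedCategory_obj_iff (M : ModuleCat.{u} Γ) :
    IsCompactObj.{u} (e.mapDerivedCategory.obj (Q.obj ((single _ (ComplexShape.up ℤ) 0).obj M))) ↔
      IsCompactModule (e.obj M) := by
  let φ := mapDerivedSingleIso e M
  exact ⟨fun h => h.of_retract φ.inv φ.hom φ.inv_hom_id,
    fun h => h.of_retract φ.hom φ.inv φ.hom_inv_id⟩

/-- The criterion for ladders of height four, for functors induced by exact adjoint functors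
`e ⊣ r ⊣ r₁` between module categories. -/
theorem hasDownwardLadder_mapDerivedCategory
    (R : TriangulatedRecollement i.mapDerivedCategory e.mapDerivedCategory) (adj : e ⊣ r)
    (adj₁ : r ⊣ r₁) (hr : IsCompactModule (r.obj (ModuleCat.of Λ Λ)))
    (hr₁ : IsCompactModule (r₁.obj (ModuleCat.of Γ Γ))) :
    HasDownwardLadder 4 i.mapDerivedCategory e.mapDerivedCategory :=
  (isCompactGenerator_ringObj Γ).hasDownwardLadder (isCompactGenerator_ringObj Λ) R
    (mapDerivedCategoryAdjunction adj) (mapDerivedCategoryAdjunction adj₁)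
    ((isCompactObj_mapDerivedCategory_obj_iff _).2 hr)
    ((isCompactObj_mapDerivedCategory_obj_iff _).2 hr₁)

/-- The converse of `hasDownwardLadder_mapDerivedCategory` for the functor `r₁`. -/
theorem isCompactModule_of_hasDownwardLadder
    (h : HasDownwardLadder 4 i.mapDerivedCategory e.mapDerivedCategory) (adj : e ⊣ r)
    (adj₁ : r ⊣ r₁) : IsCompactModule (r₁.obj (ModuleCat.of Γ Γ)) :=
  (isCompactObj_mapDerivedCategory_obj_iff _).1
    (h.isCompactObj (mapDerivedCategoryAdjunction adj) (mapDerivedCategoryAdjunction adj₁)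
      (isCompactObj_ringObj Γ))

end DerivedRecollement

/-! ### Adjoint functors between module categories -/

section ModuleAdjoints

variable {R S : Type u} [Ring R] [Ring S]

lemma exists_hom_apply_one {X : ModuleCat.{u} R} (x : X) :
    ∃ f : ModuleCat.of R R ⟶ X, f.hom (1 : R) = x :=
  ⟨ModuleCat.ofHom (LinearMap.toSpanSingleton R X x), one_smul R x⟩

lemma hom_ext_one {X : ModuleCat.{u} R} {f g : ModuleCat.of R R ⟶ X}
    (h : f.hom (1 : R) = g.hom (1 : R)) : f = g :=
  ModuleCat.hom_ext (LinearMap.ext_ring h)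

lemma isIso_of_bijective_comp_ring {X Y : ModuleCat.{u} R} (f : X ⟶ Y)
    (h : Function.Bijective fun g : ModuleCat.of R R ⟶ X => g ≫ f) : IsIso f := by
  rw [ConcreteCategory.isIso_iff_bijective]
  refine ⟨fun x y hxy => ?_, fun y => ?_⟩
  · obtain ⟨a, rfl⟩ := exists_hom_apply_one x
    obtain ⟨b, rfl⟩ := exists_hom_apply_one y
    rw [h.1 (hom_ext_one (f := a ≫ f) (g := b ≫ f) hxy)]
  · obtain ⟨b, rfl⟩ := exists_hom_apply_one y
    obtain ⟨a, rfl⟩ := h.2 b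
    exact ⟨a.hom (1 : R), rfl⟩

/-- Arrows from the regular module correspond to elements. -/
lemma isUniversalArrow_ring_iff {F : ModuleCat.{u} S ⥤ ModuleCat.{u} R} {L : ModuleCat.{u} S}
    {η : ModuleCat.of R R ⟶ F.obj L} : IsUniversalArrow F η ↔
      ∀ (Y : ModuleCat.{u} S) (y : F.obj Y), ∃! g : L ⟶ Y, (F.map g).hom (η.hom (1 : R)) = y := by
  refine forall_congr' fun Y => ?_
  rw [Function.bijective_iff_existsUnique]
  refine ⟨fun h y => ?_, fun h f => ?_⟩
  · obtain ⟨f, rfl⟩ := exists_hom_apply_one y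
    refine (existsUnique_congr fun g => ?_).1 (h f)
    exact ⟨fun e => congrArg (fun k => k.hom (1 : R)) e, fun e => hom_ext_one e⟩
  · refine (existsUnique_congr fun g => ?_).1 (h (f.hom (1 : R)))
    exact ⟨fun e => hom_ext_one e, fun e => congrArg (fun k => k.hom (1 : R)) e⟩

/-- A functor between module categories has a left adjoint as soon as the left adjoint is defined
at the regular module, since every module has a free presentation. -/
lemma isRightAdjoint_of_isUniversalArrow_ring {F : ModuleCat.{u} S ⥤ ModuleCat.{u} R}
    {L : ModuleCat.{u} S} {η : ModuleCat.of R R ⟶ F.obj L} (h : IsUniversalArrow F η) :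
    F.IsRightAdjoint := by
  have free (J : Type u) : F.leftAdjointObjIsDefined (∐ fun _ : J => ModuleCat.of R R) :=
    Functor.leftAdjointObjIsDefined_of_isColimit (coproductIsCoproduct _)
      fun _ => h.leftAdjointObjIsDefined
  have cover (X : ModuleCat.{u} R) : ∃ (J : Type u)
      (π : (∐ fun _ : J => ModuleCat.of R R) ⟶ X), Epi π := by
    choose a ha using fun x : X => exists_hom_apply_one x
    refine ⟨X, Limits.Sigma.desc a, ?_⟩
    rw [ModuleCat.epi_iff_surjective]
    intro x
    refine ⟨(Sigma.ι (fun _ : X => ModuleCat.of R R) x).hom (1 : R), Eq.trans ?_ (ha x)⟩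
    exact congrArg (fun k : ModuleCat.of R R ⟶ X => k.hom (1 : R)) (Sigma.ι_desc a x)
  refine Functor.isRightAdjoint_of_leftAdjointObjIsDefined_eq_top ?_
  ext X
  simp only [Pi.top_apply, Prop.top_eq_true, iff_true]
  obtain ⟨J, π, hπ⟩ := cover X
  obtain ⟨J', π', hπ'⟩ := cover (kernel π)
  have h0 : (π' ≫ kernel.ι π) ≫ π = 0 := by rw [Category.assoc, kernel.condition, comp_zero]
  have hex : (ShortComplex.mk _ _ h0).Exact := by
    rw [ShortComplex.moduleCat_exact_iff]
    intro x hx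
    have hk : (ShortComplex.mk _ _ (kernel.condition π)).Exact :=
      ShortComplex.exact_of_f_is_kernel _ (kernelIsKernel π)
    rw [ShortComplex.moduleCat_exact_iff] at hk
    obtain ⟨y, rfl⟩ := hk x hx
    obtain ⟨z, rfl⟩ := (ModuleCat.epi_iff_surjective _).1 hπ' y
    exact ⟨z, rfl⟩
  refine Functor.leftAdjointObjIsDefined_of_isColimit hex.gIsCokernel ?_
  rintro (_ | _)
  · exact free J'
  · exact free J

variable (R) in
lemma isCompactObj_ring : IsCompactObj.{u} (ModuleCat.of R R) := by
  intro J X c hc f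
  obtain ⟨A, hA⟩ := exists_cofanPart_apply_eq hc (f.hom (1 : R))
  exact ⟨A, hom_ext_one hA⟩

/-- A functor between module categories is a left adjoint if it has a left adjoint which maps the
regular module to a finitely generated projective module. -/
lemma isLeftAdjoint_of_finite_of_projective {L : ModuleCat.{u} R ⥤ ModuleCat.{u} S}
    {F : ModuleCat.{u} S ⥤ ModuleCat.{u} R} [F.Additive] (adj : L ⊣ F)
    [Module.Finite S (L.obj (ModuleCat.of R R))]
    [Module.Projective S (L.obj (ModuleCat.of R R))] : F.IsLeftAdjoint := by
  have hc : PreservesCoproducts.{u} F := by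
    refine preservesCoproducts_of_forall_isCompactObj adj (fun _ : Unit => ModuleCat.of R R)
      (fun _ => isCompactObj_ring R) (fun X Y f hf => isIso_of_bijective_comp_ring f (hf ()))
      fun _ => ?_
    obtain ⟨n, p, i, h⟩ := exists_dual_basis (L.obj (ModuleCat.of R R))
    exact IsCompactObj.of_sum _ (fun _ => isCompactObj_ring S) p i h
  have hP : Projective (L.obj (ModuleCat.of R R)) :=
    (IsProjective.iff_projective _).1 inferInstance
  have : PreservesLimitsOfSize.{0, 0} F := adj.rightAdjoint_preservesLimits
  have hepi {X Y : ModuleCat.{u} S} (g : X ⟶ Y) [Epi g] : Epi (F.map g) := by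
    rw [ModuleCat.epi_iff_surjective]
    intro y
    obtain ⟨f, rfl⟩ := exists_hom_apply_one y
    let f' := (adj.homEquiv _ _).symm f
    have h1 : adj.homEquiv _ _ (Projective.factorThru f' g) ≫ F.map g = f := by
      rw [← adj.homEquiv_naturality_right, Projective.factorThru_comp]
      exact (adj.homEquiv _ _).apply_symm_apply f
    exact ⟨(adj.homEquiv _ _ (Projective.factorThru f' g)).hom (1 : R),
      congrArg (fun k => k.hom (1 : R)) h1⟩
  have : PreservesFiniteLimits F := inferInstance
  have : PreservesFiniteColimits F := by
    refine ((F.exact_tfae.out 0 3 : _ ↔ PreservesFiniteLimits F ∧ PreservesFiniteColimits F).1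
      fun T hT => ?_).2
    have := hT.epi_g
    have := hT.mono_f
    exact
      { exact := (hT.exact.map_of_mono_of_preservesKernel F inferInstance inferInstance)
        mono_f := inferInstanceAs (Mono (F.map T.f))
        epi_g := hepi T.g }
  have (J : Type u) : PreservesColimitsOfShape (Discrete J) F := by
    have (X : J → ModuleCat.{u} S) : PreservesColimit (Discrete.functor X) F := by
      obtain ⟨h⟩ := hc (coproductIsCoproduct X)
      exact preservesColimit_of_preserves_colimit_cocone (coproductIsCoproduct X)
        ((Cofan.isColimitMapCoconeEquiv F _ _).symm h)
    exact preservesColimitsOfShape_of_discrete F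
  have : PreservesColimits F := preservesColimits_of_preservesCoequalizers_and_coproducts F
  exact isLeftAdjoint_of_preservesColimits_of_isSeparating
    (ModuleCat.isSeparator.{u} S) F

/-- A functor between module categories has a right adjoint if its left adjoint is defined at the
regular module, with a finitely generated projective module as value. -/
lemma isLeftAdjoint_of_isUniversalArrow_ring {F : ModuleCat.{u} S ⥤ ModuleCat.{u} R} [F.Additive]
    {P : ModuleCat.{u} S} [Module.Finite S P] [Module.Projective S P]
    {η : ModuleCat.of R R ⟶ F.obj P} (h : IsUniversalArrow F η) : F.IsLeftAdjoint := by
  have := isRightAdjoint_of_isUniversalArrow_ring h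
  let adj := Adjunction.ofIsRightAdjoint F
  obtain ⟨f, -⟩ := (isUniversalArrow_unit adj (ModuleCat.of R R)).nonempty_iso h
  have := Module.Finite.equiv f.toLinearEquiv.symm
  have := Module.Projective.of_equiv f.toLinearEquiv.symm
  exact isLeftAdjoint_of_finite_of_projective adj

end ModuleAdjoints

/-! ### Matrix units and columns -/

section Columns

open scoped Matrix.Module

variable {Λ : Type u} [Ring Λ] (I : TwoSidedIdeal Λ)

/-- The element of `Γ` whose only nonzero entry is `x` in position `(a, b)`. -/
def gammaSingle {n : ℕ} (a b : Fin n) (x : Λ) (h : a < b → x ∈ I) : gammaRing I n :=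
  ⟨Matrix.single a b x, fun c d hcd => by
    rw [Matrix.single_apply]
    split_ifs with hab
    · exact h (hab.1 ▸ hab.2 ▸ hcd)
    · exact I.zero_mem⟩

lemma gammaSingle_val {n : ℕ} (a b : Fin n) (x : Λ) (h : a < b → x ∈ I) :
    (gammaSingle I a b x h).1 = Matrix.single a b x := rfl

/-- The `b`-th column of `γ`. -/
lemma mul_gammaSingle {n : ℕ} (γ : gammaRing I n) (b c : Fin n) (x : Λ) (h : b < c → x ∈ I)
    (h' : ∀ a : Fin n, a < c → γ.1 a b * x ∈ I) :
    γ * gammaSingle I b c x h = ∑ a, gammaSingle I a c (γ.1 a b * x) (h' a) := by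
  apply Subtype.ext
  ext d e
  simp only [Subring.coe_mul, AddSubmonoidClass.coe_finsetSum, gammaSingle_val, Matrix.sum_apply,
    Matrix.mul_apply, Matrix.single_apply]
  by_cases hce : c = e <;> simp [hce]

/-- The `b`-th row of `γ`. -/
lemma gammaSingle_mul {n : ℕ} (γ : gammaRing I n) (b c : Fin n) (x : Λ) (h : c < b → x ∈ I)
    (h' : ∀ a : Fin n, c < a → x * γ.1 b a ∈ I) :
    gammaSingle I c b x h * γ = ∑ a, gammaSingle I c a (x * γ.1 b a) (h' a) := by
  apply Subtype.ext
  ext d e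
  simp only [Subring.coe_mul, AddSubmonoidClass.coe_finsetSum, gammaSingle_val, Matrix.sum_apply,
    Matrix.mul_apply, Matrix.single_apply]
  by_cases hce : c = d <;> simp [hce]

/-- The functor which maps a `Λ`-module `X` to the column vectors with entries in `X`, on which `Γ`
acts by matrix multiplication. -/
def columnFunctor (n : ℕ) : ModuleCat.{u} Λ ⥤ ModuleCat.{u} (gammaRing I n) where
  obj X := ModuleCat.of (gammaRing I n) (Fin n → X)
  map {X Y} f := ModuleCat.ofHom
    { toFun := fun x a => f.hom (x a)
      map_add' := fun x y => funext fun a => map_add f.hom _ _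
      map_smul' := fun γ x => funext fun a => by
        change f.hom (∑ b, γ.1 a b • x b) = ∑ b, γ.1 a b • f.hom (x b)
        simp }

instance columnFunctor_additive (n : ℕ) : (columnFunctor I n).Additive where

/-- The entries of a column vector. -/
def columnEntry {n : ℕ} {X : ModuleCat.{u} Λ} (x : (columnFunctor I n).obj X) : Fin n → X := x

lemma column_smul_apply {n : ℕ} {X : ModuleCat.{u} Λ} (γ : gammaRing I n)
    (x : (columnFunctor I n).obj X) (a : Fin n) :
    columnEntry I (γ • x) a = ∑ b, γ.1 a b • columnEntry I x b := rfl

variable (m : ℕ)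

lemma lt_last_elim {m : ℕ} {a : Fin (m + 1)} {p : Prop} (h : Fin.last m < a) : p :=
  absurd h (Fin.le_last a).not_gt

lemma lt_zero_elim {m : ℕ} {a : Fin (m + 1)} {p : Prop} (h : a < 0) : p :=
  absurd h (Fin.zero_le a).not_gt

/-- The elementary matrices with entry `x` in the last row. -/
abbrev rowSingle (a : Fin (m + 1)) (x : Λ) : gammaRing I (m + 1) :=
  gammaSingle I (Fin.last m) a x lt_last_elim

/-- The elementary matrices with entry `x` in the first column. -/
abbrev columnSingle (a : Fin (m + 1)) (x : Λ) : gammaRing I (m + 1) :=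
  gammaSingle I a 0 x lt_zero_elim

lemma rowSingle_mul (a : Fin (m + 1)) (γ : gammaRing I (m + 1)) :
    rowSingle I m a 1 * γ = ∑ b, diagonalHom I (Fin.last m) (γ.1 a b) * rowSingle I m b 1 := by
  rw [rowSingle, gammaSingle_mul I γ _ _ _ _ fun _ => lt_last_elim]
  refine Finset.sum_congr rfl fun b _ => Subtype.ext ?_
  refine Eq.trans ?_ (Matrix.single_mul_single_same _ _ _ _ _).symm
  rw [mul_one, gammaSingle_val, one_mul]

lemma mul_columnSingle (b : Fin (m + 1)) (γ : gammaRing I (m + 1)) :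
    γ * columnSingle I m b 1 = ∑ a, columnSingle I m a 1 * diagonalHom I 0 (γ.1 a b) := by
  rw [columnSingle, mul_gammaSingle I γ _ _ _ _ fun _ => lt_zero_elim]
  refine Finset.sum_congr rfl fun b _ => Subtype.ext ?_
  refine Eq.trans ?_ (Matrix.single_mul_single_same _ _ _ _ _).symm
  rw [mul_one, gammaSingle_val, one_mul]

lemma diagonalHom_mul_rowSingle (a : Fin (m + 1)) :
    diagonalHom I (Fin.last m) 1 * rowSingle I m a 1 = rowSingle I m a 1 :=
  Subtype.ext ((Matrix.single_mul_single_same _ _ _ _ _).trans (by rw [one_mul]; rfl))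

lemma column_single_smul {n : ℕ} {X : ModuleCat.{u} Λ} (a b : Fin n) (c : Λ) (h : a < b → c ∈ I)
    (x : (columnFunctor I n).obj X) :
    gammaSingle I a b c h • x = (Pi.single a (c • columnEntry I x b) : Fin n → X) := by
  funext d
  refine (column_smul_apply I _ x d).trans ?_
  rw [Finset.sum_eq_single b]
  · by_cases hd : d = a
    · subst hd
      simp [gammaSingle_val]
    · simp [gammaSingle_val, Matrix.single_apply_of_row_ne (Ne.symm hd), hd]
  · intro e _ he
    simp [gammaSingle_val, Matrix.single_apply_of_col_ne _ _ (Ne.symm he)]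
  · simp

/-- The map from a `Γ`-module `M` to the column vectors with entries in `f M`. -/
def toColumn (M : ModuleCat.{u} (gammaRing I (m + 1))) :
    M ⟶ (columnFunctor I (m + 1)).obj ((functorE I m).obj M) :=
  ModuleCat.ofHom
    { toFun := fun x a => ⟨rowSingle I m a 1 • x, by
        change diagonalHom I (Fin.last m) 1 • rowSingle I m a 1 • x = _
        rw [smul_smul, diagonalHom_mul_rowSingle]⟩
      map_add' := fun x y => funext fun a => Subtype.ext (smul_add _ _ _)
      map_smul' := fun γ x => funext fun a => Subtype.ext (by
        refine (smul_smul (rowSingle I m a 1) γ x).trans ?_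
        rw [rowSingle_mul, Finset.sum_smul]
        refine Eq.trans ?_ (map_sum (AddSubgroup.subtype
          (cornerSubgroup (diagonalHom I (Fin.last m)) M)) _ _).symm
        exact Finset.sum_congr rfl fun b _ => mul_smul _ _ _) }

/-- The map from the column vectors supported in the last entry to this entry. -/
def lastEntry (X : ModuleCat.{u} Λ) :
    (functorE I m).obj ((columnFunctor I (m + 1)).obj X) ⟶ X :=
  ModuleCat.ofHom
    { toFun := fun y => columnEntry I y.1 (Fin.last m)
      map_add' := fun x y => rfl
      map_smul' := fun c y => by
        refine (congrFun (column_single_smul I (Fin.last m) (Fin.last m) c lt_last_elim y.1)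
          _).trans ?_
        rw [Pi.single_eq_same]
        rfl }

/-- The adjunction between `e` and the column functor. -/
def cornerColumnAdjunction : functorE I m ⊣ columnFunctor I (m + 1) :=
  Adjunction.mkOfUnitCounit
    { unit :=
        { app := toColumn I m
          naturality := fun M N f => by
            ext x
            exact funext fun a => Subtype.ext (map_smul f.hom _ _).symm }
      counit :=
        { app := lastEntry I m
          naturality := fun X Y f => rfl }
      left_triangle := by
        ext M x
        exact Subtype.ext x.2
      right_triangle := by
        ext X x
        funext a
        refine (congrFun (column_single_smul I (Fin.last m) a 1 lt_last_elim x) _).trans ?_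
        rw [Pi.single_eq_same, one_smul]
        rfl }

lemma isIso_lastEntry (X : ModuleCat.{u} Λ) : IsIso (lastEntry I m X) := by
  rw [ConcreteCategory.isIso_iff_bijective]
  have h (y : (functorE I m).obj ((columnFunctor I (m + 1)).obj X)) :
      (y.1 : Fin (m + 1) → X) = Pi.single (Fin.last m) ((lastEntry I m X).hom y) := by
    refine y.2.symm.trans ((column_single_smul I _ _ 1 lt_last_elim y.1).trans ?_)
    rw [one_smul]
    rfl
  refine ⟨fun y z hyz => Subtype.ext ?_, fun x => ?_⟩
  · rw [h y, h z]
    exact congrArg _ hyz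
  · refine ⟨⟨(Pi.single (Fin.last m) x : Fin (m + 1) → X), ?_⟩, Pi.single_eq_same _ _⟩
    refine (column_single_smul I _ _ 1 lt_last_elim _).trans ?_
    rw [one_smul]
    exact congrArg _ (Pi.single_eq_same _ _)

lemma columnFunctor_full_faithful :
    (columnFunctor I (m + 1)).Full ∧ (columnFunctor I (m + 1)).Faithful := by
  have : IsIso (cornerColumnAdjunction I m).counit := by
    rw [NatTrans.isIso_iff_isIso_app]
    exact isIso_lastEntry I m
  have h := (cornerColumnAdjunction I m).fullyFaithfulROfIsIsoCounit
  exact ⟨h.full, h.faithful⟩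

/-- The map from a `Λ`-module to the column vectors supported in the first entry. -/
def toFirstEntry (X : ModuleCat.{u} Λ) :
    X ⟶ (cornerFunctor (diagonalHom I 0)).obj ((columnFunctor I (m + 1)).obj X) :=
  ModuleCat.ofHom
    { toFun := fun x => ⟨(Pi.single 0 x : Fin (m + 1) → X), by
        refine (column_single_smul I 0 0 1 lt_zero_elim _).trans ?_
        rw [one_smul]
        exact congrArg _ (Pi.single_eq_same _ _)⟩
      map_add' := fun x y => Subtype.ext (Pi.single_add _ _ _)
      map_smul' := fun c x => Subtype.ext (by
        refine Eq.trans ?_ (column_single_smul I 0 0 c lt_zero_elim _).symm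
        refine congrArg (Pi.single 0) (congrArg (c • ·) ?_)
        exact (Pi.single_eq_same (M := fun _ : Fin (m + 1) => X) 0 x).symm) }

/-- The map from the column vectors with entries in `f₀ M` to `M`, where `f₀` is the first diagonal
idempotent. -/
def ofColumn (M : ModuleCat.{u} (gammaRing I (m + 1))) :
    (columnFunctor I (m + 1)).obj ((cornerFunctor (diagonalHom I 0)).obj M) ⟶ M :=
  ModuleCat.ofHom
    { toFun := fun y => ∑ a, columnSingle I m a 1 •
        (columnEntry I y a).1
      map_add' := fun x y => by
        rw [← Finset.sum_add_distrib]
        exact Finset.sum_congr rfl fun a _ => smul_add _ _ _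
      map_smul' := fun γ y => by
        rw [RingHom.id_apply, Finset.smul_sum]
        simp_rw [smul_smul, mul_columnSingle, Finset.sum_smul]
        rw [Finset.sum_comm]
        refine Finset.sum_congr rfl fun a _ => ?_
        simp_rw [mul_smul]
        rw [← Finset.smul_sum]
        exact congrArg _ (map_sum (AddSubgroup.subtype _) _ _) }

/-- The adjunction between the column functor and the functor `f₀(-)`. -/
def columnCornerAdjunction :
    columnFunctor I (m + 1) ⊣ cornerFunctor (diagonalHom I (0 : Fin (m + 1))) :=
  Adjunction.mkOfUnitCounit
    { unit :=
        { app := toFirstEntry I m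
          naturality := fun X Y f => by
            ext x
            refine Subtype.ext (funext fun a => ?_)
            change (Pi.single 0 (f.hom x) : Fin (m + 1) → Y) a =
              f.hom ((Pi.single 0 x : Fin (m + 1) → X) a)
            by_cases ha : a = 0
            · subst ha
              simp
            · simp [ha] }
      counit :=
        { app := ofColumn I m
          naturality := fun M N f => by
            ext y
            change ∑ a, columnSingle I m a 1 • f.hom (columnEntry I (n := m + 1)
              (X := (cornerFunctor (diagonalHom I 0)).obj M) y a).1 = f.hom
                (∑ a, columnSingle I m a 1 • (columnEntry I y a).1)
            rw [map_sum]
            exact Finset.sum_congr rfl fun a _ => (map_smul f.hom _ _).symm }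
      left_triangle := by
        ext X x
        change ∑ a, columnSingle I m a 1 • (Pi.single 0
          (columnEntry I x a) : Fin (m + 1) → X) = x
        refine (Finset.sum_congr rfl fun a _ => column_single_smul I a 0 1 lt_zero_elim _).trans ?_
        simp only [one_smul]
        refine (Finset.sum_congr rfl fun a _ => congrArg (Pi.single a)
          (Pi.single_eq_same (M := fun _ : Fin (m + 1) => X) 0 _)).trans ?_
        exact Finset.univ_sum_single _
      right_triangle := by
        ext M x
        have h (x : cornerSubgroup (diagonalHom I (0 : Fin (m + 1))) M) :
            ∑ a, columnSingle I m a 1 •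
              ((Pi.single 0 x : Fin (m + 1) → cornerSubgroup (diagonalHom I 0) M) a).1 = x.1 := by
          rw [Finset.sum_eq_single 0]
          · rw [Pi.single_eq_same]
            exact x.2
          · intro a _ ha
            rw [Pi.single_eq_of_ne ha]
            exact smul_zero _
          · simp
        exact Subtype.ext (h x) }

instance columnFunctor_preservesFiniteLimits :
    PreservesFiniteLimits (columnFunctor I (m + 1)) := by
  have : PreservesLimitsOfSize.{0, 0} (columnFunctor I (m + 1)) :=
    (cornerColumnAdjunction I m).rightAdjoint_preservesLimits
  infer_instance

instance columnFunctor_preservesFiniteColimits :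
    PreservesFiniteColimits (columnFunctor I (m + 1)) := by
  have : PreservesColimitsOfSize.{0, 0} (columnFunctor I (m + 1)) :=
    (columnCornerAdjunction I m).leftAdjoint_preservesColimits
  infer_instance

end Columns

/-! ### The module generated by the corner idempotent -/

section CornerColumn

variable {Λ Γ : Type u} [Ring Λ] [Ring Γ] (φ : Λ →ₙ+* Γ)

lemma map_one_mul_map_one : φ 1 * φ 1 = φ 1 := by rw [← map_mul, one_mul]

/-- The left ideal `Γ f` for the idempotent `f = φ 1`. -/
def cornerIdeal : Submodule Γ Γ where
  carrier := {x | x * φ 1 = x}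
  zero_mem' := zero_mul _
  add_mem' := fun {x y} (hx : x * φ 1 = x) (hy : y * φ 1 = y) => by
    change (x + y) * φ 1 = x + y
    rw [add_mul, hx, hy]
  smul_mem' := fun c x (hx : x * φ 1 = x) => by
    change c * x * φ 1 = c * x
    rw [mul_assoc, hx]

/-- Right multiplication with the idempotent `f = φ 1`. -/
def toCornerIdeal : Γ →ₗ[Γ] cornerIdeal φ where
  toFun x := ⟨x * φ 1, by
    change x * φ 1 * φ 1 = x * φ 1
    rw [mul_assoc, map_one_mul_map_one]⟩
  map_add' x y := Subtype.ext (add_mul _ _ _)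
  map_smul' c x := Subtype.ext (mul_assoc _ _ _)

lemma toCornerIdeal_apply_val (x : cornerIdeal φ) : toCornerIdeal φ x.1 = x := Subtype.ext x.2

instance cornerIdeal_projective : Module.Projective Γ (cornerIdeal φ) :=
  Module.Projective.of_split (cornerIdeal φ).subtype (toCornerIdeal φ)
    (LinearMap.ext (toCornerIdeal_apply_val φ))

instance cornerIdeal_finite : Module.Finite Γ (cornerIdeal φ) :=
  Module.Finite.of_surjective (toCornerIdeal φ) fun x => ⟨x.1, toCornerIdeal_apply_val φ x⟩

/-- The module `Γ f` corepresents the functor `f(-)`. -/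
lemma exists_isUniversalArrow_cornerFunctor :
    ∃ θ : ModuleCat.of Λ Λ ⟶ (cornerFunctor φ).obj (ModuleCat.of Γ (cornerIdeal φ)),
      IsUniversalArrow (cornerFunctor φ) θ := by
  let f : cornerIdeal φ := ⟨φ 1, map_one_mul_map_one φ⟩
  let u : (cornerFunctor φ).obj (ModuleCat.of Γ (cornerIdeal φ)) :=
    ⟨f, Subtype.ext (map_one_mul_map_one φ)⟩
  obtain ⟨θ, hθ⟩ := exists_hom_apply_one u
  refine ⟨θ, isUniversalArrow_ring_iff.2 fun Y y => ?_⟩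
  rw [hθ]
  refine ⟨ModuleCat.ofHom
    { toFun := fun x => x.1 • y.1
      map_add' := fun a b => add_smul a.1 b.1 y.1
      map_smul' := fun c a => mul_smul c a.1 y.1 }, Subtype.ext y.2, fun g hg => ?_⟩
  ext x
  have h1 : g.hom f = y.1 := congrArg Subtype.val hg
  change g.hom x = x.1 • y.1
  rw [← h1, ← map_smul]
  exact congrArg _ (Subtype.ext x.2.symm)

end CornerColumn

/-! ### The ring `Σ` and the ideal `ΓfΓ` -/

section ModuleRecollement

variable {Λ : Type u} [Ring Λ] (I : TwoSidedIdeal Λ) (m : ℕ)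

lemma ringCon_mk'_eq_zero_iff {x : Λ} : I.ringCon.mk' x = 0 ↔ x ∈ I :=
  ⟨fun h => (TwoSidedIdeal.mem_iff I x).2 ((RingCon.eq I.ringCon).1
    (h.trans (map_zero I.ringCon.mk').symm)), ringCon_mk'_eq_zero I⟩

lemma gammaToSigma_surjective : Function.Surjective (gammaToSigma I m) := by
  intro σ
  choose s hs using I.ringCon.mk'_surjective
  let M : Matrix (Fin (m + 1)) (Fin (m + 1)) Λ := fun a b =>
    if h : b ≤ a ∧ a.1 < m ∧ b.1 < m then s (σ.1 ⟨a, h.2.1⟩ ⟨b, h.2.2⟩) else 0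
  refine ⟨⟨M, fun a b hab => ?_⟩, Subtype.ext (Matrix.ext fun a b => ?_)⟩
  · rw [show M a b = 0 from dif_neg fun h => hab.not_ge h.1]
    exact I.zero_mem
  · change I.ringCon.mk' (M a.castSucc b.castSucc) = σ.1 a b
    by_cases hab : b ≤ a
    · exact (congrArg _ (dif_pos ⟨hab, a.2, b.2⟩)).trans (hs _)
    · rw [σ.2 a b (not_le.1 hab)]
      exact (congrArg _ (dif_neg fun h => hab h.1)).trans (map_zero I.ringCon.mk')

lemma gammaToSigma_eq_zero_iff {γ : gammaRing I (m + 1)} :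
    gammaToSigma I m γ = 0 ↔ ∀ a b, a < Fin.last m → γ.1 a b ∈ I := by
  constructor
  · intro h a b ha
    rcases Fin.eq_castSucc_or_eq_last b with ⟨b, rfl⟩ | rfl
    · obtain ⟨a, rfl⟩ := Fin.exists_castSucc_eq.2 ha.ne
      exact (ringCon_mk'_eq_zero_iff I).1 (congrFun (congrFun (congrArg Subtype.val h) a) b)
    · exact γ.2 _ _ ha
  · intro h
    ext a b
    exact (ringCon_mk'_eq_zero_iff I).2 (h _ _ (Fin.castSucc_lt_last a))

instance functorI_full : (functorI I m).Full where
  map_surjective {X Y} g := ⟨ModuleCat.ofHom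
    { toFun := g.hom
      map_add' := map_add g.hom
      map_smul' := fun σ x => by
        obtain ⟨γ, rfl⟩ := gammaToSigma_surjective I m σ
        exact g.hom.map_smul γ x }, rfl⟩

/-- The projection from the regular `Γ`-module to `Σ`. -/
def sigmaProjection : ModuleCat.of (gammaRing I (m + 1)) (gammaRing I (m + 1)) ⟶
    (functorI I m).obj (ModuleCat.of (sigmaRing I m) (sigmaRing I m)) :=
  ModuleCat.ofHom
    (Y := (functorI I m).obj (ModuleCat.of (sigmaRing I m) (sigmaRing I m)))
    { toFun := gammaToSigma I m
      map_add' := map_add (gammaToSigma I m)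
      map_smul' := map_mul (gammaToSigma I m) }

/-- The value of the left adjoint of `i` at the regular module is `Σ`. -/
lemma isUniversalArrow_sigmaProjection :
    IsUniversalArrow (functorI I m) (sigmaProjection I m) := by
  refine isUniversalArrow_ring_iff.2 fun Y y => ?_
  have h1 : (sigmaProjection I m).hom (1 : gammaRing I (m + 1)) = (1 : sigmaRing I m) :=
    map_one (gammaToSigma I m)
  rw [h1]
  obtain ⟨g, hg⟩ := exists_hom_apply_one (R := sigmaRing I m) (X := Y) y
  exact ⟨g, hg, fun g' hg' => hom_ext_one (hg'.trans hg.symm)⟩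

/-- The kernel of `Γ → Σ`, which is the ideal `ΓfΓ`. -/
def sigmaKernel : ModuleCat.{u} (gammaRing I (m + 1)) :=
  ModuleCat.of _ (LinearMap.ker (sigmaProjection I m).hom)

/-- The inclusion of the kernel of `Γ → Σ`. -/
def sigmaKernelι :
    sigmaKernel I m ⟶ ModuleCat.of (gammaRing I (m + 1)) (gammaRing I (m + 1)) :=
  ModuleCat.ofHom (Submodule.subtype _)

lemma sigmaKernelι_comp : sigmaKernelι I m ≫ sigmaProjection I m = 0 := by
  ext x
  exact x.2

lemma sigmaKernel_shortExact :
    (ShortComplex.mk _ _ (sigmaKernelι_comp I m)).ShortExact where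
  exact := by
    rw [ShortComplex.moduleCat_exact_iff]
    exact fun x hx => ⟨⟨x, hx⟩, rfl⟩
  mono_f := (ModuleCat.mono_iff_injective _).2 Subtype.val_injective
  epi_g := (ModuleCat.epi_iff_surjective _).2 (gammaToSigma_surjective I m)

lemma mem_of_sigmaKernel (x : sigmaKernel I m) (a b : Fin (m + 1)) (ha : a < Fin.last m) :
    x.1.1 a b ∈ I :=
  (gammaToSigma_eq_zero_iff I m).1 x.2 a b ha

/-- The `b`-th column of an element of `ΓfΓ`, as an element of `Γ f`. -/
def sigmaKernelColumn (b : Fin (m + 1)) : sigmaKernel I m ⟶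
    ModuleCat.of (gammaRing I (m + 1)) (cornerIdeal (diagonalHom I (Fin.last m))) :=
  ModuleCat.ofHom
    { toFun := fun x => ⟨⟨x.1.1 * Matrix.single b (Fin.last m) 1, fun c d hcd => by
        by_cases hd : d = Fin.last m
        · subst hd
          rw [Matrix.mul_single_apply_same, mul_one]
          exact mem_of_sigmaKernel I m x c b hcd
        · rw [Matrix.mul_single_apply_of_ne _ _ _ _ _ hd]
          exact I.zero_mem⟩, Subtype.ext (by
        change x.1.1 * Matrix.single b (Fin.last m) 1 *
          Matrix.single (Fin.last m) (Fin.last m) 1 = _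
        rw [mul_assoc, Matrix.single_mul_single_same, mul_one])⟩
      map_add' := fun x y => Subtype.ext (Subtype.ext (add_mul _ _ _))
      map_smul' := fun γ x => Subtype.ext (Subtype.ext (mul_assoc _ _ _)) }

/-- The element of `ΓfΓ` with a given `b`-th column in `Γ f`. -/
def ofSigmaKernelColumn (b : Fin (m + 1)) :
    ModuleCat.of (gammaRing I (m + 1)) (cornerIdeal (diagonalHom I (Fin.last m))) ⟶
      sigmaKernel I m :=
  ModuleCat.ofHom
    { toFun := fun x => ⟨x.1 * rowSingle I m b 1, by
        refine (gammaToSigma_eq_zero_iff I m).2 fun c d hc => ?_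
        have h : (x.1 * rowSingle I m b 1).1 = x.1.1 * Matrix.single (Fin.last m) b 1 := rfl
        rw [h]
        by_cases hd : d = b
        · subst hd
          rw [Matrix.mul_single_apply_same, mul_one]
          exact x.1.2 _ _ hc
        · rw [Matrix.mul_single_apply_of_ne _ _ _ _ _ hd]
          exact I.zero_mem⟩
      map_add' := fun x y => Subtype.ext (add_mul _ _ _)
      map_smul' := fun γ x => Subtype.ext (mul_assoc _ _ _) }

lemma sum_sigmaKernelColumn (x : sigmaKernel I m) :
    ∑ b, ((sigmaKernelColumn I m b).hom x).1 * rowSingle I m b 1 = x.1 := by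
  apply Subtype.ext
  rw [AddSubmonoidClass.coe_finsetSum]
  have h (b : Fin (m + 1)) : (((sigmaKernelColumn I m b).hom x).1 * rowSingle I m b 1).1 =
      x.1.1 * Matrix.single b b 1 := by
    change x.1.1 * Matrix.single b (Fin.last m) 1 * Matrix.single (Fin.last m) b 1 = _
    rw [mul_assoc, Matrix.single_mul_single_same, mul_one]
  simp_rw [h]
  rw [← Finset.mul_sum, Matrix.sum_single_one, mul_one]

/-- The left module `ΓfΓ` is a summand of a sum of copies of the projective module `Γ f`. -/
lemma sum_sigmaKernelColumn_comp :
    ∑ b, sigmaKernelColumn I m b ≫ ofSigmaKernelColumn I m b = 𝟙 _ := by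
  ext x
  rw [ModuleCat.hom_sum, LinearMap.sum_apply]
  refine Subtype.ext (Eq.trans ?_ (sum_sigmaKernelColumn I m x))
  exact map_sum (Submodule.subtype _) _ _

lemma isZero_functorE_functorI (X : ModuleCat.{u} (sigmaRing I m)) :
    IsZero ((functorE I m).obj ((functorI I m).obj X)) := by
  refine @ModuleCat.isZero_of_subsingleton _ _ _ ⟨fun x y => ?_⟩
  have h0 : gammaToSigma I m (diagonalHom I (Fin.last m) 1) = 0 := by
    refine (gammaToSigma_eq_zero_iff I m).2 fun a b ha => ?_
    change Matrix.single _ _ _ _ _ ∈ I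
    rw [Matrix.single_apply_of_row_ne ha.ne']
    exact I.zero_mem
  have h (x : (functorE I m).obj ((functorI I m).obj X)) : x.1 = 0 := by
    refine x.2.symm.trans ?_
    change (gammaToSigma I m (diagonalHom I (Fin.last m) 1)) • (show X from x.1) = 0
    rw [h0, zero_smul]
  exact Subtype.ext ((h x).trans (h y).symm)

/-- A `Γ`-module annihilated by `f` is annihilated by `ΓfΓ`, so it is a module over `Σ`. -/
lemma essImage_functorI_iff (X : ModuleCat.{u} (gammaRing I (m + 1))) :
    (functorI I m).essImage X ↔ IsZero ((functorE I m).obj X) := by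
  refine ⟨fun ⟨Y, ⟨f⟩⟩ => (isZero_functorE_functorI I m Y).of_iso ((functorE I m).mapIso f.symm),
    fun hX => ?_⟩
  have h0 (x : X) (b : Fin (m + 1)) : rowSingle I m b 1 • x = 0 := by
    have hx : diagonalHom I (Fin.last m) 1 • rowSingle I m b 1 • x = rowSingle I m b 1 • x := by
      rw [smul_smul, diagonalHom_mul_rowSingle]
    exact congrArg Subtype.val ((ModuleCat.subsingleton_of_isZero hX).elim
      (⟨_, hx⟩ : (functorE I m).obj X) 0)
  have hK (γ : gammaRing I (m + 1)) (hγ : gammaToSigma I m γ = 0) (x : X) : γ • x = 0 := by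
    have h1 := sum_sigmaKernelColumn I m ⟨γ, hγ⟩
    change _ = γ at h1
    rw [← h1, Finset.sum_smul]
    exact Finset.sum_eq_zero fun b _ => by rw [mul_smul, h0, smul_zero]
  let α : sigmaRing I m →+* AddMonoid.End X :=
    (gammaToSigma I m).liftOfSurjective (gammaToSigma_surjective I m)
      ⟨Module.toAddMonoidEnd (gammaRing I (m + 1)) X, fun γ hγ => by
        ext x
        exact hK γ hγ x⟩
  have hα (γ : gammaRing I (m + 1)) (x : X) : α (gammaToSigma I m γ) x = γ • x :=
    congrArg (fun f : AddMonoid.End X => f x)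
      ((gammaToSigma I m).liftOfRightInverse_comp_apply _ _ _ γ)
  let inst : Module (sigmaRing I m) X := Module.compHom X α
  let f : (functorI I m).obj (ModuleCat.of (sigmaRing I m) X) ≃ₗ[gammaRing I (m + 1)] X :=
    { toFun := fun x => x
      invFun := fun x => x
      map_add' := fun _ _ => rfl
      map_smul' := fun γ x => hα γ x
      left_inv := fun _ => rfl
      right_inv := fun _ => rfl }
  exact ⟨ModuleCat.of (sigmaRing I m) X, ⟨f.toModuleIso⟩⟩

end ModuleRecollement

/-! ### The recollement of module categories -/

section Existence

variable {Λ : Type u} [Ring Λ] (I : TwoSidedIdeal Λ) (m : ℕ)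

/-- The recollement of module categories. -/
theorem nonempty_recollement : Nonempty (Recollement (functorI I m) (functorE I m)) := by
  have h₁ := isUniversalArrow_sigmaProjection I m
  obtain ⟨θ, h₂⟩ := exists_isUniversalArrow_cornerFunctor (diagonalHom I (Fin.last m))
  have := isRightAdjoint_of_isUniversalArrow_ring h₁
  have := isLeftAdjoint_of_isUniversalArrow_ring h₁
  have := isRightAdjoint_of_isUniversalArrow_ring h₂
  obtain ⟨_, _⟩ := columnFunctor_full_faithful I m
  let adjl := Adjunction.ofIsRightAdjoint (functorE I m)
  have ffl : (functorE I m).leftAdjoint.FullyFaithful :=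
    (Adjunction.Triple.mk adjl (cornerColumnAdjunction I m)).fullyFaithfulEquiv.symm
      (.ofFullyFaithful (columnFunctor I (m + 1)))
  exact ⟨{
    q := (functorI I m).leftAdjoint
    p := (functorI I m).rightAdjoint
    l := (functorE I m).leftAdjoint
    r := columnFunctor I (m + 1)
    adj_q_i := Adjunction.ofIsRightAdjoint _
    adj_i_p := Adjunction.ofIsLeftAdjoint _
    adj_l_e := adjl
    adj_e_r := cornerColumnAdjunction I m
    full_i := inferInstance
    faithful_i := inferInstance
    full_l := ffl.full
    faithful_l := ffl.faithful
    full_r := inferInstance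
    faithful_r := inferInstance
    image_eq_kernel := essImage_functorI_iff I m }⟩

lemma isLeftAdjoint_firstCorner :
    (cornerFunctor (diagonalHom I (0 : Fin (m + 1)))).IsLeftAdjoint := by
  obtain ⟨θ, h⟩ := exists_isUniversalArrow_cornerFunctor (diagonalHom I (0 : Fin (m + 1)))
  exact isLeftAdjoint_of_isUniversalArrow_ring h

/-! ### The first row -/

/-- The left ideal of possible entries in the `b`-th column of the first row. -/
def rowIdeal (b : Fin (m + 1)) : Submodule Λ Λ where
  carrier := {x | 0 < b → x ∈ I}
  zero_mem' _ := I.zero_mem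
  add_mem' hx hy h := I.add_mem (hx h) (hy h)
  smul_mem' c _ hx h := I.mul_mem_left c _ (hx h)

/-- The `Λ`-module `f₀ Γ`, which is the first row of `Γ`. -/
abbrev firstRow : ModuleCat.{u} Λ :=
  (cornerFunctor (diagonalHom I (0 : Fin (m + 1)))).obj
    (ModuleCat.of (gammaRing I (m + 1)) (gammaRing I (m + 1)))

/-- An entry of the first row. -/
def firstRowEntry (b : Fin (m + 1)) : firstRow I m ⟶ ModuleCat.of Λ (rowIdeal I m b) :=
  ModuleCat.ofHom
    (X := cornerSubgroup (diagonalHom I (0 : Fin (m + 1))) (gammaRing I (m + 1)))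
    { toFun := fun γ => ⟨γ.1.1 0 b, γ.1.2 0 b⟩
      map_add' := fun _ _ => rfl
      map_smul' := fun _ _ => Subtype.ext (Matrix.single_mul_apply_same _ _ _ _ _) }

/-- The element of the first row with a given entry. -/
def ofFirstRowEntry (b : Fin (m + 1)) : ModuleCat.of Λ (rowIdeal I m b) ⟶ firstRow I m :=
  ModuleCat.ofHom
    (Y := cornerSubgroup (diagonalHom I (0 : Fin (m + 1))) (gammaRing I (m + 1)))
    { toFun := fun x => ⟨gammaSingle I 0 b x.1 x.2, Subtype.ext
        ((Matrix.single_mul_single_same _ _ _ _ _).trans (by rw [one_mul]; rfl))⟩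
      map_add' := fun x y => Subtype.ext (Subtype.ext (Matrix.single_add _ _ _ _))
      map_smul' := fun c x => Subtype.ext (Subtype.ext
        (Matrix.single_mul_single_same _ _ _ _ _).symm) }

lemma ofFirstRowEntry_comp (b : Fin (m + 1)) :
    ofFirstRowEntry I m b ≫ firstRowEntry I m b = 𝟙 _ := by
  refine ModuleCat.hom_ext (LinearMap.ext fun x : rowIdeal I m b => Subtype.ext ?_)
  exact Matrix.single_apply_same 0 b x.1

lemma sum_firstRowEntry_comp :
    ∑ b, firstRowEntry I m b ≫ ofFirstRowEntry I m b = 𝟙 (firstRow I m) := by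
  ext γ
  rw [ModuleCat.hom_sum, LinearMap.sum_apply]
  refine Subtype.ext ((map_sum (AddSubgroup.subtype (cornerSubgroup
    (diagonalHom I (0 : Fin (m + 1))) (gammaRing I (m + 1)))) _ _).trans ?_)
  have h (γ : gammaRing I (m + 1)) (hγ : diagonalHom I 0 1 * γ = γ) :
      ∑ b, gammaSingle I 0 b (γ.1 0 b) (γ.2 0 b) = γ := by
    conv_rhs => rw [← hγ]
    refine Eq.trans ?_ (gammaSingle_mul I γ 0 0 1 (fun h => absurd h (lt_irrefl _))
      fun a ha => by rw [one_mul]; exact γ.2 _ _ ha).symm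
    simp only [one_mul]
  exact h γ.1 γ.2

/-- The first entry of the first row is arbitrary. -/
def rowIdealZeroEquiv : rowIdeal I m 0 ≃ₗ[Λ] Λ where
  toFun x := x.1
  invFun x := ⟨x, fun h => absurd h (lt_irrefl _)⟩
  map_add' _ _ := rfl
  map_smul' _ _ := rfl
  left_inv _ := rfl
  right_inv _ := rfl

/-- The other entries of the first row belong to `I`. -/
def rowIdealEquiv {m : ℕ} {b : Fin (m + 1)} (hb : 0 < b) : rowIdeal I m b ≃ₗ[Λ] I where
  toFun x := ⟨x.1, x.2 hb⟩
  invFun x := ⟨x.1, fun _ => x.2⟩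
  map_add' _ _ := rfl
  map_smul' _ _ := rfl
  left_inv _ := rfl
  right_inv _ := rfl

/-- The first row is the sum of `Λ` and copies of `I`. -/
lemma firstRow_finite_projective (h : Module.Finite Λ I) (h' : Module.Projective Λ I) :
    Module.Finite Λ (firstRow I m) ∧ Module.Projective Λ (firstRow I m) := by
  have hb (b : Fin (m + 1)) :
      Module.Finite Λ (rowIdeal I m b) ∧ Module.Projective Λ (rowIdeal I m b) := by
    rcases eq_or_ne b 0 with rfl | hb
    · exact ⟨Module.Finite.equiv (rowIdealZeroEquiv I m).symm,
        Module.Projective.of_equiv (rowIdealZeroEquiv I m).symm⟩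
    · exact ⟨Module.Finite.equiv (rowIdealEquiv I (Fin.pos_of_ne_zero hb)).symm,
        Module.Projective.of_equiv (rowIdealEquiv I (Fin.pos_of_ne_zero hb)).symm⟩
  have h₁ (b : Fin (m + 1)) := (hb b).1
  have h₂ (b : Fin (m + 1)) := (hb b).2
  let i : firstRow I m →ₗ[Λ] ∀ b, rowIdeal I m b := LinearMap.pi fun b => (firstRowEntry I m b).hom
  let p : (∀ b, rowIdeal I m b) →ₗ[Λ] firstRow I m :=
    ∑ b, (ofFirstRowEntry I m b).hom ∘ₗ LinearMap.proj b
  have hp : p ∘ₗ i = LinearMap.id := by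
    have h := congrArg ModuleCat.Hom.hom (sum_firstRowEntry_comp I m)
    rw [ModuleCat.hom_sum] at h
    refine Eq.trans (LinearMap.ext fun x => ?_) h
    simp [p, i]
  have : Module.Projective Λ (∀ b, rowIdeal I m b) :=
    Module.Projective.of_equiv (DirectSum.linearEquivFunOnFintype Λ _ _)
  exact ⟨Module.Finite.of_surjective p fun x => ⟨i x, LinearMap.congr_fun hp x⟩,
    Module.Projective.of_split i p hp⟩

lemma projective_of_firstRow (hm : 1 ≤ m) (h : Module.Projective Λ (firstRow I m)) :
    Module.Projective Λ I := by
  have hb : 0 < Fin.last m := Fin.lt_def.2 hm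
  have : Module.Projective Λ (rowIdeal I m (Fin.last m)) :=
    Module.Projective.of_split (ofFirstRowEntry I m (Fin.last m)).hom
      (firstRowEntry I m (Fin.last m)).hom
      (congrArg ModuleCat.Hom.hom (ofFirstRowEntry_comp I m (Fin.last m)))
  exact Module.Projective.of_equiv (rowIdealEquiv I hb)

section Compact

variable [HasDerivedCategory.{w} (ModuleCat.{u} Λ)]

lemma IsCompactModule.of_iso {R : Type u} [Ring R] [HasDerivedCategory.{w} (ModuleCat.{u} R)]
    {M N : ModuleCat.{u} R} (h : IsCompactModule M) (f : M ≅ N) : IsCompactModule N :=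
  IsCompactModule.of_sum (fun _ : Unit => M) (fun _ => h) (fun _ => f.inv) (fun _ => f.hom)
    (by simp)

lemma isCompactModule_firstRow (h : IsCompactModule (ModuleCat.of Λ I)) :
    IsCompactModule (firstRow I m) := by
  refine IsCompactModule.of_sum _ (fun b => ?_) _ _ (sum_firstRowEntry_comp I m)
  rcases eq_or_ne b 0 with rfl | hb
  · exact (isCompactModule_self Λ).of_iso (rowIdealZeroEquiv I m).symm.toModuleIso
  · exact h.of_iso (rowIdealEquiv I (Fin.pos_of_ne_zero hb)).symm.toModuleIso

lemma isCompactModule_of_firstRow (hm : 1 ≤ m) (h : IsCompactModule (firstRow I m)) :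
    IsCompactModule (ModuleCat.of Λ I) := by
  have hb : 0 < Fin.last m := Fin.lt_def.2 hm
  have h1 : IsCompactModule (ModuleCat.of Λ (rowIdeal I m (Fin.last m))) :=
    IsCompactModule.of_sum (fun _ : Unit => firstRow I m) (fun _ => h)
      (fun _ => ofFirstRowEntry I m (Fin.last m)) (fun _ => firstRowEntry I m (Fin.last m))
      (by simp [ofFirstRowEntry_comp])
  exact h1.of_iso (rowIdealEquiv I hb).toModuleIso

variable [HasDerivedCategory.{w} (ModuleCat.{u} (gammaRing I (m + 1)))]

/-- The column of the regular module is the finitely generated projective module `Γ f₀`, because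
both are values of left adjoints of `f₀(-)`. -/
lemma isCompactModule_column :
    IsCompactModule ((columnFunctor I (m + 1)).obj (ModuleCat.of Λ Λ)) := by
  obtain ⟨θ, h⟩ := exists_isUniversalArrow_cornerFunctor (diagonalHom I (0 : Fin (m + 1)))
  obtain ⟨f, -⟩ := h.nonempty_iso (isUniversalArrow_unit (columnCornerAdjunction I m) _)
  have := isCompactModule_of_projective (ModuleCat.of (gammaRing I (m + 1))
    (cornerIdeal (diagonalHom I (0 : Fin (m + 1)))))
  exact this.of_iso f

end Compact

/-! ### The recollement of derived categories -/

section Derived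

variable [HasDerivedCategory.{w} (ModuleCat.{u} (sigmaRing I m))]
  [HasDerivedCategory.{w} (ModuleCat.{u} (gammaRing I (m + 1)))]
  [HasDerivedCategory.{w} (ModuleCat.{u} Λ)]

theorem nonempty_triangulatedRecollement :
    Nonempty (TriangulatedRecollement (functorI I m).mapDerivedCategory
      (functorE I m).mapDerivedCategory) := by
  obtain ⟨θ, hθ⟩ := exists_isUniversalArrow_cornerFunctor (diagonalHom I (Fin.last m))
  obtain ⟨_, _⟩ := columnFunctor_full_faithful I m
  have : Projective (ModuleCat.of (gammaRing I (m + 1))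
    (cornerIdeal (diagonalHom I (Fin.last m)))) := (IsProjective.iff_projective _).1 inferInstance
  exact nonempty_triangulatedRecollement_mapDerivedCategory
    (isUniversalArrow_sigmaProjection I m) hθ (sigmaKernel_shortExact I m) _ _
    (sum_sigmaKernelColumn_comp I m) (isZero_functorE_functorI I m) (cornerColumnAdjunction I m)

theorem isHomologicalEmbedding_functorI : IsHomologicalEmbedding (functorI I m) := by
  obtain ⟨R⟩ := nonempty_triangulatedRecollement I m
  have := R.full_i
  have := R.faithful_i
  exact isHomologicalEmbedding_of_fullyFaithful _

/-- The compactness of the first row, hence of `I`, decides about ladders of height four. -/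
theorem hasDownwardLadder_iff (hm : 1 ≤ m) :
    HasDownwardLadder 4 (functorI I m).mapDerivedCategory (functorE I m).mapDerivedCategory ↔
      IsCompactModule (ModuleCat.of Λ I) := by
  refine ⟨fun h => isCompactModule_of_firstRow I m hm (isCompactModule_of_hasDownwardLadder h
    (cornerColumnAdjunction I m) (columnCornerAdjunction I m)), fun h => ?_⟩
  obtain ⟨R⟩ := nonempty_triangulatedRecollement I m
  exact hasDownwardLadder_mapDerivedCategory R (cornerColumnAdjunction I m)
    (columnCornerAdjunction I m) (isCompactModule_column I m) (isCompactModule_firstRow I m h)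

end Derived

/-! ### The ladders to the right -/

section RightHeight

variable {I m} (R : Recollement (functorI I m) (functorE I m))

/-- The right adjoint of the column functor is `f₀(-)`. -/
def Recollement.adjunction : R.r ⊣ cornerFunctor (diagonalHom I (0 : Fin (m + 1))) :=
  (columnCornerAdjunction I m).ofNatIsoLeft
    ((cornerColumnAdjunction I m).rightAdjointUniq R.adj_e_r)

lemma Recollement.rHeightAtLeast_three : R.RHeightAtLeast 3 :=
  have := isLeftAdjoint_firstCorner I m
  ⟨_, ⟨R.adjunction⟩, _, ⟨Adjunction.ofIsLeftAdjoint _⟩, trivial⟩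

lemma Recollement.rHeightAtLeast_four (h : Module.Finite Λ I) (h' : Module.Projective Λ I) :
    R.RHeightAtLeast 4 := by
  have := isLeftAdjoint_firstCorner I m
  obtain ⟨_, _⟩ := firstRow_finite_projective I m h h'
  let adj := Adjunction.ofIsLeftAdjoint (cornerFunctor (diagonalHom I (0 : Fin (m + 1))))
  have := adj.right_adjoint_additive
  have := isLeftAdjoint_of_finite_of_projective adj
  exact ⟨_, ⟨R.adjunction⟩, _, ⟨adj⟩, _, ⟨Adjunction.ofIsLeftAdjoint _⟩, trivial⟩

/-- If the right adjoint of `f₀(-)` has a right adjoint, then `f₀(-)` preserves projective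
modules. -/
lemma Recollement.projective_of_rHeightAtLeast_four (hm : 1 ≤ m) (h : R.RHeightAtLeast 4) :
    Module.Projective Λ I := by
  obtain ⟨r₁, ⟨a₁⟩, r₂, ⟨a₂⟩, r₃, ⟨a₃⟩, -⟩ := h
  have adj : cornerFunctor (diagonalHom I (0 : Fin (m + 1))) ⊣ r₂ :=
    a₂.ofNatIsoLeft (a₁.rightAdjointUniq R.adjunction)
  have : r₂.IsLeftAdjoint := a₃.isLeftAdjoint
  have hp : Projective (firstRow I m) := adj.map_projective _ inferInstance
  exact projective_of_firstRow I m hm ((IsProjective.iff_projective _).2 hp)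

end RightHeight

end Existence

/-! ### Left adjoints of the left adjoint of a corner functor -/

section CornerDual

variable {Λ Γ : Type u} [Ring Λ] [Ring Γ] (φ : Λ →ₙ+* Γ)

/-- The left `Λ`-module of right `Λ`-linear maps from `Γ f` to `Λ`, where `f = φ 1`. They are
encoded as the additive maps `ψ` on `Γ` such that `ψ (x φ(c)) = ψ(x) c`; in particular
`ψ (x f) = ψ x`. -/
def cornerDual : Submodule Λ (Γ →+ Λ) where
  carrier := {ψ | ∀ x c, ψ (x * φ c) = ψ x * c}
  zero_mem' x c := (zero_mul c).symm
  add_mem' {ψ ψ'} h h' x c := by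
    rw [AddMonoidHom.add_apply, AddMonoidHom.add_apply, h x c, h' x c, add_mul]
  smul_mem' d ψ h x c := by
    change d * ψ (x * φ c) = d * ψ x * c
    rw [h x c, mul_assoc]

/-- A finite dual basis of the right `Λ`-module `Γ f`. -/
def HasDualBasis : Prop :=
  ∃ (n : ℕ) (t : Fin n → Γ) (ψ : Fin n → cornerDual φ), ∀ x, ∑ b, t b * φ ((ψ b).1 x) = x * φ 1

variable {φ}

lemma cornerDual_apply_mul (ψ : cornerDual φ) (x : Γ) (c : Λ) : ψ.1 (x * φ c) = ψ.1 x * c :=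
  ψ.2 x c

lemma cornerDual_apply_mul_map_one (ψ : cornerDual φ) (x : Γ) : ψ.1 (x * φ 1) = ψ.1 x := by
  rw [ψ.2, mul_one]

/-- The right action of `Γ` on the dual of `Γ f`. -/
def cornerDualMul (γ : Γ) : cornerDual φ →ₗ[Λ] cornerDual φ where
  toFun ψ := ⟨ψ.1.comp (AddMonoidHom.mulLeft γ), fun x c => by
    change ψ.1 (γ * (x * φ c)) = ψ.1 (γ * x) * c
    rw [← mul_assoc, ψ.2]⟩
  map_add' _ _ := rfl
  map_smul' _ _ := rfl

lemma cornerDualMul_apply (γ : Γ) (ψ : cornerDual φ) (x : Γ) :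
    (cornerDualMul γ ψ).1 x = ψ.1 (γ * x) := rfl

variable (φ) in
/-- The `Γ`-module of `Λ`-linear maps from the dual of `Γ f` to `Y`. -/
def CoinducedModule (Y : Type u) [AddCommGroup Y] [Module Λ Y] : Type u := cornerDual φ →ₗ[Λ] Y

instance (Y : Type u) [AddCommGroup Y] [Module Λ Y] : AddCommGroup (CoinducedModule φ Y) :=
  inferInstanceAs (AddCommGroup (cornerDual φ →ₗ[Λ] Y))

/-- The underlying linear map. -/
def CoinducedModule.toLinearMap {Y : Type u} [AddCommGroup Y] [Module Λ Y] :
    CoinducedModule φ Y →+ (cornerDual φ →ₗ[Λ] Y) := AddMonoidHom.id _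

instance (Y : Type u) [AddCommGroup Y] [Module Λ Y] : Module Γ (CoinducedModule φ Y) where
  smul γ h := LinearMap.comp h (cornerDualMul γ)
  one_smul h := LinearMap.ext fun ψ => congrArg h.toFun (Subtype.ext (AddMonoidHom.ext fun x =>
    congrArg ψ.1 (one_mul x)))
  mul_smul γ γ' h := LinearMap.ext fun ψ => congrArg h.toFun (Subtype.ext
    (AddMonoidHom.ext fun x => congrArg ψ.1 (mul_assoc γ γ' x)))
  smul_zero _ := rfl
  smul_add _ _ _ := rfl
  add_smul γ γ' h := LinearMap.ext fun ψ => by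
    refine (congrArg h.toFun ?_).trans (map_add (show cornerDual φ →ₗ[Λ] Y from h) _ _)
    exact Subtype.ext (AddMonoidHom.ext fun x =>
      (congrArg ψ.1 (add_mul γ γ' x)).trans (map_add ψ.1 _ _))
  zero_smul h := LinearMap.ext fun ψ => by
    refine (congrArg h.toFun ?_).trans (map_zero (show cornerDual φ →ₗ[Λ] Y from h))
    exact Subtype.ext (AddMonoidHom.ext fun x =>
      (congrArg ψ.1 (zero_mul x)).trans (map_zero ψ.1))

variable (φ) in
/-- The functor `Y ↦ Hom_Λ (Hom_Λ (Γ f, Λ), Y)`. -/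
def coinducedFunctor : ModuleCat.{u} Λ ⥤ ModuleCat.{u} Γ where
  obj Y := ModuleCat.of Γ (CoinducedModule φ Y)
  map g := ModuleCat.ofHom
    { toFun := fun h => LinearMap.comp g.hom h
      map_add' := fun h h' => LinearMap.ext fun ψ => map_add g.hom _ _
      map_smul' := fun _ _ => rfl }

variable (φ) in
/-- The coinduced functor has a left adjoint since the identity is a universal element. -/
lemma isRightAdjoint_coinducedFunctor : (coinducedFunctor φ).IsRightAdjoint := by
  let P := ModuleCat.of Λ (cornerDual φ)
  let u : (coinducedFunctor φ).obj P := (LinearMap.id : cornerDual φ →ₗ[Λ] cornerDual φ)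
  obtain ⟨η, hη⟩ := exists_hom_apply_one u
  refine isRightAdjoint_of_isUniversalArrow_ring (η := η)
    (isUniversalArrow_ring_iff.2 fun Y h => ?_)
  rw [hη]
  exact ⟨ModuleCat.ofHom h, rfl, fun g hg => ModuleCat.hom_ext hg⟩

/-- Evaluation as a map to the coinduced module. -/
def toCoinduced (Y : ModuleCat.{u} Λ) :
    Y ⟶ (cornerFunctor φ).obj ((coinducedFunctor φ).obj Y) :=
  ModuleCat.ofHom (Y := cornerSubgroup φ (CoinducedModule φ Y))
    { toFun := fun y => ⟨(show cornerDual φ →ₗ[Λ] Y from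
        { toFun := fun ψ => ψ.1 (φ 1) • y
          map_add' := fun ψ ψ' => add_smul _ _ _
          map_smul' := fun c ψ => mul_smul c (ψ.1 (φ 1)) y }), LinearMap.ext fun ψ => by
        change ψ.1 (φ 1 * φ 1) • y = ψ.1 (φ 1) • y
        rw [map_one_mul_map_one]⟩
      map_add' := fun y y' => Subtype.ext (LinearMap.ext fun ψ => smul_add _ _ _)
      map_smul' := fun c y => Subtype.ext (LinearMap.ext fun ψ => by
        change ψ.1 (φ 1) • c • y = ψ.1 (φ c * φ 1) • y
        rw [smul_smul, ← ψ.2, ← map_mul, ← map_mul, one_mul, mul_one]) }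

variable {n : ℕ} {t : Fin n → Γ} {ψ : Fin n → cornerDual φ}

lemma cornerDualMul_eq_sum (h : ∀ x, ∑ b, t b * φ ((ψ b).1 x) = x * φ 1) (γ : Γ)
    (χ : cornerDual φ) : cornerDualMul γ χ = ∑ b, χ.1 (γ * t b) • ψ b := by
  refine Subtype.ext (AddMonoidHom.ext fun x => ?_)
  rw [cornerDualMul_apply, ← cornerDual_apply_mul_map_one, mul_assoc, ← h, Finset.mul_sum, map_sum]
  simp_rw [← mul_assoc, cornerDual_apply_mul]
  simp

/-- The counit of the adjunction between the coinduced functor and the corner functor, defined by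
a dual basis. -/
def ofCoinduced (h : ∀ x, ∑ b, t b * φ ((ψ b).1 x) = x * φ 1) (M : ModuleCat.{u} Γ) :
    (coinducedFunctor φ).obj ((cornerFunctor φ).obj M) ⟶ M :=
  ModuleCat.ofHom (X := CoinducedModule φ ((cornerFunctor φ).obj M))
    { toFun := fun k => ∑ b, t b • (k.toLinearMap (ψ b)).1
      map_add' := fun k k' => by
        rw [← Finset.sum_add_distrib]
        exact Finset.sum_congr rfl fun b _ => smul_add _ _ _
      map_smul' := fun γ k => by
        have h1 (b : Fin n) : ((γ • k).toLinearMap (ψ b)).1 =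
            ∑ j, φ ((ψ b).1 (γ * t j)) • (k.toLinearMap (ψ j)).1 := by
          change (k.toLinearMap (cornerDualMul γ (ψ b))).1 = _
          rw [cornerDualMul_eq_sum h, map_sum]
          refine (map_sum (AddSubgroup.subtype (cornerSubgroup φ M)) _ _).trans ?_
          exact Finset.sum_congr rfl fun j _ =>
            congrArg Subtype.val (map_smul k.toLinearMap _ _)
        simp_rw [h1, Finset.smul_sum]
        rw [Finset.sum_comm]
        refine Finset.sum_congr rfl fun j _ => ?_
        simp_rw [smul_smul]
        rw [← Finset.sum_smul, h, mul_smul]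
        exact congrArg _ (k.toLinearMap (ψ j)).2 }

/-- A dual basis provides a left adjoint of the corner functor. -/
def coinducedAdjunction (h : ∀ x, ∑ b, t b * φ ((ψ b).1 x) = x * φ 1) :
    coinducedFunctor φ ⊣ cornerFunctor φ :=
  Adjunction.mkOfUnitCounit
    { unit :=
        { app := toCoinduced
          naturality := fun Y Y' g => by
            ext y
            exact Subtype.ext (LinearMap.ext fun χ => (map_smul g.hom _ _).symm) }
      counit :=
        { app := ofCoinduced h
          naturality := fun M N g => by
            refine ModuleCat.hom_ext (LinearMap.ext fun k : CoinducedModule φ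
              ((cornerFunctor φ).obj M) => ?_)
            change ∑ b, t b • g.hom (k.toLinearMap (ψ b)).1 =
              g.hom (∑ b, t b • (k.toLinearMap (ψ b)).1)
            rw [map_sum]
            exact Finset.sum_congr rfl fun b _ => (map_smul g.hom _ _).symm }
      left_triangle := by
        ext Y k
        have h1 (k : CoinducedModule φ Y) : ∑ b, t b •
            (((toCoinduced Y).hom (k.toLinearMap (ψ b))).1 : CoinducedModule φ Y) = k := by
          refine LinearMap.ext fun χ => ?_
          have h2 : cornerDualMul 1 χ = χ :=
            Subtype.ext (AddMonoidHom.ext fun x => congrArg χ.1 (one_mul x))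
          refine (LinearMap.congr_fun (map_sum CoinducedModule.toLinearMap _ _) χ).trans ?_
          refine (LinearMap.sum_apply _ _ _).trans ?_
          change _ = k.toLinearMap χ
          conv_rhs => rw [← h2, cornerDualMul_eq_sum h, map_sum]
          refine Finset.sum_congr rfl fun b _ => ?_
          rw [map_smul, one_mul, ← cornerDual_apply_mul_map_one]
          rfl
        exact h1 k
      right_triangle := by
        ext M x
        refine Subtype.ext ?_
        have h1 (x : cornerSubgroup φ M) : ∑ b, t b • φ ((ψ b).1 (φ 1)) • x.1 = x.1 := by
          simp_rw [smul_smul]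
          rw [← Finset.sum_smul, h, map_one_mul_map_one]
          exact x.2
        exact h1 x }

lemma HasDualBasis.isRightAdjoint (h : HasDualBasis φ) {l : ModuleCat.{u} Λ ⥤ ModuleCat.{u} Γ}
    (adj : l ⊣ cornerFunctor φ) : l.IsRightAdjoint := by
  obtain ⟨n, t, ψ, h⟩ := h
  have := isRightAdjoint_coinducedFunctor φ
  exact Functor.isRightAdjoint_of_iso ((coinducedAdjunction h).leftAdjointUniq adj)

/-- If the left adjoint `l` of the functor `f(-)` has a left adjoint, then the right `Λ`-module `Γ
f` has a dual basis. It is read off from a universal element `u` of `l(P)`, which is a combination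
of the values of the unit: for `x` in `Γ`, the element `x • η(1)` of `l(Λ)`, where `η` is the unit,
is the image of `u` under a unique map `P ⟶ Λ`. -/
lemma hasDualBasis_of_isRightAdjoint {l : ModuleCat.{u} Λ ⥤ ModuleCat.{u} Γ}
    (adj : l ⊣ cornerFunctor φ) [l.IsRightAdjoint] : HasDualBasis φ := by
  have : l.Additive := adj.left_adjoint_additive
  let η (Y : ModuleCat.{u} Λ) (y : Y) : l.obj Y := ((adj.unit.app Y).hom y).1
  have η_map {Y Y' : ModuleCat.{u} Λ} (g : Y ⟶ Y') (y : Y) :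
      (l.map g).hom (η Y y) = η Y' (g.hom y) :=
    congrArg (fun k => (k.hom y).1) (adj.unit.naturality g).symm
  have η_smul (Y : ModuleCat.{u} Λ) (c : Λ) (y : Y) : η Y (c • y) = φ c • η Y y :=
    congrArg Subtype.val (map_smul (adj.unit.app Y).hom c y)
  -- the values of the unit generate, since a quotient of `l.obj Y` in which they vanish is zero
  have hspan (Y : ModuleCat.{u} Λ) : Submodule.span Γ (Set.range (η Y)) = ⊤ := by
    let N := Submodule.span Γ (Set.range (η Y))
    let q : l.obj Y ⟶ ModuleCat.of Γ (l.obj Y ⧸ N) := ModuleCat.ofHom N.mkQ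
    have hq : q = 0 := by
      refine (adj.homEquiv _ _).injective ?_
      ext y
      rw [adj.homEquiv_unit, adj.homEquiv_unit]
      exact Subtype.ext ((Submodule.Quotient.mk_eq_zero N).2 (Submodule.subset_span ⟨y, rfl⟩))
    rw [eq_top_iff]
    intro x _
    exact (Submodule.Quotient.mk_eq_zero N).1 (congrArg (fun k => k.hom x) hq)
  obtain ⟨P, θ, hθ⟩ := exists_isUniversalArrow (F := l) (X := ModuleCat.of Γ Γ)
    (Functor.leftAdjointObjIsDefined_of_adjunction (Adjunction.ofIsRightAdjoint l) _)
  rw [isUniversalArrow_ring_iff] at hθ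
  generalize θ.hom (1 : Γ) = u at hθ
  obtain ⟨n, t, s, hu⟩ := Submodule.mem_span_set'.1 ((hspan P).ge (Submodule.mem_top (x := u)))
  choose p hp using fun b => (s b).2
  let Λ' := ModuleCat.of Λ Λ
  choose g hg hg' using fun x : Γ => hθ Λ' (x • η Λ' (1 : Λ))
  have g_add (x y : Γ) : g (x + y) = g x + g y := by
    refine (hg' _ _ ?_).symm
    change (l.map (g x + g y)).hom u = _
    rw [l.map_add, add_smul, ← hg, ← hg]
    rfl
  have g_mul (x : Γ) (c : Λ) (ρ : Λ' ⟶ Λ') (hρ : ρ.hom (1 : Λ) = c) :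
      g (x * φ c) = g x ≫ ρ := by
    refine (hg' _ _ ?_).symm
    change (l.map (g x ≫ ρ)).hom u = _
    rw [l.map_comp]
    refine (congrArg (l.map ρ).hom (hg x)).trans ?_
    rw [map_smul, η_map, hρ, mul_smul, ← η_smul]
    exact congrArg (fun d : Λ => x • η Λ' d) (mul_one c).symm
  refine ⟨n, t, fun b => ⟨
    { toFun := fun x => (g x).hom (p b)
      map_zero' := by
        have h0 : g 0 = 0 := by simpa using g_add 0 0
        rw [h0]
        rfl
      map_add' := fun x y => by
        rw [g_add]
        rfl }, fun x c => ?_⟩, fun x => ?_⟩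
  · obtain ⟨ρ, hρ⟩ := exists_hom_apply_one (R := Λ) (X := Λ') c
    change (g (x * φ c)).hom (p b) = (g x).hom (p b) * c
    rw [g_mul x c ρ hρ]
    have h1 : ρ.hom ((g x).hom (p b) • (1 : Λ)) = (g x).hom (p b) • c := by
      rw [map_smul, hρ]
    rw [smul_eq_mul, mul_one] at h1
    exact h1
  · obtain ⟨k, hk⟩ := exists_hom_apply_one (R := Λ)
      (X := (cornerFunctor φ).obj (ModuleCat.of Γ Γ)) ⟨φ 1, map_one_mul_map_one φ⟩
    -- `κ : l(Λ) ⟶ Γ` is the embedding of `Γ f` and maps `η(1)` to `f`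
    let κ := (adj.homEquiv _ _).symm k
    have hκ : κ.hom (η Λ' (1 : Λ)) = φ 1 := by
      have h1 : adj.homEquiv _ _ κ = k := (adj.homEquiv _ _).apply_symm_apply k
      rw [adj.homEquiv_unit] at h1
      exact congrArg Subtype.val ((congrArg (fun f => f.hom (1 : Λ)) h1).trans hk)
    have h1 : ∑ b, t b • φ ((g x).hom (p b)) • η Λ' (1 : Λ) = x • η Λ' (1 : Λ) := by
      rw [← hg x, ← hu, map_sum]
      refine Finset.sum_congr rfl fun b _ => ?_
      rw [map_smul, ← hp, η_map, ← η_smul]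
      exact congrArg (fun d : Λ => t b • η Λ' d) (mul_one _)
    have h2 := congrArg κ.hom h1
    rw [map_sum, map_smul, hκ] at h2
    refine Eq.trans (Finset.sum_congr rfl fun b _ => ?_) h2
    rw [map_smul, map_smul, hκ]
    change t b * φ ((g x).hom (p b)) = t b * (φ ((g x).hom (p b)) * φ 1)
    rw [← map_mul, mul_one]

end CornerDual

/-! ### Dual bases of the last column and the ladders to the left -/

section LeftHeight

variable {Λ : Type u} [Ring Λ] (I : TwoSidedIdeal Λ) (m : ℕ)

/-- The last column `Γ f` consists of the entry in `Λ` on the diagonal and of entries in `I`. -/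
lemma hasDualBasis_of_finite_of_projective (h : Module.Finite Λᵐᵒᵖ I)
    (h' : Module.Projective Λᵐᵒᵖ I) : HasDualBasis (diagonalHom I (Fin.last m)) := by
  obtain ⟨n, p, i, hpi⟩ := exists_dual_basis (ModuleCat.of Λᵐᵒᵖ I)
  let τ (b : Fin n) : I →+ Λ :=
    MulOpposite.opAddEquiv.symm.toAddMonoidHom.comp (p b).hom.toAddMonoidHom
  let s (b : Fin n) : I := (i b).hom (1 : Λᵐᵒᵖ)
  have hs (x : I) : ∑ b, (s b).1 * τ b x = x.1 := by
    have h1 := congrArg (fun k => k.hom x) hpi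
    rw [ModuleCat.hom_sum] at h1
    have h2 := congrArg (fun y : I => y.1) h1
    refine Eq.trans ?_ h2
    refine Eq.trans ?_ ((congrArg (fun y : I => y.1) (LinearMap.sum_apply _ _ _)).trans
      (map_sum (TwoSidedIdeal.coeAddMonoidHom I) _ _)).symm
    refine Finset.sum_congr rfl fun b _ => ?_
    have h3 : (i b).hom ((p b).hom x • (1 : Λᵐᵒᵖ)) = (p b).hom x • (s b) := map_smul _ _ _
    rw [smul_eq_mul, mul_one] at h3
    exact (congrArg Subtype.val h3).symm
  -- the entries in `I` of the last column
  let c (a : Fin m) : gammaRing I (m + 1) →+ I :=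
    { toFun := fun x => ⟨x.1 a.castSucc (Fin.last m), x.2 _ _ (Fin.castSucc_lt_last _)⟩
      map_zero' := rfl
      map_add' := fun _ _ => rfl }
  let e := Fintype.equivFin (Option (Fin m × Fin n))
  let t : Option (Fin m × Fin n) → gammaRing I (m + 1) := fun o => o.elim
    (diagonalHom I (Fin.last m) 1)
    fun ab => gammaSingle I ab.1.castSucc (Fin.last m) (s ab.2).1 fun _ => (s ab.2).2
  let ψ : Option (Fin m × Fin n) → cornerDual (diagonalHom I (Fin.last m)) := fun o => o.elim
    ⟨{ toFun := fun x => x.1 (Fin.last m) (Fin.last m)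
       map_zero' := rfl
       map_add' := fun _ _ => rfl }, fun x d =>
      Matrix.mul_single_apply_same d (Fin.last m) (Fin.last m) (Fin.last m) x.1⟩
    fun ab => ⟨(τ ab.2).comp (c ab.1), fun x d => by
      refine Eq.trans ?_ (congrArg MulOpposite.unop (map_smul (p ab.2).hom (MulOpposite.op d)
        (c ab.1 x)))
      exact congrArg (τ ab.2) (Subtype.ext (Matrix.mul_single_apply_same _ _ _ _ _))⟩
  have key (x : gammaRing I (m + 1)) : ∑ o, t o * diagonalHom I (Fin.last m) ((ψ o).1 x) =
      x * diagonalHom I (Fin.last m) 1 := by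
    have h1 : x * diagonalHom I (Fin.last m) 1 = ∑ a : Fin (m + 1),
        gammaSingle I a (Fin.last m) (x.1 a (Fin.last m)) (fun ha => x.2 _ _ ha) := by
      refine (mul_gammaSingle I x _ _ 1 lt_last_elim fun a ha => ?_).trans ?_
      · rw [mul_one]
        exact x.2 _ _ ha
      · simp only [mul_one]
    rw [h1, Fin.sum_univ_castSucc, Fintype.sum_option]
    refine (add_comm _ _).trans ?_
    rw [Fintype.sum_prod_type]
    refine congrArg₂ (· + ·) (Finset.sum_congr rfl fun a _ => ?_) ?_
    · apply Subtype.ext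
      rw [AddSubmonoidClass.coe_finsetSum]
      refine (Finset.sum_congr rfl fun b _ => Matrix.single_mul_single_same _ _ _ _ _).trans ?_
      refine Eq.trans ?_ (congrArg (Matrix.single a.castSucc (Fin.last m)) (hs (c a x)))
      exact (map_sum (Matrix.singleAddMonoidHom (α := Λ) a.castSucc (Fin.last m))
        (fun b => (s b).1 * τ b (c a x)) Finset.univ).symm
    · refine (map_mul _ _ _).symm.trans ?_
      rw [one_mul]
      rfl
  refine ⟨_, t ∘ e.symm, ψ ∘ e.symm, fun x => ?_⟩
  exact (e.symm.sum_comp fun o => t o * diagonalHom I (Fin.last m) ((ψ o).1 x)).trans (key x)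

variable {I m} in
/-- The entries in `I` of a dual basis of `Γ f` form a dual basis of `I`. -/
lemma HasDualBasis.projective (hm : 1 ≤ m) (h : HasDualBasis (diagonalHom I (Fin.last m))) :
    Module.Projective Λᵐᵒᵖ I := by
  obtain ⟨n, t, ψ, h⟩ := h
  have h0 : 0 < Fin.last m := Fin.lt_def.2 hm
  let E (x : I) : gammaRing I (m + 1) := gammaSingle I 0 (Fin.last m) x.1 fun _ => x.2
  have hE (x : I) (c : Λ) : E (MulOpposite.op c • x) = E x * diagonalHom I (Fin.last m) c :=
    Subtype.ext (Matrix.single_mul_single_same _ _ _ _ _).symm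
  let i : I →ₗ[Λᵐᵒᵖ] (Fin n → Λᵐᵒᵖ) :=
    { toFun := fun x b => MulOpposite.op ((ψ b).1 (E x))
      map_add' := fun x y => funext fun b => congrArg MulOpposite.op <| by
        refine Eq.trans (congrArg (ψ b).1 ?_) (map_add (ψ b).1 (E x) (E y))
        exact Subtype.ext (Matrix.single_add _ _ _ _)
      map_smul' := fun c x => funext fun b => congrArg MulOpposite.op <| by
        obtain ⟨c, rfl⟩ := MulOpposite.op_surjective c
        rw [hE, cornerDual_apply_mul]
        rfl }
  let p : (Fin n → Λᵐᵒᵖ) →ₗ[Λᵐᵒᵖ] I :=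
    { toFun := fun v => ⟨∑ b, (t b).1 0 (Fin.last m) * (v b).unop,
        sum_mem fun b _ => I.mul_mem_right _ _ ((t b).2 _ _ h0)⟩
      map_add' := fun v v' => Subtype.ext (by
        change ∑ b, _ * ((v b).unop + (v' b).unop) = ∑ b, _ * (v b).unop + ∑ b, _ * (v' b).unop
        rw [← Finset.sum_add_distrib]
        exact Finset.sum_congr rfl fun b _ => mul_add _ _ _)
      map_smul' := fun c v => Subtype.ext (by
        change ∑ b, _ * ((v b).unop * c.unop) = (∑ b, _ * (v b).unop) * c.unop
        rw [Finset.sum_mul]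
        exact Finset.sum_congr rfl fun b _ => (mul_assoc _ _ _).symm) }
  refine Module.Projective.of_split i p (LinearMap.ext fun x => Subtype.ext ?_)
  have h1 := congrArg (fun γ : gammaRing I (m + 1) => γ.1 0 (Fin.last m)) (h (E x))
  refine Eq.trans ?_ (h1.trans ?_)
  · change ∑ b, (t b).1 0 (Fin.last m) * (ψ b).1 (E x) = _
    rw [AddSubmonoidClass.coe_finsetSum, Matrix.sum_apply]
    exact Finset.sum_congr rfl fun b _ => (Matrix.mul_single_apply_same _ _ _ _ _).symm
  · refine (Matrix.mul_single_apply_same _ _ _ _ _).trans ((mul_one _).trans ?_)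
    exact Matrix.single_apply_same 0 (Fin.last m) x.1

variable {I m} (R : Recollement (functorI I m) (functorE I m))

lemma Recollement.lHeightAtLeast_two (h : Module.Finite Λᵐᵒᵖ I)
    (h' : Module.Projective Λᵐᵒᵖ I) : R.LHeightAtLeast 2 :=
  have := (hasDualBasis_of_finite_of_projective I m h h').isRightAdjoint R.adj_l_e
  ⟨_, ⟨Adjunction.ofIsRightAdjoint R.l⟩, trivial⟩

lemma Recollement.projective_of_lHeightAtLeast_two (hm : 1 ≤ m) (h : R.LHeightAtLeast 2) :
    Module.Projective Λᵐᵒᵖ I := by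
  obtain ⟨l₁, ⟨adj⟩, -⟩ := h
  have : R.l.IsRightAdjoint := adj.isRightAdjoint
  exact (hasDualBasis_of_isRightAdjoint R.adj_l_e).projective hm

end LeftHeight

end

theorem proposition3 {Λ : Type u} [Ring Λ] (I : TwoSidedIdeal Λ) (m : ℕ) (hm : 1 ≤ m)
    [HasDerivedCategory.{w} (ModuleCat.{u} (sigmaRing I m))]
    [HasDerivedCategory.{w} (ModuleCat.{u} (gammaRing I (m + 1)))]
    [HasDerivedCategory.{w} (ModuleCat.{u} Λ)] :
    -- the recollement of module categories exists, and every such recollement satisfies (i)-(iv)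
    Nonempty (Recollement (functorI I m) (functorE I m)) ∧
    (∀ R : Recollement (functorI I m) (functorE I m),
      (IsHomologicalEmbedding (functorI I m) ∧ R.LHeightAtLeast 1 ∧ R.RHeightAtLeast 3) ∧
      (¬ Module.Projective Λ I → ¬ Module.Projective Λᵐᵒᵖ I →
        R.LHeightExactly 1 ∧ R.RHeightExactly 3) ∧
      (Module.Finite Λ I → Module.Projective Λ I →
        R.LHeightAtLeast 1 ∧ R.RHeightAtLeast 4) ∧
      (Module.Finite Λᵐᵒᵖ I → Module.Projective Λᵐᵒᵖ I →
        R.LHeightAtLeast 2 ∧ R.RHeightAtLeast 3)) ∧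
    -- the induced recollement of derived categories
    Nonempty (TriangulatedRecollement (functorI I m).mapDerivedCategory
      (functorE I m).mapDerivedCategory) ∧
    (HasDownwardLadder 4 (functorI I m).mapDerivedCategory (functorE I m).mapDerivedCategory →
      HasFiniteProjectiveDimension (ModuleCat.of Λ I)) ∧
    (HasFGProjectiveResolution (ModuleCat.of Λ I) →
      HasFiniteProjectiveDimension (ModuleCat.of Λ I) →
      HasDownwardLadder 4 (functorI I m).mapDerivedCategory
        (functorE I m).mapDerivedCategory) := by
  refine ⟨nonempty_recollement I m, fun R => ⟨⟨isHomologicalEmbedding_functorI I m, trivial,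
    R.rHeightAtLeast_three⟩, fun h h' => ⟨⟨trivial, fun hl => h'
      (R.projective_of_lHeightAtLeast_two hm hl)⟩, R.rHeightAtLeast_three, fun hr => h
      (R.projective_of_rHeightAtLeast_four hm hr)⟩, fun h h' => ⟨trivial,
      R.rHeightAtLeast_four h h'⟩, fun h h' => ⟨R.lHeightAtLeast_two h h',
      R.rHeightAtLeast_three⟩⟩, nonempty_triangulatedRecollement I m,
    fun h => ((hasDownwardLadder_iff I m hm).1 h).hasFiniteProjectiveDimension,
    fun h h' => (hasDownwardLadder_iff I m hm).2 (h.isCompactModule h')⟩
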